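/- **Conventions.** $\Lambda Z=\mathrm{diag}(1,1,1,-1)$, $R_z(\alpha)=\mathrm{diag}(1,e^{i\alpha})$, $|\pm_\alpha\rangle=(|0\rangle\pm e^{i\alpha}|1\rangle)/\sqrt2$, $|+\rangle=|+_0\rangle$; $H,X,Z$ are the Hadamard and Pauli matrices. Circuits and patterns act on a finite register $V$ of qubits with input and output qubits $I,O\subseteq V$ (which may overlap). The *depth* of a sequence of gates or commands is the length of a longest subsequence in which any two consecutive members are dependent. Two members are dependent if they act on a common qubit, or if the later one uses a measurement outcome produced by the earlier one; merely using the same outcome does not make two commands dependent (classical processing is free). *Circuits with unbounded fan-out* consist of gates $H$, $R_z(\alpha)$ ($\alpha\in\mathbb R$), $\Lambda Z$ and fan-out gates $|y_1,\dots,y_m,x\rangle\mapsto|y_1\oplus x,\dots,y_m\oplus x,x\rangle$ of any size. Non-input qubits start in $|0\rangle$; non-output qubits are measured at the end and their outcomes discarded (they are traced out). A unitary $U$ on $n$ qubits is in $\mathrm{UQNC}_f[d]$ if some such circuit of depth at most $d$ realises the operation $\rho\mapsto U\rho U^\dagger$. A state $|\phi\rangle$ is in $\mathrm{IQNC}_f[d]$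 if $|\phi\rangle=U|0\cdots0\rangle$ for some $U\in\mathrm{UQNC}_f[d]$. A linear map $M$ is in $\mathrm{OQNC}_f[d]$ if $UMU^\dagger$ is diagonal for some $U\in\mathrm{UQNC}_f[d]$. A *one-way measurement pattern* is a finite sequence of commands: $E_{ij}$ ($\Lambda Z$ on $i\neq j$), $M_i^\alpha$ (measurement of qubit $i$ in the basis $|\pm_\alpha\rangle$, $\alpha\in\mathbb R$, with outcome $s_i\in\{0,1\}$), and the corrections $X_i^\sigma$, $Z_i^\sigma$, where $\sigma$ is a sum modulo 2 of outcomes already obtained. No command acts on a measured qubit, and output qubits are not measured. Non-input qubits start in $|+\rangle$. A *classically controlled scheme* $(\mathcal I,\mathcal U,\mathcal O,\mathcal C)$ consists of sets of pure states, of unitaries, of two-outcome projective measurements (given by observables $M=M^\dagger$ with $M^2=1$, the eigenvalue $(-1)^s$ standing for outcome $s\in\{0,1\}$) and of unitary corrections, each on a finite number of qubits. A *pattern* of the scheme is a finite sequence of commands, each of which acts on distinct qubits of $V$: initialise some qubits in a state of $\mathcal I$; apply some $U\in\mathcal U$; perform a measurement from $\mathcal O$, recording its outcome; apply some $C\in\mathcal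 C$ exactly when a sum modulo 2 of previously recorded outcomes equals $1$. Non-input qubits have no default state: the pattern is required to be such that the final state of its outputs depends on the initial state of the register only through the input qubits (for instance, every non-input qubit is initialised before it is used). A pattern of either kind realises a quantum operation from its input register to its output register: one sums over all measurement outcomes and traces out the non-output qubits. A pattern is *implemented* by another one, with input and output registers identified with those of the first, if both realise the same operation. **Theorem.** Let $(\mathcal I,\mathcal U,\mathcal O,\mathcal C)$ be a classically controlled scheme for which there is a constant $d$ with $$\mathcal I\subseteq\mathrm{IQNC}_f[d],\quad \mathcal U\subseteq\mathrm{UQNC}_f[d],\quad \mathcal O\subseteq\mathrm{OQNC}_f[d],\quad \mathcal C\subseteq\mathrm{UQNC}_f[d]\cap\mathrm{OQNC}_f[d].$$ Then there is a constant $c$ such that every pattern $P$ of the scheme is implemented by a one-way measurement pattern $t$ with $\mathrm{depth}(t)\le c\cdot\mathrm{depth}(P)$. In particular there is such a constant for the ancilla-driven model, i.e. for the scheme $$\big(\{|+\rangle\},\ \{(H\otimes H)\circ\Lambda Z\},\ \{\{|+_\alpha\rangle,|-_\alpha\rangle\}:\alpha\in[0,2\pi)\},\ \{Z,X\}\big).$$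 -/

import Mathlib

open scoped Matrix

noncomputable section

namespace MBQC

/-! ### Qubit registers -/

/-- Computational basis labels of a register of qubits indexed by `V`. -/
abbrev Bits (V : Type) : Type := V → Fin 2

/-- Linear operators (in particular density operators) on a register of qubits. -/
abbrev Op (V : Type) : Type := Matrix (Bits V) (Bits V) ℂ

section Registers

variable {V W I : Type} [Fintype V] [DecidableEq V]

/-- The map `ρ ↦ A ρ A†`. -/
def conj (A ρ : Op V) : Op V := A * ρ * Aᴴ

/-- The one-qubit operator `A` acting on qubit `i` (identity on the other qubits). -/
def single (i : V) (A : Matrix (Fin 2) (Fin 2) ℂ) : Op V :=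
  Matrix.of fun x y => if ∀ v, v ≠ i → x v = y v then A (x i) (y i) else 0

open Classical in
/-- The operator `A` acting on the qubits selected by `e` (identity on the other qubits). -/
def embed (e : W ↪ V) (A : Op W) : Op V :=
  Matrix.of fun x y =>
    if ∀ v, v ∉ Set.range e → x v = y v then A (x ∘ e) (y ∘ e) else 0

/-- Controlled-Z on qubits `i`, `j`. -/
def cz (i j : V) : Op V :=
  Matrix.diagonal fun x => if x i = 1 ∧ x j = 1 then -1 else 1

/-- Fan-out: the control `c` is added modulo 2 to every qubit of `T`. -/
def fan (c : V) (T : Finset V) : Op V :=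
  Matrix.of fun x y => if x = (fun v => if v ∈ T then y v + y c else y v) then 1 else 0

open Classical in
/-- Reduced operator on the subregister selected by `e` (partial trace over all other qubits). -/
def reduce (e : W ↪ V) (ρ : Op V) : Op W :=
  Matrix.of fun x y =>
    ∑ u ∈ Finset.univ.filter (fun u : Bits V => u ∘ e = x), ρ u (Function.extend e y u)

open Classical in
/-- `ρ` on the qubits selected by `e`, every other qubit in the pure state `φ`. -/
def prepare (e : W ↪ V) (φ : Fin 2 → ℂ) (ρ : Op W) : Op V :=
  Matrix.of fun x y =>
    ρ (x ∘ e) (y ∘ e) *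
      ∏ v ∈ Finset.univ.filter (fun v => v ∉ Set.range e), (φ (x v) * star (φ (y v)))

/-- Put the qubits selected by `e` in the state `φ`, forgetting their previous contents:
`ρ ↦ |φ⟩⟨φ| ⊗ Tr_e ρ`. -/
def reset {n : ℕ} (e : Fin n ↪ V) (φ : Bits (Fin n) → ℂ) (ρ : Op V) : Op V :=
  Matrix.of fun x y =>
    φ (x ∘ e) * star (φ (y ∘ e)) *
      ∑ z : Bits (Fin n), ρ (Function.extend e z x) (Function.extend e z y)

end Registers

/-! ### One-qubit states and operators -/

def ket0 : Fin 2 → ℂ := ![1, 0]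

/-- `|+_α⟩` for `b = 0` and `|-_α⟩` for `b = 1`. -/
def ketAngle (α : ℝ) (b : Fin 2) : Fin 2 → ℂ :=
  ![(Real.sqrt 2 : ℂ)⁻¹, (Real.sqrt 2 : ℂ)⁻¹ * (-1) ^ (b : ℕ) * Complex.exp (α * Complex.I)]

def ketPlus : Fin 2 → ℂ := ketAngle 0 0

/-- The projector on `|±_α⟩`. -/
def projAngle (α : ℝ) (b : Fin 2) : Matrix (Fin 2) (Fin 2) ℂ :=
  Matrix.vecMulVec (ketAngle α b) (star (ketAngle α b))

def gateX : Matrix (Fin 2) (Fin 2) ℂ := !![0, 1; 1, 0]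

def gateZ : Matrix (Fin 2) (Fin 2) ℂ := !![1, 0; 0, -1]

def gateH : Matrix (Fin 2) (Fin 2) ℂ := (Real.sqrt 2 : ℂ)⁻¹ • !![1, 1; 1, -1]

def gateRz (α : ℝ) : Matrix (Fin 2) (Fin 2) ℂ := !![1, 0; 0, Complex.exp (α * Complex.I)]

/-! ### Depth -/

/-- The length of a longest subsequence of `A` in which any two consecutive members are
dependent. -/
def chainDepth {α : Type*} (dep : α → α → Prop) (A : List α) : ℕ :=
  sSup {n | ∃ l : List α, l.Sublist A ∧ l.IsChain dep ∧ l.length = n}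

/-! ### Quantum circuits with unbounded fan-out -/

/-- Gates; `fanout c T` has control `c` and any number of targets. -/
inductive Gate (V : Type) : Type
  | H (i : V)
  | Rz (i : V) (α : ℝ)
  | CZ (i j : V) (hij : i ≠ j)
  | fanout (c : V) (T : Finset V) (hc : c ∉ T)

namespace Gate

variable {V : Type}

def qubits : Gate V → Set V
  | H i => {i}
  | Rz i _ => {i}
  | CZ i j _ => {i, j}
  | fanout c T _ => insert c (T : Set V)

/-- Two gates are dependent when they share a qubit. -/
def Dep (g h : Gate V) : Prop := (g.qubits ∩ h.qubits).Nonempty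

def toOp [Fintype V] [DecidableEq V] : Gate V → Op V
  | H i => single i gateH
  | Rz i α => single i (gateRz α)
  | CZ i j _ => cz i j
  | fanout c T _ => fan c T

end Gate

/-- A circuit on the qubits `V` with input qubits `inp` and output qubits `out` (which may
overlap). The gates are listed in the order of execution. -/
structure Circuit (V I O : Type) where
  inp : I ↪ V
  out : O ↪ V
  gates : List (Gate V)

namespace Circuit

variable {V I O : Type}

def depth (C : Circuit V I O) : ℕ := chainDepth Gate.Dep C.gates

/-- Non-input qubits start in `|0⟩`; the gates are applied; the non-output qubits are measured in
the standard basis and forgotten, i.e. traced out. -/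
def channel [Fintype V] [DecidableEq V] (C : Circuit V I O) (ρ : Op I) : Op O :=
  reduce C.out (C.gates.foldl (fun τ g => conj g.toOp τ) (prepare C.inp ket0 ρ))

end Circuit

/-- Unitaries implementable by a circuit with unbounded fan-out of depth at most `d`. -/
def UQNCf (d n : ℕ) : Set (Op (Fin n)) :=
  {U | U ∈ Matrix.unitaryGroup (Bits (Fin n)) ℂ ∧
    ∃ (W : Type) (_ : Fintype W) (_ : DecidableEq W) (C : Circuit W (Fin n) (Fin n)),
      C.depth ≤ d ∧ ∀ ρ, C.channel ρ = conj U ρ}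

/-- States of the form `U|0…0⟩` with `U` implementable in depth `d`. -/
def IQNCf (d n : ℕ) : Set (Bits (Fin n) → ℂ) :=
  {φ | ∃ U ∈ UQNCf d n, φ = U *ᵥ Pi.single 0 1}

/-- Linear maps diagonalised by a unitary implementable in depth `d`. -/
def OQNCf (d n : ℕ) : Set (Op (Fin n)) :=
  {M | ∃ U ∈ UQNCf d n, (U * M * Uᴴ).IsDiag}

/-! ### One-way measurement patterns -/

/-- `E i j` is controlled-Z, `M i α` is the measurement of qubit `i` in the basis `|±_α⟩`, and
`X i σ`, `Z i σ` are Pauli corrections controlled by the sum modulo 2 of the outcomes of the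
qubits in `σ`. -/
inductive MCommand (V : Type) : Type
  | E (i j : V) (hij : i ≠ j)
  | M (i : V) (α : ℝ)
  | X (i : V) (σ : Finset V)
  | Z (i : V) (σ : Finset V)

namespace MCommand

variable {V : Type}

/-- The qubits on which a command acts. -/
def qubits : MCommand V → Set V
  | E i j _ => {i, j}
  | M i _ => {i}
  | X i _ => {i}
  | Z i _ => {i}

/-- The qubits whose outcome is produced by a command. -/
def writes : MCommand V → Set V
  | M i _ => {i}
  | _ => ∅

/-- The qubits whose outcome is used by a command. -/
def reads : MCommand V → Set V
  | X _ σ => σ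
  | Z _ σ => σ
  | _ => ∅

/-- A later command `q` depends on an earlier command `p` when they act on a common qubit, or `q`
uses an outcome produced by `p`. -/
def Dep (p q : MCommand V) : Prop :=
  (p.qubits ∩ q.qubits).Nonempty ∨ (p.writes ∩ q.reads).Nonempty

/-- Well-formedness of a sequence of commands (listed in the order of execution) once the qubits
of `m` have been measured: no command acts on a measured qubit, and a correction uses only
outcomes that are already available. -/
def WF (m : Set V) : List (MCommand V) → Prop
  | [] => True
  | p :: A => Disjoint p.qubits m ∧ p.reads ⊆ m ∧ WF (m ∪ p.writes) A

/-- Execution of a sequence of commands on the (unnormalised) state `ρ` with recorded outcomes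
`s`, summed over all outcomes of the measurements to come. A measured qubit is left in its
post-measurement state; in a well-formed pattern it is never used again. -/
def run [Fintype V] [DecidableEq V] : List (MCommand V) → (V → Fin 2) → Op V → Op V
  | [], _, ρ => ρ
  | E i j _ :: A, s, ρ => run A s (conj (cz i j) ρ)
  | M i α :: A, s, ρ =>
      ∑ b : Fin 2, run A (Function.update s i b) (conj (single i (projAngle α b)) ρ)
  | X i σ :: A, s, ρ => run A s (conj (single i (gateX ^ ((∑ j ∈ σ, s j : Fin 2) : ℕ))) ρ)
  | Z i σ :: A, s, ρ => run A s (conj (single i (gateZ ^ ((∑ j ∈ σ, s j : Fin 2) : ℕ))) ρ)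

end MCommand

/-- A (well-formed) measurement pattern on the qubits `V`, with inputs `inp` and outputs `out`
(which may overlap). -/
structure MPattern (V I O : Type) where
  inp : I ↪ V
  out : O ↪ V
  cmds : List (MCommand V)
  wf : MCommand.WF ∅ cmds
  out_not_measured : ∀ (o : O) (α : ℝ), MCommand.M (out o) α ∉ cmds

namespace MPattern

variable {V I O : Type}

def depth (t : MPattern V I O) : ℕ := chainDepth MCommand.Dep t.cmds

/-- The quantum operation from the input register to the output register realised by a pattern:
non-input qubits start in `|+⟩`, and the non-output qubits are forgotten at the end. -/
def channel [Fintype V] [DecidableEq V] (t : MPattern V I O) (ρ : Op I) : Op O :=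
  reduce t.out (MCommand.run t.cmds 0 (prepare t.inp ketPlus ρ))

end MPattern

/-! ### Classically controlled schemes -/

/-- A classically controlled scheme: sets of initial states, unitaries, two-outcome measurements
and corrections, on any number `n` of qubits. A measurement with outcomes in `{0, 1}` is given by
its observable, whose eigenvalue `(-1) ^ s` stands for the outcome `s`. -/
structure Scheme where
  states : (n : ℕ) → Set (Bits (Fin n) → ℂ)
  unitaries : (n : ℕ) → Set (Op (Fin n))
  measurements : (n : ℕ) → Set (Op (Fin n))
  corrections : (n : ℕ) → Set (Op (Fin n))
  states_norm : ∀ n, ∀ φ ∈ states n, ∑ x, ‖φ x‖ ^ 2 = 1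
  unitaries_unitary : ∀ n, ∀ U ∈ unitaries n, U ∈ Matrix.unitaryGroup (Bits (Fin n)) ℂ
  measurements_hermitian : ∀ n, ∀ M ∈ measurements n, M.IsHermitian
  measurements_sq : ∀ n, ∀ M ∈ measurements n, M * M = 1
  corrections_unitary : ∀ n, ∀ C ∈ corrections n, C ∈ Matrix.unitaryGroup (Bits (Fin n)) ℂ

/-- All ingredients of the scheme are in the constant-depth classes, with one depth bound for the
whole scheme. -/
def Scheme.ConstantDepth (S : Scheme) : Prop :=
  ∃ d : ℕ, ∀ n : ℕ,
    S.states n ⊆ IQNCf d n ∧ S.unitaries n ⊆ UQNCf d n ∧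
    S.measurements n ⊆ OQNCf d n ∧ S.corrections n ⊆ UQNCf d n ∩ OQNCf d n

/-- The projector of outcome `b` of the two-outcome observable `M`. -/
def outcomeProj {n : ℕ} (M : Op (Fin n)) (b : Fin 2) : Op (Fin n) :=
  (2 : ℂ)⁻¹ • (1 + (-1 : ℂ) ^ (b : ℕ) • M)

/-- Commands of a classically controlled pattern. Outcomes are named by natural numbers;
`correct e C _ σ` applies `C` when the sum modulo 2 of the outcomes named in `σ` is 1. -/
inductive CCCommand (S : Scheme) (V : Type) : Type
  | init {n : ℕ} (e : Fin n ↪ V) (φ : Bits (Fin n) → ℂ) (hφ : φ ∈ S.states n)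
  | unitary {n : ℕ} (e : Fin n ↪ V) (U : Op (Fin n)) (hU : U ∈ S.unitaries n)
  | measure {n : ℕ} (e : Fin n ↪ V) (M : Op (Fin n)) (hM : M ∈ S.measurements n) (k : ℕ)
  | correct {n : ℕ} (e : Fin n ↪ V) (C : Op (Fin n)) (hC : C ∈ S.corrections n) (σ : Finset ℕ)

namespace CCCommand

variable {S : Scheme} {V : Type}

/-- The qubits on which a command acts. -/
def qubits : CCCommand S V → Set V
  | init e _ _ => Set.range e
  | unitary e _ _ => Set.range e
  | measure e _ _ _ => Set.range e
  | correct e _ _ _ => Set.range e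

/-- The outcomes produced by a command. -/
def writes : CCCommand S V → Set ℕ
  | measure _ _ _ k => {k}
  | _ => ∅

/-- The outcomes used by a command. -/
def reads : CCCommand S V → Set ℕ
  | correct _ _ _ σ => σ
  | _ => ∅

/-- A later command `q` depends on an earlier command `p` when they act on a common qubit, or `q`
uses an outcome produced by `p`. -/
def Dep (p q : CCCommand S V) : Prop :=
  (p.qubits ∩ q.qubits).Nonempty ∨ (p.writes ∩ q.reads).Nonempty

/-- Well-formedness once the outcomes in `m` are available: distinct measurements have distinct
names, and a correction uses only available outcomes. -/
def WF (m : Set ℕ) : List (CCCommand S V) → Prop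
  | [] => True
  | p :: A => Disjoint p.writes m ∧ p.reads ⊆ m ∧ WF (m ∪ p.writes) A

/-- Execution of a sequence of commands on the (unnormalised) state `ρ` with recorded outcomes
`s`, summed over all outcomes of the measurements to come. Measurements are projective; measured
qubits may be used again. -/
def run [Fintype V] [DecidableEq V] : List (CCCommand S V) → (ℕ → Fin 2) → Op V → Op V
  | [], _, ρ => ρ
  | init e φ _ :: A, s, ρ => run A s (reset e φ ρ)
  | unitary e U _ :: A, s, ρ => run A s (conj (embed e U) ρ)
  | measure e M _ k :: A, s, ρ =>
      ∑ b : Fin 2, run A (Function.update s k b) (conj (embed e (outcomeProj M b)) ρ)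
  | correct e C _ σ :: A, s, ρ =>
      run A s (conj (embed e (C ^ ((∑ k ∈ σ, s k : Fin 2) : ℕ))) ρ)

end CCCommand

/-- A pattern of the scheme `S` on the qubits `V` with inputs `inp` and outputs `out` (which may
overlap). Non-input qubits have no default state: the final state of the outputs must depend on
the initial state of the register only through the input qubits. This holds as soon as every
non-input qubit is initialised before it is used. -/
structure CCPattern (S : Scheme) (V I O : Type) [Fintype V] [DecidableEq V] where
  inp : I ↪ V
  out : O ↪ V
  cmds : List (CCCommand S V)
  wf : CCCommand.WF ∅ cmds
  well_defined : ∀ τ τ' : Op V, reduce inp τ = reduce inp τ' →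
    reduce out (CCCommand.run cmds 0 τ) = reduce out (CCCommand.run cmds 0 τ')

namespace CCPattern

variable {S : Scheme} {V I O : Type} [Fintype V] [DecidableEq V]

def depth (P : CCPattern S V I O) : ℕ := chainDepth CCCommand.Dep P.cmds

/-- The quantum operation from the input register to the output register realised by a pattern.
By `well_defined`, the contents `|0⟩` of the non-input qubits is immaterial. -/
def channel (P : CCPattern S V I O) (ρ : Op I) : Op O :=
  reduce P.out (CCCommand.run P.cmds 0 (prepare P.inp ket0 ρ))

end CCPattern

/-! ### The ancilla-driven model -/

/-- The observable of the measurement in the basis `|±_α⟩`. -/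
def obsAngle (α : ℝ) : Matrix (Fin 2) (Fin 2) ℂ := projAngle α 0 - projAngle α 1

theorem single_mul {V : Type} [Fintype V] [DecidableEq V] (i : V)
    (A B : Matrix (Fin 2) (Fin 2) ℂ) : single i A * single i B = single i (A * B) := by
  ext x y
  simp only [single, Matrix.mul_apply, Matrix.of_apply]
  have hinj : Function.Injective (fun b : Fin 2 => Function.update x i b) :=
    Function.update_injective x i
  rw [← Finset.sum_subset (Finset.subset_univ (Finset.univ.map ⟨_, hinj⟩))]
  · rw [Finset.sum_map]
    by_cases h : ∀ v, v ≠ i → x v = y v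
    · rw [if_pos h]
      refine Finset.sum_congr rfl fun b _ => ?_
      have h1 : ∀ v, v ≠ i → x v = Function.update x i b v := fun v hv => by simp [hv]
      have h2 : ∀ v, v ≠ i → Function.update x i b v = y v := fun v hv => by simp [hv, h v hv]
      simp only [Function.Embedding.coeFn_mk]
      rw [if_pos h1, if_pos h2]
      simp
    · rw [if_neg h]
      refine Finset.sum_eq_zero fun b _ => ?_
      have h2 : ¬ ∀ v, v ≠ i → Function.update x i b v = y v := fun h' =>
        h fun v hv => by simpa [hv] using h' v hv
      simp only [Function.Embedding.coeFn_mk]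
      rw [if_neg h2, mul_zero]
  · intro z _ hz
    rw [if_neg, zero_mul]
    intro h
    apply hz
    simp only [Finset.mem_map, Finset.mem_univ, true_and, Function.Embedding.coeFn_mk]
    refine ⟨z i, ?_⟩
    funext v
    by_cases hv : v = i
    · subst hv; simp
    · simp [hv, h v hv]

theorem single_one {V : Type} [Fintype V] [DecidableEq V] (i : V) :
    single i (1 : Matrix (Fin 2) (Fin 2) ℂ) = 1 := by
  ext x y
  simp only [single, Matrix.of_apply, Matrix.one_apply]
  by_cases h : x = y
  · subst h; simp
  · rw [if_neg h]
    split_ifs with h1 h2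
    · exact absurd (funext fun v => if hv : v = i then hv ▸ h2 else h1 v hv) h
    · rfl
    · rfl

theorem single_conjTranspose {V : Type} [Fintype V] [DecidableEq V] (i : V)
    (A : Matrix (Fin 2) (Fin 2) ℂ) : (single i A)ᴴ = single i Aᴴ := by
  ext x y
  simp only [single, Matrix.of_apply, Matrix.conjTranspose_apply, eq_comm (a := x _),
    apply_ite star, star_zero]

theorem single_unitary {V : Type} [Fintype V] [DecidableEq V] (i : V)
    {A : Matrix (Fin 2) (Fin 2) ℂ} (h : A * Aᴴ = 1) :
    single i A ∈ Matrix.unitaryGroup (Bits V) ℂ := by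
  rw [Matrix.mem_unitaryGroup_iff, Matrix.star_eq_conjTranspose, single_conjTranspose,
    single_mul, h, single_one]

theorem cz_unitary {V : Type} [Fintype V] [DecidableEq V] (i j : V) :
    cz i j ∈ Matrix.unitaryGroup (Bits V) ℂ := by
  rw [Matrix.mem_unitaryGroup_iff, Matrix.star_eq_conjTranspose, cz,
    Matrix.diagonal_conjTranspose, Matrix.diagonal_mul_diagonal, ← Matrix.diagonal_one]
  congr 1
  funext x
  simp only [Pi.star_apply]
  split_ifs <;> simp

theorem sqrt_two_inv_mul_self : (Real.sqrt 2 : ℂ)⁻¹ * (Real.sqrt 2 : ℂ)⁻¹ = 2⁻¹ := by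
  rw [← mul_inv, ← Complex.ofReal_mul, Real.mul_self_sqrt (by norm_num)]
  norm_num

theorem gateH_mul : gateH * gateHᴴ = 1 := by
  ext a b
  have h := sqrt_two_inv_mul_self
  fin_cases a <;> fin_cases b <;>
    simp [gateH, Matrix.mul_apply, Fin.sum_univ_two, h] <;> norm_num

theorem obsAngle_eq (α : ℝ) :
    obsAngle α = !![0, Complex.exp (-(α * Complex.I)); Complex.exp (α * Complex.I), 0] := by
  have h := sqrt_two_inv_mul_self
  have hc : (starRingEnd ℂ) (Complex.exp (α * Complex.I)) = Complex.exp (-(α * Complex.I)) := by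
    rw [← Complex.exp_conj]; simp
  ext a b
  simp only [obsAngle, projAngle, Matrix.sub_apply, Matrix.vecMulVec_apply, Pi.star_apply]
  fin_cases a <;> fin_cases b <;> simp [ketAngle, hc]
  · linear_combination 2 * Complex.exp (-(α * Complex.I)) * h
  · linear_combination 2 * Complex.exp (α * Complex.I) * h

theorem obsAngle_hermitian (α : ℝ) : (obsAngle α)ᴴ = obsAngle α := by
  have hc : (starRingEnd ℂ) (Complex.exp (α * Complex.I)) = Complex.exp (-(α * Complex.I)) := by
    rw [← Complex.exp_conj]; simp
  rw [obsAngle_eq]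
  ext a b
  fin_cases a <;> fin_cases b <;> simp [← hc]

theorem obsAngle_sq (α : ℝ) : obsAngle α * obsAngle α = 1 := by
  rw [obsAngle_eq]
  ext a b
  fin_cases a <;> fin_cases b <;> simp [Matrix.mul_apply, Fin.sum_univ_two, ← Complex.exp_add]

/-- The ancilla-driven model: initial state `|+⟩`, interaction `(H ⊗ H) ∘ ΛZ`, measurements in
the bases `|±_α⟩`, corrections `Z` and `X`. -/
def ancillaDriven : Scheme where
  states
    | 1 => {fun x => ketPlus (x 0)}
    | _ => ∅
  unitaries
    | 2 => {single 0 gateH * single 1 gateH * cz 0 1}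
    | _ => ∅
  measurements
    | 1 => {M | ∃ α ∈ Set.Ico (0 : ℝ) (2 * Real.pi), M = single 0 (obsAngle α)}
    | _ => ∅
  corrections
    | 1 => {single 0 gateZ, single 0 gateX}
    | _ => ∅
  states_norm := by
    rintro (_ | _ | n) φ hφ
    · exact hφ.elim
    · obtain rfl : φ = fun x => ketPlus (x 0) := hφ
      rw [← (Equiv.funUnique (Fin 1) (Fin 2)).symm.sum_comp, Fin.sum_univ_two]
      simp [ketPlus, ketAngle]
      norm_num
    · exact hφ.elim
  unitaries_unitary := by
    rintro (_ | _ | _ | n) U hU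
    · exact hU.elim
    · exact hU.elim
    · obtain rfl : U = single 0 gateH * single 1 gateH * cz 0 1 := hU
      exact mul_mem (mul_mem (single_unitary _ gateH_mul) (single_unitary _ gateH_mul))
        (cz_unitary _ _)
    · exact hU.elim
  measurements_hermitian := by
    rintro (_ | _ | n) M hM
    · exact hM.elim
    · obtain ⟨α, -, rfl⟩ := hM
      rw [Matrix.IsHermitian, single_conjTranspose, obsAngle_hermitian]
    · exact hM.elim
  measurements_sq := by
    rintro (_ | _ | n) M hM
    · exact hM.elim
    · obtain ⟨α, -, rfl⟩ := hM
      rw [single_mul, obsAngle_sq, single_one]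
    · exact hM.elim
  corrections_unitary := by
    rintro (_ | _ | n) C hC
    · exact hC.elim
    · rcases hC with rfl | rfl
      · refine single_unitary _ ?_
        ext a b
        fin_cases a <;> fin_cases b <;> simp [gateZ, Matrix.mul_apply, Fin.sum_univ_two]
      · refine single_unitary _ ?_
        ext a b
        fin_cases a <;> fin_cases b <;> simp [gateX, Matrix.mul_apply, Fin.sum_univ_two]
    · exact hC.elim

end MBQC

end

/-!
# Classically controlled schemes of constant depth and one-way measurement patterns

A classically controlled pattern is compiled command by command. It suffices that every command
becomes a block of bounded depth, and that commands of different blocks are dependent only when the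
original commands are: a chain of dependent commands then visits the blocks along a chain of the
original pattern (`chainDepth_flatMap_le`), so that depths multiply. The second condition is met
because every block has ancillas of its own.

The compilation goes through programs in an intermediate language `Instr`, whose instructions act in
place on a register: resets to `|+⟩`, Hadamard gates, diagonal unitaries on any number of qubits,
measurements in the basis `|±⟩`, and classically controlled `X`.

*From programs to measurement patterns* (`exists_sim`). Hadamard gates are teleportations through an
edge to a fresh qubit. A diagonal unitary on any number of qubits has constant depth: by Fourier
expansion its phase is a sum of phases `θ T` times the parity of the qubits in `T`
(`exists_parity_expansion`), up to a global phase. All these parities are computed at once by a grid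
of ancillas (`grid`): rows carry copies of the data qubits, columns accumulate parities, and each
relation between neighbours in the grid is imposed by measuring a constraint qubit joined to them by
edges. The unwanted outcomes shift the solution of the linear system by known bits, which are
corrected by one layer of classically controlled `X`, as classical processing is free. The qubits at
the ends of the columns are then measured at the angles `θ T`, and one layer of `Z` on the data
undoes the effect of the outcomes (`XorNet.run_cmds`).

*From circuits to programs* (`hasImpl_unitary`). A fan-out gate is diagonal between two layers of
Hadamard gates, and so is the exchange of data with ancillas, up to three repetitions. If a circuit
realises a unitary `U` after discarding qubits, then the discarded qubits end in a state that does
not depend on the input (`exists_factor_of_reduce_eq`), so `U` is applied in place by exchanging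
the data with the circuit's input, running the circuit, and exchanging the data back.

*Measurements and corrections.* If `U M U†` is diagonal and `U` has constant depth, then `M` can be
applied under the control of one more qubit in constant depth: run the circuit for `U`, apply the
diagonal phases under control, and run the inverse circuit, which also restores the ancillas
(`hasImpl_ctrl`). With the control in `|+⟩` and measured in `|±⟩` this measures the observable `M`
(`hasImpl_measure`); with the control in a basis state, set by a classically controlled `X`, it is a
classically controlled correction (`hasImpl_correct`).
-/

noncomputable section

set_option linter.unusedSectionVars false

namespace MBQC

/-! ### Subregisters -/

section Sub

variable {U V W : Type}

theorem extend_comp_self (e : W ↪ V) (a : Bits W) (x : Bits V) :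
    Function.extend e a x ∘ e = a :=
  Function.extend_comp e.injective a x

theorem extend_apply_range (e : W ↪ V) (a : Bits W) (x : Bits V) (w : W) :
    Function.extend e a x (e w) = a w :=
  e.injective.extend_apply a x w

theorem extend_apply_notMem (e : W ↪ V) (a : Bits W) (x : Bits V) {v : V}
    (hv : v ∉ Set.range e) : Function.extend e a x v = x v :=
  Function.extend_apply' a x v hv

theorem extend_extend (e : W ↪ V) (a b : Bits W) (x : Bits V) :
    Function.extend e a (Function.extend e b x) = Function.extend e a x := by
  funext v
  by_cases hv : v ∈ Set.range e
  · obtain ⟨w, rfl⟩ := hv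
    simp only [extend_apply_range]
  · simp only [extend_apply_notMem e _ _ hv]

theorem extend_self (e : W ↪ V) (x : Bits V) : Function.extend e (x ∘ e) x = x := by
  funext v
  by_cases hv : v ∈ Set.range e
  · obtain ⟨w, rfl⟩ := hv
    simp only [extend_apply_range, Function.comp_apply]
  · simp only [extend_apply_notMem e _ _ hv]

/-- `Function.extend e a x` is the label `x` with the entries of the subregister replaced by `a`. -/
theorem agree_iff (e : W ↪ V) (x z : Bits V) :
    (∀ v, v ∉ Set.range e → x v = z v) ↔ z = Function.extend e (z ∘ e) x := by
  constructor
  · intro h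
    funext v
    by_cases hv : v ∈ Set.range e
    · obtain ⟨w, rfl⟩ := hv
      simp only [extend_apply_range, Function.comp_apply]
    · rw [extend_apply_notMem e _ _ hv, h v hv]
  · intro h v hv
    rw [h, extend_apply_notMem e _ _ hv]

theorem comp_eq_iff (e : W ↪ V) (u : Bits V) (a : Bits W) (x : Bits V) :
    u ∘ e = a ∧ (∀ v, v ∉ Set.range e → x v = u v) ↔ u = Function.extend e a x := by
  constructor
  · rintro ⟨rfl, h⟩
    exact (agree_iff e x u).1 h
  · rintro rfl
    exact ⟨extend_comp_self e a x, fun v hv => (extend_apply_notMem e _ _ hv).symm⟩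

variable [Fintype V] [DecidableEq V]

/-- A sum over the labels that agree with `x` off a subregister runs over the labels of the
subregister. -/
theorem sum_agree [Fintype W] [DecidableEq W] {M : Type*} [AddCommMonoid M] (e : W ↪ V)
    (x : Bits V) (F : Bits V → M) [DecidablePred fun z : Bits V =>
      ∀ v, v ∉ Set.range e → x v = z v] :
    (∑ z : Bits V, if ∀ v, v ∉ Set.range e → x v = z v then F z else 0)
      = ∑ a : Bits W, F (Function.extend e a x) := by
  rw [← Finset.sum_filter]
  refine Finset.sum_bij' (fun z _ => z ∘ e) (fun a _ => Function.extend e a x) ?_ ?_ ?_ ?_ ?_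
  · intros; exact Finset.mem_univ _
  · intro a _
    rw [Finset.mem_filter]
    exact ⟨Finset.mem_univ _, fun v hv => (extend_apply_notMem e _ _ hv).symm⟩
  · intro z hz
    rw [Finset.mem_filter] at hz
    exact ((agree_iff e x z).1 hz.2).symm
  · intro a _
    exact extend_comp_self e a x
  · intro z hz
    rw [Finset.mem_filter] at hz
    rw [← (agree_iff e x z).1 hz.2]

theorem embed_apply (e : W ↪ V) (A : Op W) (x y : Bits V)
    [Decidable (∀ v, v ∉ Set.range e → x v = y v)] :
    embed e A x y = if ∀ v, v ∉ Set.range e → x v = y v then A (x ∘ e) (y ∘ e) else 0 := by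
  rw [embed, Matrix.of_apply]
  congr!

theorem reduce_apply (e : W ↪ V) (ρ : Op V) (x y : Bits W)
    [DecidablePred fun u : Bits V => u ∘ e = x] :
    reduce e ρ x y = ∑ u : Bits V, if u ∘ e = x then ρ u (Function.extend e y u) else 0 := by
  rw [reduce, Matrix.of_apply, Finset.sum_filter]
  congr!

theorem prepare_apply (e : W ↪ V) (φ : Fin 2 → ℂ) (ρ : Op W) (x y : Bits V)
    [DecidablePred fun v => v ∈ Set.range e] :
    prepare e φ ρ x y =
      ρ (x ∘ e) (y ∘ e) * ∏ v, if v ∈ Set.range e then 1 else φ (x v) * star (φ (y v)) := by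
  rw [prepare, Matrix.of_apply, Finset.prod_filter]
  congr 1
  refine Finset.prod_congr rfl fun v _ => ?_
  by_cases hv : v ∈ Set.range e
  · rw [if_neg (not_not.2 hv), if_pos hv]
  · rw [if_pos hv, if_neg hv]

theorem embed_mul_apply [Fintype W] [DecidableEq W] {X : Type*} (e : W ↪ V) (A : Op W)
    (N : Matrix (Bits V) X ℂ) (x : Bits V) (y : X) :
    (embed e A * N) x y = ∑ a : Bits W, A (x ∘ e) a * N (Function.extend e a x) y := by
  classical
  rw [Matrix.mul_apply]
  simp only [embed_apply, ite_mul, zero_mul]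
  rw [sum_agree e x (fun z => A (x ∘ e) (z ∘ e) * N z y)]
  simp only [extend_comp_self]

theorem embed_mul [Fintype W] [DecidableEq W] (e : W ↪ V) (A B : Op W) :
    embed e A * embed e B = embed e (A * B) := by
  classical
  ext x y
  rw [embed_mul_apply]
  have h : ∀ a : Bits W, (∀ v, v ∉ Set.range e → Function.extend e a x v = y v) ↔
      (∀ v, v ∉ Set.range e → x v = y v) := fun a =>
    forall₂_congr fun v hv => by rw [extend_apply_notMem e _ _ hv]
  simp only [embed_apply, h, extend_comp_self, Matrix.mul_apply]
  split_ifs <;> simp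

theorem embed_one [Fintype W] [DecidableEq W] (e : W ↪ V) : embed e (1 : Op W) = 1 := by
  classical
  ext x y
  rw [embed_apply, Matrix.one_apply, Matrix.one_apply]
  by_cases hxy : x = y
  · subst hxy; simp
  · rw [if_neg hxy]
    split_ifs with h1 h2
    · exact absurd (((agree_iff e x y).1 h1).trans (h2 ▸ extend_self e x)).symm hxy
    · rfl
    · rfl

theorem embed_conjTranspose (e : W ↪ V) (A : Op W) : (embed e A)ᴴ = embed e Aᴴ := by
  classical
  ext x y
  simp only [Matrix.conjTranspose_apply, embed_apply, eq_comm (a := x _), apply_ite star, star_zero]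

theorem embed_smul (e : W ↪ V) (c : ℂ) (A : Op W) : embed e (c • A) = c • embed e A := by
  classical
  ext x y
  simp [embed_apply]

theorem embed_add (e : W ↪ V) (A B : Op W) : embed e (A + B) = embed e A + embed e B := by
  classical
  ext x y
  simp only [embed_apply, Matrix.add_apply]
  split_ifs <;> simp

theorem embed_trans [Fintype W] [DecidableEq W] (e : U ↪ W) (f : W ↪ V) (A : Op U) :
    embed (e.trans f) A = embed f (embed e A) := by
  classical
  ext x y
  simp only [embed_apply]
  by_cases h1 : ∀ v, v ∉ Set.range f → x v = y v
  · rw [if_pos h1]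
    refine if_congr ?_ rfl rfl
    constructor
    · intro h w hw
      refine h _ fun ⟨u, hu⟩ => hw ⟨u, f.injective hu⟩
    · intro h v hv
      by_cases hv' : v ∈ Set.range f
      · obtain ⟨w, rfl⟩ := hv'
        exact h w fun ⟨u, hu⟩ => hv ⟨u, by simp [hu]⟩
      · exact h1 v hv'
  · rw [if_neg h1, if_neg]
    intro h
    exact h1 fun v hv => h v fun ⟨u, hu⟩ => hv ⟨e u, hu⟩

theorem embed_single [Fintype W] [DecidableEq W] (e : W ↪ V) (i : W)
    (A : Matrix (Fin 2) (Fin 2) ℂ) : embed e (single i A) = single (e i) A := by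
  classical
  ext x y
  simp only [embed_apply, single, Matrix.of_apply, Function.comp_apply]
  rw [← ite_and]
  refine if_congr ?_ rfl rfl
  constructor
  · rintro ⟨h1, h2⟩ v hv
    by_cases hv' : v ∈ Set.range e
    · obtain ⟨w, rfl⟩ := hv'
      exact h2 w fun h => hv (by rw [h])
    · exact h1 v hv'
  · intro h
    exact ⟨fun v hv => h v fun h' => hv ⟨i, h'.symm⟩, fun w hw => h _ fun h' => hw (e.injective h')⟩

theorem embed_diagonal [Fintype W] [DecidableEq W] (e : W ↪ V) (d : Bits W → ℂ) :
    embed e (Matrix.diagonal d) = Matrix.diagonal fun x => d (x ∘ e) := by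
  classical
  ext x y
  rw [embed_apply, Matrix.diagonal_apply, Matrix.diagonal_apply]
  by_cases hxy : x = y
  · subst hxy; simp
  · rw [if_neg hxy]
    split_ifs with h1 h2
    · exact absurd (((agree_iff e x y).1 h1).trans (h2 ▸ extend_self e x)).symm hxy
    · rfl
    · rfl

theorem embed_cz [Fintype W] [DecidableEq W] (e : W ↪ V) (i j : W) :
    embed e (cz i j) = cz (e i) (e j) := by
  rw [cz, embed_diagonal]; rfl

/-- `ρ ↦ Tr_{V∖W} ρ` is dual to `A ↦ A ⊗ 1`. Through this duality, rules for `reduce` follow from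
those for `embed`. -/
theorem trace_mul_reduce [Fintype W] [DecidableEq W] (e : W ↪ V) (A : Op W) (ρ : Op V) :
    (A * reduce e ρ).trace = (embed e A * ρ).trace := by
  classical
  simp only [Matrix.trace, Matrix.diag_apply, embed_mul_apply]
  have h1 : ∀ a, (A * reduce e ρ) a a
      = ∑ u : Bits V, A a (u ∘ e) * ρ u (Function.extend e a u) := by
    intro a
    rw [Matrix.mul_apply]
    simp only [reduce_apply, Finset.mul_sum, mul_ite, mul_zero]
    rw [Finset.sum_comm]
    refine Finset.sum_congr rfl fun u _ => ?_
    rw [Finset.sum_ite_eq, if_pos (Finset.mem_univ _)]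
  simp only [h1]
  rw [Finset.sum_comm, ← Finset.sum_product', ← Finset.sum_product']
  -- exchange the entries of the two labels on the subregister
  refine Finset.sum_bij' (fun p _ => (Function.extend e p.2 p.1, p.1 ∘ e))
    (fun p _ => (Function.extend e p.2 p.1, p.1 ∘ e)) ?_ ?_ ?_ ?_ ?_
  · intros; simp
  · intros; simp
  · rintro ⟨x, a⟩ _
    simp only [extend_extend, extend_self, extend_comp_self]
  · rintro ⟨x, a⟩ _
    simp only [extend_extend, extend_self, extend_comp_self]
  · rintro ⟨x, a⟩ _
    simp only [extend_extend, extend_self, extend_comp_self]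

theorem ext_trace [Fintype W] [DecidableEq W] {ρ σ : Op W}
    (h : ∀ A : Op W, (A * ρ).trace = (A * σ).trace) : ρ = σ :=
  Matrix.ext_iff_trace_mul_left.2 h

theorem reduce_eq_iff [Fintype W] [DecidableEq W] (e : W ↪ V) (ρ : Op V) (σ : Op W)
    (h : ∀ A : Op W, (embed e A * ρ).trace = (A * σ).trace) : reduce e ρ = σ :=
  ext_trace fun A => by rw [trace_mul_reduce, h]

theorem reduce_conj_embed [Fintype W] [DecidableEq W] (e : W ↪ V) (B : Op W) (ρ : Op V) :
    reduce e (conj (embed e B) ρ) = conj B (reduce e ρ) := by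
  refine reduce_eq_iff e _ _ fun A => ?_
  rw [conj, conj, embed_conjTranspose, ← Matrix.mul_assoc, Matrix.trace_mul_comm,
    ← Matrix.mul_assoc, ← Matrix.mul_assoc, embed_mul, embed_mul, ← trace_mul_reduce,
    ← Matrix.mul_assoc, Matrix.trace_mul_comm (A * _) Bᴴ, ← Matrix.mul_assoc, ← Matrix.mul_assoc]

theorem reduce_trans [Fintype W] [DecidableEq W] (e : U ↪ W) (f : W ↪ V) (ρ : Op V) :
    reduce (e.trans f) ρ = reduce e (reduce f ρ) := by
  classical
  have : Fintype U := Fintype.ofInjective e e.injective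
  refine reduce_eq_iff _ _ _ fun A => ?_
  rw [trace_mul_reduce, trace_mul_reduce, embed_trans]

theorem reduce_refl (ρ : Op V) : reduce (Function.Embedding.refl V) ρ = ρ := by
  classical
  refine reduce_eq_iff _ _ _ fun A => ?_
  congr 2
  ext x y
  rw [embed_apply, if_pos fun v hv => absurd ⟨v, rfl⟩ hv]
  rfl

theorem reduce_add (e : W ↪ V) (ρ σ : Op V) : reduce e (ρ + σ) = reduce e ρ + reduce e σ := by
  ext x y
  simp only [reduce, Matrix.of_apply, Matrix.add_apply, Finset.sum_add_distrib]

/-- Partial trace as an additive map. -/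
def reduceHom (e : W ↪ V) : Op V →+ Op W where
  toFun := reduce e
  map_zero' := by ext x y; simp [reduce]
  map_add' := reduce_add e

@[simp] theorem reduceHom_apply (e : W ↪ V) (ρ : Op V) : reduceHom e ρ = reduce e ρ := rfl

theorem reduce_sum {ι : Type*} (e : W ↪ V) (s : Finset ι) (ρ : ι → Op V) :
    reduce e (∑ i ∈ s, ρ i) = ∑ i ∈ s, reduce e (ρ i) :=
  map_sum (reduceHom e) ρ s

theorem conj_add (A ρ σ : Op V) : conj A (ρ + σ) = conj A ρ + conj A σ := by
  simp [conj, Matrix.mul_add, Matrix.add_mul]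

theorem conj_conj (A B ρ : Op V) : conj A (conj B ρ) = conj (A * B) ρ := by
  simp [conj, Matrix.mul_assoc]

theorem conj_one (ρ : Op V) : conj 1 ρ = ρ := by simp [conj]

/-- `ρ ↦ A ρ A†` as an additive map. -/
def conjHom (A : Op V) : Op V →+ Op V where
  toFun := conj A
  map_zero' := by simp [conj]
  map_add' := conj_add A

@[simp]
theorem conjHom_apply (A ρ : Op V) : conjHom A ρ = conj A ρ := rfl

/-! ### Preparation of ancillas -/

open Classical in
/-- The isometry `ψ ↦ ψ ⊗ φ^⊗`, with `ψ` on the qubits selected by `e` and `φ` on every other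
qubit. -/
def inj (e : W ↪ V) (φ : Fin 2 → ℂ) : Matrix (Bits V) (Bits W) ℂ :=
  Matrix.of fun x a =>
    if x ∘ e = a then ∏ v, if v ∈ Set.range e then 1 else φ (x v) else 0

theorem inj_apply (e : W ↪ V) (φ : Fin 2 → ℂ) (x : Bits V) (a : Bits W)
    [DecidablePred fun v => v ∈ Set.range e] [Decidable (x ∘ e = a)] :
    inj e φ x a = if x ∘ e = a then ∏ v, if v ∈ Set.range e then 1 else φ (x v) else 0 := by
  rw [inj, Matrix.of_apply]
  congr!

theorem prepare_eq [Fintype W] [DecidableEq W] (e : W ↪ V) (φ : Fin 2 → ℂ) (ρ : Op W) :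
    prepare e φ ρ = inj e φ * ρ * (inj e φ)ᴴ := by
  classical
  ext x y
  simp only [Matrix.mul_apply, inj_apply, Matrix.conjTranspose_apply, ite_mul, zero_mul,
    apply_ite star, star_zero, mul_ite, mul_zero, Finset.sum_ite_eq, Finset.mem_univ, if_true,
    prepare_apply]
  rw [star_prod, mul_comm (∏ _, _) (ρ _ _), mul_assoc, ← Finset.prod_mul_distrib]
  congr 1
  refine Finset.prod_congr rfl fun v _ => ?_
  split_ifs <;> simp

theorem embed_mul_inj [Fintype W] [DecidableEq W] (e : W ↪ V) (φ : Fin 2 → ℂ) (A : Op W) :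
    embed e A * inj e φ = inj e φ * A := by
  classical
  ext x a
  rw [embed_mul_apply, Matrix.mul_apply]
  simp only [inj_apply, extend_comp_self, mul_ite, mul_zero, ite_mul, zero_mul,
    Finset.sum_ite_eq', Finset.sum_ite_eq, Finset.mem_univ, if_true]
  rw [mul_comm]
  congr 1
  refine Finset.prod_congr rfl fun v _ => ?_
  split_ifs with hv
  · rfl
  · rw [extend_apply_notMem e _ _ hv]

/-- Operations on a subregister commute with the preparation of the other qubits. -/
theorem conj_embed_prepare [Fintype W] [DecidableEq W] (e : W ↪ V) (φ : Fin 2 → ℂ) (A ρ : Op W) :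
    conj (embed e A) (prepare e φ ρ) = prepare e φ (conj A ρ) := by
  have h : (inj e φ)ᴴ * (embed e A)ᴴ = Aᴴ * (inj e φ)ᴴ := by
    rw [← Matrix.conjTranspose_mul, embed_mul_inj, Matrix.conjTranspose_mul]
  rw [prepare_eq, prepare_eq, conj, conj]
  calc _ = embed e A * inj e φ * ρ * ((inj e φ)ᴴ * (embed e A)ᴴ) := by
        simp only [Matrix.mul_assoc]
    _ = _ := by rw [h, embed_mul_inj]; simp only [Matrix.mul_assoc]

theorem prepare_trans [Fintype W] [DecidableEq W] (e : U ↪ W) (f : W ↪ V) (φ : Fin 2 → ℂ)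
    (ρ : Op U) : prepare (e.trans f) φ ρ = prepare f φ (prepare e φ ρ) := by
  classical
  ext x y
  simp only [prepare_apply]
  rw [mul_assoc]
  congr 1
  have h : ∏ w, (if w ∈ Set.range e then 1 else φ ((x ∘ f) w) * star (φ ((y ∘ f) w)))
      = ∏ v, if v ∈ Set.range f ∧ v ∉ Set.range (e.trans f)
          then φ (x v) * star (φ (y v)) else 1 := by
    rw [← Finset.prod_subset (Finset.subset_univ (Finset.univ.map f)), Finset.prod_map]
    · refine Finset.prod_congr rfl fun w _ => ?_
      have : f w ∈ Set.range (e.trans f) ↔ w ∈ Set.range e :=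
        ⟨fun ⟨u, hu⟩ => ⟨u, f.injective hu⟩, fun ⟨u, hu⟩ => ⟨u, by simp [hu]⟩⟩
      simp only [this, Set.mem_range_self, true_and, ite_not, Function.comp_apply]
    · intro v _ hv
      rw [if_neg]
      rintro ⟨⟨w, rfl⟩, -⟩
      exact hv (Finset.mem_map_of_mem f (Finset.mem_univ w))
  rw [h, ← Finset.prod_mul_distrib]
  refine Finset.prod_congr rfl fun v _ => ?_
  by_cases h1 : v ∈ Set.range f
  · by_cases h2 : v ∈ Set.range (e.trans f)
    · simp only [h1, h2, if_true, not_true, and_false, if_false, mul_one]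
    · simp only [h1, h2, if_true, not_false_eq_true, and_self, if_false, mul_one]
  · have h2 : v ∉ Set.range (e.trans f) := fun ⟨u, hu⟩ => h1 ⟨e u, hu⟩
    simp only [h1, h2, if_false, false_and, one_mul]

theorem prepare_refl (φ : Fin 2 → ℂ) (ρ : Op V) :
    prepare (Function.Embedding.refl V) φ ρ = ρ := by
  classical
  ext x y
  have h : ∀ v : V, v ∈ Set.range (Function.Embedding.refl V) := fun v => ⟨v, rfl⟩
  simp only [prepare_apply, h, if_true, Finset.prod_const_one, mul_one]
  rfl

/-- Discarding freshly prepared qubits restores the state. -/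
theorem reduce_prepare (e : W ↪ V) {φ : Fin 2 → ℂ}
    (hφ : ∑ b, φ b * star (φ b) = 1) (ρ : Op W) : reduce e (prepare e φ ρ) = ρ := by
  classical
  ext x y
  simp only [reduce_apply, prepare_apply]
  have key : ∀ u : Bits V, (if u ∘ e = x then ρ (u ∘ e) (Function.extend e y u ∘ e) *
      ∏ v, (if v ∈ Set.range e then 1 else
        φ (u v) * star (φ (Function.extend e y u v))) else 0) =
      ρ x y * ∏ v, if v ∈ Set.range e then
        (if u v = Function.extend e x 0 v then 1 else 0) else φ (u v) * star (φ (u v)) := by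
    intro u
    rw [extend_comp_self]
    by_cases hu : u ∘ e = x
    · rw [if_pos hu, hu]
      congr 1
      refine Finset.prod_congr rfl fun v _ => ?_
      by_cases hv : v ∈ Set.range e
      · rw [if_pos hv, if_pos hv, if_pos]
        obtain ⟨w, rfl⟩ := hv
        rw [extend_apply_range, ← hu, Function.comp_apply]
      · rw [if_neg hv, if_neg hv, extend_apply_notMem e _ _ hv]
    · rw [if_neg hu]
      obtain ⟨w, hw⟩ := Function.ne_iff.1 hu
      rw [Finset.prod_eq_zero (Finset.mem_univ (e w)), mul_zero]
      rw [if_pos ⟨w, rfl⟩, if_neg]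
      rw [extend_apply_range]
      exact hw
  simp only [key, ← Finset.mul_sum]
  have := (Finset.prod_univ_sum (fun _ : V => (Finset.univ : Finset (Fin 2)))
    (fun v b => if v ∈ Set.range e then
        (if b = Function.extend e x 0 v then (1 : ℂ) else 0) else φ b * star (φ b)))
  rw [Fintype.piFinset_univ] at this
  rw [← this, Finset.prod_eq_one, mul_one]
  intro v _
  split_ifs
  · simp
  · exact hφ

/-- Discarding qubits of the given register commutes with adding ancillas to it. -/
theorem reduce_sumMap_prepare {A : Type} [Fintype A] [DecidableEq A]
    [Fintype W] [DecidableEq W] (e : W ↪ V) (φ : Fin 2 → ℂ) (ρ : Op V) :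
    reduce (e.sumMap (Function.Embedding.refl A)) (prepare (V := V ⊕ A) .inl φ ρ)
      = prepare (V := W ⊕ A) .inl φ (reduce e ρ) := by
  classical
  have hr : ∀ (X : Type) [Fintype X] [DecidableEq X] (p : X ⊕ A → ℂ),
      ∏ v : X ⊕ A, (if v ∈ Set.range (Function.Embedding.inl : X ↪ X ⊕ A) then 1 else p v)
        = ∏ a : A, p (.inr a) := by
    intro X _ _ p
    rw [Fintype.prod_sum_type]
    simp
  ext x y
  simp only [reduce_apply, prepare_apply, hr, Finset.sum_mul]
  rw [← Finset.sum_filter]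
  simp only [ite_mul, zero_mul]
  rw [← Finset.sum_filter]
  refine Finset.sum_bij' (fun u _ => u ∘ Sum.inl)
    (fun u _ => Sum.elim u (x ∘ Sum.inr)) ?_ ?_ ?_ ?_ ?_
  · intro u hu
    rw [Finset.mem_filter] at hu ⊢
    exact ⟨Finset.mem_univ _, by rw [← hu.2]; rfl⟩
  · intro u hu
    rw [Finset.mem_filter] at hu ⊢
    refine ⟨Finset.mem_univ _, ?_⟩
    funext v
    rcases v with v | v
    · exact congrFun hu.2 v
    · rfl
  · intro u hu
    rw [Finset.mem_filter] at hu
    funext v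
    rcases v with v | v
    · rfl
    · exact (congrFun hu.2 (Sum.inr v)).symm
  · intro u _; rfl
  · intro u hu
    rw [Finset.mem_filter] at hu
    have h1 : ∀ a : A, u (Sum.inr a) = x (Sum.inr a) := fun a => congrFun hu.2 (Sum.inr a)
    have h2 : ∀ a : A, Function.extend (e.sumMap (Function.Embedding.refl A)) y u (Sum.inr a)
        = y (Sum.inr a) := fun a =>
      extend_apply_range (e.sumMap (Function.Embedding.refl A)) y u (Sum.inr a)
    simp only [h1, h2]
    congr 2
    funext v
    by_cases hv : v ∈ Set.range e
    · obtain ⟨w, rfl⟩ := hv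
      rw [extend_apply_range]
      exact extend_apply_range (e.sumMap (Function.Embedding.refl A)) y u (Sum.inl w)
    · rw [extend_apply_notMem e _ _ hv]
      refine extend_apply_notMem (e.sumMap (Function.Embedding.refl A)) y u (v := Sum.inl v) ?_
      rintro ⟨w | w, hw⟩
      · exact hv ⟨w, Sum.inl_injective hw⟩
      · cases hw

end Sub

/-! ### Depth of composite sequences -/

section Depth

variable {α β : Type*} {dep : α → α → Prop}

theorem chainDepth_le {A : List α} {d : ℕ}
    (h : ∀ l : List α, l.Sublist A → l.IsChain dep → l.length ≤ d) : chainDepth dep A ≤ d := by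
  refine csSup_le ⟨0, [], List.nil_sublist A, List.isChain_nil, rfl⟩ ?_
  rintro n ⟨l, h1, h2, rfl⟩
  exact h l h1 h2

theorem le_chainDepth {A l : List α} (h1 : l.Sublist A) (h2 : l.IsChain dep) :
    l.length ≤ chainDepth dep A := by
  refine le_csSup ⟨A.length, ?_⟩ ⟨l, h1, h2, rfl⟩
  rintro n ⟨l, h1, -, rfl⟩
  exact h1.length_le

theorem chainDepth_le_length (A : List α) : chainDepth dep A ≤ A.length :=
  chainDepth_le fun _ h _ => h.length_le

theorem chainDepth_nil : chainDepth dep [] = 0 :=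
  Nat.le_zero.1 (chainDepth_le_length [])

theorem chainDepth_append_le (A B : List α) :
    chainDepth dep (A ++ B) ≤ chainDepth dep A + chainDepth dep B := by
  refine chainDepth_le fun l hl hc => ?_
  obtain ⟨l1, l2, rfl, h1, h2⟩ := List.sublist_append_iff.1 hl
  rw [List.length_append]
  exact add_le_add (le_chainDepth h1 hc.left_of_append)
    (le_chainDepth h2 hc.right_of_append)

theorem chainDepth_append_le_of_le {A B : List α} {a b : ℕ} (hA : chainDepth dep A ≤ a)
    (hB : chainDepth dep B ≤ b) : chainDepth dep (A ++ B) ≤ a + b :=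
  (chainDepth_append_le A B).trans (add_le_add hA hB)

theorem chainDepth_le_one {A : List α} (h : A.Pairwise fun a b => ¬ dep a b) :
    chainDepth dep A ≤ 1 := by
  refine chainDepth_le fun l hl hc => ?_
  match l, hl, hc with
  | [], _, _ => simp
  | [_], _, _ => simp
  | a :: b :: l, hl, hc =>
    have h1 := (List.pairwise_cons.1 (h.sublist hl)).1 b (by simp)
    exact absurd (List.isChain_cons_cons.1 hc).1 h1

theorem chainDepth_map_le {dep' : β → β → Prop} (f : α → β) (A : List α)
    (h : ∀ a b, dep' (f a) (f b) → dep a b) : chainDepth dep' (A.map f) ≤ chainDepth dep A := by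
  refine chainDepth_le fun l hl hc => ?_
  obtain ⟨l', hl', rfl⟩ := List.sublist_map_iff.1 hl
  rw [List.length_map]
  exact le_chainDepth hl' (((List.isChain_map f).1 hc).imp fun a b => h a b)

theorem chainDepth_reverse_le (hs : ∀ a b, dep a b → dep b a) (A : List α) :
    chainDepth dep A.reverse ≤ chainDepth dep A := by
  refine chainDepth_le fun l hl hc => ?_
  rw [← List.length_reverse]
  refine le_chainDepth (by simpa using hl.reverse) ?_
  rw [List.isChain_reverse]
  exact hc.imp fun a b h => hs _ _ h

/-- If a sequence is cut into blocks of depth at most `c`, and the blocks are labelled in such a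
way that members of different blocks are dependent only when the labels are, then the depth is at
most `c` times that of the sequence of labels: a chain in the long sequence visits a chain of
labels. -/
theorem chainDepth_flatMap_le {dep' : β → β → Prop} {c : ℕ} (L : List (α × List β))
    (hc : ∀ b ∈ L, chainDepth dep' b.2 ≤ c)
    (hp : L.Pairwise fun a b => ∀ p ∈ a.2, ∀ q ∈ b.2, dep' p q → dep a.1 b.1) :
    chainDepth dep' (L.flatMap Prod.snd) ≤ c * chainDepth dep (L.map Prod.fst) := by
  -- the induction keeps track of the block in which the chain starts
  have key : ∀ (L : List (α × List β)), (∀ b ∈ L, chainDepth dep' b.2 ≤ c) →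
      (L.Pairwise fun a b => ∀ p ∈ a.2, ∀ q ∈ b.2, dep' p q → dep a.1 b.1) →
      ∀ l : List β, l.Sublist (L.flatMap Prod.snd) → l.IsChain dep' →
      ∃ m : List (α × List β), m.Sublist L ∧ (m.map Prod.fst).IsChain dep ∧
        l.length ≤ c * m.length ∧ (∀ p ∈ l.head?, ∃ b ∈ m.head?, p ∈ b.2) := by
    intro L
    induction L with
    | nil =>
      intro _ _ l hl _
      have : l = [] := by simpa using hl
      subst this
      exact ⟨[], by simp, by simp, by simp, by simp⟩
    | cons b L ih =>
      intro hc hp l hl hl'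
      rw [List.flatMap_cons] at hl
      obtain ⟨l1, l2, rfl, h1, h2⟩ := List.sublist_append_iff.1 hl
      rw [List.pairwise_cons] at hp
      obtain ⟨m, hm1, hm2, hm3, hm4⟩ := ih (fun b hb => hc b (List.mem_cons_of_mem _ hb)) hp.2 l2 h2
        hl'.right_of_append
      rcases List.eq_nil_or_concat l1 with rfl | ⟨l1', x, rfl⟩
      · exact ⟨m, hm1.cons b, hm2, by simpa using hm3, by simpa using hm4⟩
      rw [List.concat_eq_append] at h1 hl' ⊢
      have hlen : (l1' ++ [x]).length ≤ c :=
        (le_chainDepth h1 hl'.left_of_append).trans (hc b (by simp))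
      have hhead : ∀ p ∈ (l1' ++ [x] ++ l2).head?, p ∈ b.2 := by
        intro p hp
        refine h1.subset ?_
        cases l1' with
        | nil => simp at hp; simp [hp]
        | cons y l => simp at hp; simp [hp]
      rcases l2 with _ | ⟨y, l2⟩
      · refine ⟨[b], by simp, by simp, by simpa using hlen, fun p hp => ⟨b, by simp, hhead p hp⟩⟩
      · obtain ⟨b', hb', hy⟩ := hm4 y (by simp)
        rcases m with _ | ⟨b'', m⟩
        · simp at hb'
        obtain rfl : b'' = b' := by simpa using hb'
        refine ⟨b :: b'' :: m, hm1.cons_cons b, ?_, ?_, fun p hp => ⟨b, by simp, hhead p hp⟩⟩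
        · rw [List.map_cons, List.map_cons, List.isChain_cons_cons]
          refine ⟨?_, hm2⟩
          have hxy : dep' x y := by
            have : ((l1' ++ [x]) ++ (y :: l2)).IsChain dep' := hl'
            rw [List.append_assoc] at this
            exact (List.isChain_cons_cons.1 this.right_of_append).1
          exact hp.1 b'' (hm1.subset (by simp)) x (h1.subset (by simp)) y hy hxy
        · rw [List.length_append, List.length_cons (a := b), mul_add, mul_one, add_comm]
          exact add_le_add hm3 hlen
  refine chainDepth_le fun l hl hl' => ?_
  obtain ⟨m, hm1, hm2, hm3, -⟩ := key L hc hp l hl hl'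
  refine hm3.trans (Nat.mul_le_mul_left c ?_)
  rw [← List.length_map (f := Prod.fst)]
  exact le_chainDepth (hm1.map _) hm2

end Depth

/-! ### Measurement commands on subregisters -/

namespace MCommand

variable {V W : Type}

/-- Relabelling of the qubits of a command. -/
def map (j : V ↪ W) : MCommand V → MCommand W
  | E a b h => E (j a) (j b) (j.injective.ne h)
  | M a α => M (j a) α
  | X a σ => X (j a) (σ.map j)
  | Z a σ => Z (j a) (σ.map j)

theorem qubits_map (j : V ↪ W) (p : MCommand V) : (p.map j).qubits = j '' p.qubits := by
  cases p <;> simp [map, qubits, Set.image_pair]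

theorem writes_map (j : V ↪ W) (p : MCommand V) : (p.map j).writes = j '' p.writes := by
  cases p <;> simp [map, writes]

theorem reads_map (j : V ↪ W) (p : MCommand V) : (p.map j).reads = j '' p.reads := by
  cases p <;> simp [map, reads]

theorem writes_subset_qubits (p : MCommand V) : p.writes ⊆ p.qubits := by
  cases p <;> simp [writes, qubits]

theorem dep_map (j : V ↪ W) (p q : MCommand V) (h : Dep (p.map j) (q.map j)) : Dep p q := by
  simpa only [Dep, qubits_map, writes_map, reads_map, ← Set.image_inter j.injective,
    Set.image_nonempty] using h

/-- The qubits measured by a sequence of commands. -/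
def measured (A : List (MCommand V)) : Set V := {v | ∃ p ∈ A, v ∈ p.writes}

theorem measured_nil : measured ([] : List (MCommand V)) = ∅ := by
  simp [measured]

theorem measured_cons (p : MCommand V) (A : List (MCommand V)) :
    measured (p :: A) = p.writes ∪ measured A := by
  ext v; simp [measured]

theorem measured_append (A B : List (MCommand V)) :
    measured (A ++ B) = measured A ∪ measured B := by
  ext v; simp [measured, or_and_right, exists_or]

theorem measured_map (j : V ↪ W) (A : List (MCommand V)) :
    measured (A.map (map j)) = j '' measured A := by
  ext v
  simp only [measured, List.mem_map, Set.mem_ofPred_eq, Set.mem_image]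
  constructor
  · rintro ⟨_, ⟨p, hp, rfl⟩, hv⟩
    rw [writes_map] at hv
    obtain ⟨w, hw, rfl⟩ := hv
    exact ⟨w, ⟨p, hp, hw⟩, rfl⟩
  · rintro ⟨w, ⟨p, hp, hw⟩, rfl⟩
    exact ⟨_, ⟨p, hp, rfl⟩, by rw [writes_map]; exact ⟨w, hw, rfl⟩⟩

theorem wf_append (m : Set V) (A B : List (MCommand V)) :
    WF m (A ++ B) ↔ WF m A ∧ WF (m ∪ measured A) B := by
  induction A generalizing m with
  | nil => simp [WF, measured_nil]
  | cons p A ih =>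
    rw [List.cons_append, WF, WF, ih, measured_cons, Set.union_assoc]
    tauto

theorem WF.disjoint {m : Set V} {A : List (MCommand V)} (h : WF m A) :
    Disjoint (measured A) m := by
  induction A generalizing m with
  | nil => simp [measured_nil]
  | cons p A ih =>
    rw [measured_cons, Set.disjoint_union_left]
    exact ⟨h.1.mono_left (writes_subset_qubits p), (ih h.2.2).mono_right Set.subset_union_left⟩

/-- Relabelling preserves well-formedness, whatever has been measured outside. -/
theorem WF.map (j : V ↪ W) {m : Set V} {m' : Set W} {A : List (MCommand V)} (h : WF m A)
    (hm : ∀ v, j v ∈ m' ↔ v ∈ m) : WF m' (A.map (MCommand.map j)) := by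
  induction A generalizing m m' with
  | nil => trivial
  | cons p A ih =>
    refine ⟨?_, ?_, ih h.2.2 fun v => ?_⟩
    · rw [qubits_map, Set.disjoint_left]
      rintro _ ⟨v, hv, rfl⟩ hv'
      exact Set.disjoint_left.1 h.1 hv ((hm v).1 hv')
    · rw [reads_map]
      rintro _ ⟨v, hv, rfl⟩
      exact (hm v).2 (h.2.1 hv)
    · rw [writes_map, Set.mem_union, Set.mem_union, hm, j.injective.mem_set_image]

variable [Fintype V] [DecidableEq V] [Fintype W] [DecidableEq W]

/-- Execution with a continuation: the sum of `κ` over the branches of a sequence of commands,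
given the record and the unnormalised state at the end of the branch. -/
def runK {β : Type*} [AddCommMonoid β] : List (MCommand V) → (V → Fin 2) → Op V →
    ((V → Fin 2) → Op V → β) → β
  | [], s, ρ, κ => κ s ρ
  | E i j _ :: A, s, ρ, κ => runK A s (conj (cz i j) ρ) κ
  | M i α :: A, s, ρ, κ =>
      ∑ b : Fin 2, runK A (Function.update s i b) (conj (single i (projAngle α b)) ρ) κ
  | X i σ :: A, s, ρ, κ => runK A s (conj (single i (gateX ^ ((∑ j ∈ σ, s j : Fin 2) : ℕ))) ρ) κ
  | Z i σ :: A, s, ρ, κ => runK A s (conj (single i (gateZ ^ ((∑ j ∈ σ, s j : Fin 2) : ℕ))) ρ) κ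

theorem run_eq_runK (A : List (MCommand V)) (s : V → Fin 2) (ρ : Op V) :
    run A s ρ = runK A s ρ fun _ σ => σ := by
  induction A generalizing s ρ with
  | nil => rfl
  | cons p A ih => cases p <;> simp only [run, runK, ih]

variable {β : Type*} [AddCommMonoid β]

theorem runK_append (A B : List (MCommand V)) (s : V → Fin 2) (ρ : Op V)
    (κ : (V → Fin 2) → Op V → β) :
    runK (A ++ B) s ρ κ = runK A s ρ fun s' ρ' => runK B s' ρ' κ := by
  induction A generalizing s ρ with
  | nil => rfl
  | cons p A ih => cases p <;> simp only [List.cons_append, runK, ih]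

theorem update_comp_embedding (j : V ↪ W) (s : W → Fin 2) (i : V) (b : Fin 2) :
    Function.update s (j i) b ∘ j = Function.update (s ∘ j) i b :=
  Function.update_comp_eq_of_injective s j.injective i b

/-- Commands on a subregister act on the reduced state as they would on the subregister alone. -/
theorem runK_map_reduce (j : V ↪ W) (A : List (MCommand V)) (s : W → Fin 2) (ρ : Op W)
    (κ : (V → Fin 2) → Op V → β) :
    runK (A.map (map j)) s ρ (fun s' ρ' => κ (s' ∘ j) (reduce j ρ'))
      = runK A (s ∘ j) (reduce j ρ) κ := by
  induction A generalizing s ρ with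
  | nil => rfl
  | cons p A ih =>
    cases p with
    | E a b h =>
      simp only [List.map_cons, map, runK, ih]
      rw [← embed_cz, reduce_conj_embed]
    | M a α =>
      simp only [List.map_cons, map, runK, ih]
      refine Finset.sum_congr rfl fun b _ => ?_
      rw [← embed_single, reduce_conj_embed, update_comp_embedding]
    | X a σ =>
      simp only [List.map_cons, map, runK, ih, Finset.sum_map]
      rw [← embed_single, reduce_conj_embed]
      rfl
    | Z a σ =>
      simp only [List.map_cons, map, runK, ih, Finset.sum_map]
      rw [← embed_single, reduce_conj_embed]
      rfl

theorem run_map_reduce (j : V ↪ W) (A : List (MCommand V)) (s : W → Fin 2) (ρ : Op W) :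
    reduce j (run (A.map (map j)) s ρ) = run A (s ∘ j) (reduce j ρ) := by
  have h : ∀ (A : List (MCommand W)) (s : W → Fin 2) (ρ : Op W),
      reduce j (run A s ρ) = runK A s ρ fun _ σ => reduce j σ := by
    intro A
    induction A with
    | nil => intro s ρ; rfl
    | cons p A ih => intro s ρ; cases p <;> simp only [run, runK, ih, reduce_sum]
  rw [h, run_eq_runK, ← runK_map_reduce]

/-- Commands on a subregister do not affect freshly prepared qubits outside. -/
theorem runK_map_prepare (j : V ↪ W) (φ : Fin 2 → ℂ) (A : List (MCommand V)) (t : W → Fin 2)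
    (s : V → Fin 2) (ρ : Op V) (κ : (W → Fin 2) → Op W → β) :
    runK (A.map (map j)) (Function.extend j s t) (prepare j φ ρ) κ
      = runK A s ρ fun s' ρ' => κ (Function.extend j s' t) (prepare j φ ρ') := by
  have hu : ∀ (s : V → Fin 2) (a : V) (b : Fin 2),
      Function.update (Function.extend j s t) (j a) b
        = Function.extend j (Function.update s a b) t := by
    intro s a b
    funext w
    by_cases hw : w ∈ Set.range j
    · obtain ⟨v, rfl⟩ := hw
      by_cases hv : v = a
      · subst hv; simp [extend_apply_range]
      · simp [extend_apply_range, hv]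
    · rw [Function.update_of_ne (fun h => hw ⟨a, h.symm⟩), extend_apply_notMem _ _ _ hw,
        extend_apply_notMem _ _ _ hw]
  induction A generalizing s ρ with
  | nil => rfl
  | cons p A ih =>
    cases p with
    | E a b h =>
      simp only [List.map_cons, map, runK]
      rw [← embed_cz, conj_embed_prepare, ih]
    | M a α =>
      simp only [List.map_cons, map, runK]
      refine Finset.sum_congr rfl fun b _ => ?_
      rw [← embed_single, conj_embed_prepare, hu, ih]
    | X a σ =>
      simp only [List.map_cons, map, runK, Finset.sum_map, extend_apply_range]
      rw [← embed_single, conj_embed_prepare, ih]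
    | Z a σ =>
      simp only [List.map_cons, map, runK, Finset.sum_map, extend_apply_range]
      rw [← embed_single, conj_embed_prepare, ih]

/-- A continuation that does not look at the new outcomes can be applied after summation. -/
theorem runK_of_const (A : List (MCommand V)) (s : V → Fin 2) (ρ : Op V)
    (κ : (V → Fin 2) → Op V → β) (κ₀ : Op V →+ β)
    (h : ∀ s' : V → Fin 2, (∀ v, v ∉ measured A → s' v = s v) → ∀ ρ', κ s' ρ' = κ₀ ρ') :
    runK A s ρ κ = κ₀ (run A s ρ) := by
  induction A generalizing s ρ with
  | nil => exact h s (fun _ _ => rfl) ρ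
  | cons p A ih =>
    cases p with
    | M i α =>
      simp only [runK, run, map_sum]
      refine Finset.sum_congr rfl fun b _ => ih _ _ fun s' hs' ρ' => h s' (fun v hv => ?_) ρ'
      rw [measured_cons, Set.mem_union, not_or] at hv
      rw [hs' v hv.2, Function.update_of_ne (by simpa [writes] using hv.1)]
    | _ =>
      simp only [runK, run]
      refine ih _ _ fun s' hs' ρ' => h s' (fun v hv => hs' v ?_) ρ'
      simpa [measured_cons, writes] using hv

end MCommand

/-! ### An intermediate instruction language -/

theorem ketPlus_norm : ∑ b, ketPlus b * star (ketPlus b) = 1 := by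
  have h := sqrt_two_inv_mul_self
  simp [ketPlus, ketAngle, Fin.sum_univ_two, h]
  norm_num

theorem ket0_norm : ∑ b, ket0 b * star (ket0 b) = 1 := by
  simp [ket0, Fin.sum_univ_two]

/-- Discarding qubits of the register and some of the fresh ancillas commutes with adding
ancillas. -/
theorem reduce_sumMap_prepare_of_norm {V W A B : Type} [Fintype V] [DecidableEq V] [Fintype W]
    [DecidableEq W] [Fintype A] [DecidableEq A] [Fintype B] [DecidableEq B]
    (e : W ↪ V) (f : B ↪ A) {φ : Fin 2 → ℂ} (hφ : ∑ b, φ b * star (φ b) = 1) (ρ : Op V) :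
    reduce (e.sumMap f) (prepare (V := V ⊕ A) .inl φ ρ)
      = prepare (V := W ⊕ B) .inl φ (reduce e ρ) := by
  have h1 : e.sumMap f = ((Function.Embedding.refl W).sumMap f).trans
      (e.sumMap (Function.Embedding.refl A)) := by
    ext x; rcases x with x | x <;> rfl
  have h2 : (Function.Embedding.inl : W ↪ W ⊕ A) =
      (Function.Embedding.inl : W ↪ W ⊕ B).trans ((Function.Embedding.refl W).sumMap f) := by
    ext x; rfl
  rw [h1, reduce_trans, reduce_sumMap_prepare, h2, prepare_trans, reduce_prepare _ hφ]

/-- A copy of the register in which the qubits of `S` are replaced by fresh ones. -/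
def relocate {R : Type} [DecidableEq R] (S : Finset R) : R ↪ R ⊕ R where
  toFun r := if r ∈ S then .inr r else .inl r
  inj' a b h := by
    by_cases ha : a ∈ S <;> by_cases hb : b ∈ S <;> simp_all

theorem relocate_apply {R : Type} [DecidableEq R] (S : Finset R) (r : R) :
    relocate S r = if r ∈ S then .inr r else .inl r := rfl

/-- The qubits of `S` are discarded and prepared again in the state `|+⟩`. -/
def resetPlus {R : Type} [Fintype R] [DecidableEq R] (S : Finset R) (ρ : Op R) : Op R :=
  reduce (relocate S) (prepare (V := R ⊕ R) .inl ketPlus ρ)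

theorem reduce_resetPlus_map {R R' : Type} [Fintype R] [DecidableEq R] [Fintype R']
    [DecidableEq R'] (j : R ↪ R') (S : Finset R) (ρ : Op R') :
    reduce j (resetPlus (S.map j) ρ) = resetPlus S (reduce j ρ) := by
  have h : j.trans (relocate (S.map j)) = (relocate S).trans (j.sumMap j) := by
    ext r
    by_cases hr : r ∈ S <;> simp [relocate_apply, hr]
  rw [resetPlus, resetPlus, ← reduce_trans, h, reduce_trans,
    reduce_sumMap_prepare_of_norm j j ketPlus_norm]

/-- Resetting all qubits outside a subregister. -/
theorem resetPlus_inr {V A : Type} [Fintype V] [DecidableEq V] [Fintype A] [DecidableEq A]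
    (ρ : Op (V ⊕ A)) :
    resetPlus (Finset.univ.map Function.Embedding.inr) ρ
      = prepare .inl ketPlus (reduce .inl ρ) := by
  have h : relocate (Finset.univ.map (Function.Embedding.inr : A ↪ V ⊕ A)) =
      (Function.Embedding.inl : V ↪ V ⊕ A).sumMap (Function.Embedding.inr : A ↪ V ⊕ A) := by
    ext r
    rcases r with r | r <;> simp [relocate_apply]
  rw [resetPlus, h, reduce_sumMap_prepare_of_norm _ _ ketPlus_norm]

/-- The diagonal unitary with phases `θ`. -/
def phase {R : Type} [DecidableEq R] [Fintype R] (θ : Bits R → ℝ) : Op R :=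
  Matrix.diagonal fun x => Complex.exp (θ x * Complex.I)

/-- Instructions of an intermediate language that act in place, on a fixed register: `init S` resets
the qubits of `S` to `|+⟩`, `had i` is a Hadamard gate, `diag S θ` is the diagonal unitary with
phases `θ` depending only on the qubits of `S`, `meas i k` measures qubit `i` in the basis `|±⟩`,
stores the outcome under the name `k` and resets the qubit to `|+⟩`, and `flip i σ` applies `X` to
qubit `i` when the sum modulo 2 of the outcomes named in `σ` is 1. The record of outcomes is `ℕ →
Fin 2`, as for classically controlled patterns. -/
inductive Instr (R : Type) : Type
  | init (S : Finset R)
  | had (i : R)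
  | diag (S : Finset R) (θ : Bits R → ℝ) (hθ : ∀ x y, (∀ v ∈ S, x v = y v) → θ x = θ y)
  | meas (i : R) (k : ℕ)
  | flip (i : R) (σ : Finset ℕ)

namespace Instr

variable {R R' : Type}

/-- The qubits on which an instruction acts. -/
def qubits : Instr R → Set R
  | init S => S
  | had i => {i}
  | diag S _ _ => S
  | meas i _ => {i}
  | flip i _ => {i}

/-- The outcomes produced by an instruction. -/
def writes : Instr R → Set ℕ
  | meas _ k => {k}
  | _ => ∅

/-- The outcomes used by an instruction. -/
def reads : Instr R → Set ℕ
  | flip _ σ => σ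
  | _ => ∅

/-- A later instruction `h` depends on an earlier instruction `g` when they act on a common qubit
or `h` uses an outcome produced by `g`. -/
def Dep (g h : Instr R) : Prop :=
  (g.qubits ∩ h.qubits).Nonempty ∨ (g.writes ∩ h.reads).Nonempty

/-- The outcomes produced by a program. -/
def names (Q : List (Instr R)) : Set ℕ := {k | ∃ g ∈ Q, k ∈ g.writes}

/-- Distinct measurements have distinct names, and only available outcomes are used, where those
in `m` are available at the start. -/
def WF (m : Set ℕ) : List (Instr R) → Prop
  | [] => True
  | g :: Q => Disjoint g.writes m ∧ g.reads ⊆ m ∧ WF (m ∪ g.writes) Q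

theorem names_nil : names ([] : List (Instr R)) = ∅ := by
  simp [names]

theorem names_cons (g : Instr R) (Q : List (Instr R)) : names (g :: Q) = g.writes ∪ names Q := by
  ext v; simp [names]

theorem names_append (A B : List (Instr R)) : names (A ++ B) = names A ∪ names B := by
  ext v; simp [names, or_and_right, exists_or]

theorem wf_append (m : Set ℕ) (A B : List (Instr R)) :
    WF m (A ++ B) ↔ WF m A ∧ WF (m ∪ names A) B := by
  induction A generalizing m with
  | nil => simp [WF, names_nil]
  | cons g A ih =>
    rw [List.cons_append, WF, WF, ih, names_cons, Set.union_assoc]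
    tauto

/-- Relabelling of the qubits of an instruction. -/
def map (j : R ↪ R') : Instr R → Instr R'
  | init S => init (S.map j)
  | had i => had (j i)
  | diag S θ hθ => diag (S.map j) (fun x => θ (x ∘ j)) fun _ _ h =>
      hθ _ _ fun _ hv => h _ (Finset.mem_map_of_mem j hv)
  | meas i k => meas (j i) k
  | flip i σ => flip (j i) σ

theorem qubits_map (j : R ↪ R') (g : Instr R) : (g.map j).qubits = j '' g.qubits := by
  cases g <;> simp [map, qubits]

theorem writes_map (j : R ↪ R') (g : Instr R) : (g.map j).writes = g.writes := by
  cases g <;> rfl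

theorem reads_map (j : R ↪ R') (g : Instr R) : (g.map j).reads = g.reads := by
  cases g <;> rfl

theorem dep_map (j : R ↪ R') (g h : Instr R) (hd : Dep (g.map j) (h.map j)) : Dep g h := by
  simpa only [Dep, qubits_map, writes_map, reads_map, ← Set.image_inter j.injective,
    Set.image_nonempty] using hd

theorem names_map (j : R ↪ R') (Q : List (Instr R)) : names (Q.map (map j)) = names Q := by
  ext k; simp [names, writes_map]

theorem WF.map (j : R ↪ R') {m : Set ℕ} {Q : List (Instr R)} (h : WF m Q) :
    WF m (Q.map (Instr.map j)) := by
  induction Q generalizing m with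
  | nil => trivial
  | cons g Q ih =>
    refine ⟨?_, ?_, ?_⟩
    · rw [writes_map]; exact h.1
    · rw [reads_map]; exact h.2.1
    · rw [writes_map]; exact ih h.2.2

variable [Fintype R] [DecidableEq R] [Fintype R'] [DecidableEq R']

/-- Execution with a continuation: the sum of `κ` over the branches of a program, given the record
and the unnormalised state at the end of the branch. -/
def runK {β : Type*} [AddCommMonoid β] : List (Instr R) → (ℕ → Fin 2) → Op R →
    ((ℕ → Fin 2) → Op R → β) → β
  | [], s, ρ, κ => κ s ρ
  | init S :: Q, s, ρ, κ => runK Q s (resetPlus S ρ) κ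
  | had i :: Q, s, ρ, κ => runK Q s (conj (single i gateH) ρ) κ
  | diag _ θ _ :: Q, s, ρ, κ => runK Q s (conj (phase θ) ρ) κ
  | meas i k :: Q, s, ρ, κ =>
      ∑ b : Fin 2, runK Q (Function.update s k b)
        (resetPlus {i} (conj (single i (projAngle 0 b)) ρ)) κ
  | flip i σ :: Q, s, ρ, κ =>
      runK Q s (conj (single i (gateX ^ ((∑ k ∈ σ, s k : Fin 2) : ℕ))) ρ) κ

variable {β : Type*} [AddCommMonoid β]

theorem runK_append (A B : List (Instr R)) (s : ℕ → Fin 2) (ρ : Op R)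
    (κ : (ℕ → Fin 2) → Op R → β) :
    runK (A ++ B) s ρ κ = runK A s ρ fun s' ρ' => runK B s' ρ' κ := by
  induction A generalizing s ρ with
  | nil => rfl
  | cons g A ih => cases g <;> simp only [List.cons_append, runK, ih]

/-- Instructions on a subregister act on the reduced state as they would on the subregister
alone. -/
theorem runK_map_reduce (j : R ↪ R') (Q : List (Instr R)) (s : ℕ → Fin 2) (ρ : Op R')
    (κ : (ℕ → Fin 2) → Op R → β) :
    runK (Q.map (map j)) s ρ (fun s' ρ' => κ s' (reduce j ρ')) = runK Q s (reduce j ρ) κ := by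
  induction Q generalizing s ρ with
  | nil => rfl
  | cons g Q ih =>
    cases g with
    | init S => simp only [List.map_cons, map, runK, ih, reduce_resetPlus_map]
    | had i =>
      simp only [List.map_cons, map, runK, ih]
      rw [← embed_single, reduce_conj_embed]
    | diag S θ hθ =>
      simp only [List.map_cons, map, runK, ih, phase]
      rw [← embed_diagonal j (fun x => Complex.exp (θ x * Complex.I)), reduce_conj_embed]
    | meas i k =>
      simp only [List.map_cons, map, runK, ih]
      refine Finset.sum_congr rfl fun b _ => ?_
      rw [← Finset.map_singleton, reduce_resetPlus_map, ← embed_single, reduce_conj_embed]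
    | flip i σ =>
      simp only [List.map_cons, map, runK, ih]
      rw [← embed_single, reduce_conj_embed]

end Instr

/-! ### Compilation of instructions to measurement patterns -/

/-- A measurement pattern that performs the operation `F` on the register `R`, touching only the
qubits of `S` and ancillas which are prepared in `|+⟩` and belong to qubits of `S`. The contents of
qubit `r` are moved to `out r`, and the ancilla `a` belongs to qubit `own a`. The depth bound 8 is
that of the deepest gadget, for diagonal unitaries. -/
structure Gadget (R : Type) [Fintype R] [DecidableEq R] (S : Set R) (F : Op R → Op R) where
  A : Type
  fintypeA : Fintype A
  decEqA : DecidableEq A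
  cmds : List (MCommand (R ⊕ A))
  out : R ↪ R ⊕ A
  own : A → R
  wf : MCommand.WF ∅ cmds
  out_notMem : ∀ r, out r ∉ MCommand.measured cmds
  own_out : ∀ r, Sum.elim id own (out r) = r
  touch : ∀ p ∈ cmds, ∀ x ∈ p.qubits ∪ p.reads, Sum.elim id own x ∈ S
  depth_le : chainDepth MCommand.Dep cmds ≤ 8
  run_eq : ∀ s ρ, reduce out (MCommand.run cmds s (prepare .inl ketPlus ρ)) = F ρ

attribute [instance] Gadget.fintypeA Gadget.decEqA

/-- Resets need no commands: the qubits are replaced by fresh ancillas. -/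
def initGadget {R : Type} [Fintype R] [DecidableEq R] (S : Finset R) :
    Gadget R (Instr.init S).qubits (resetPlus S) where
  A := R
  fintypeA := inferInstance
  decEqA := inferInstance
  cmds := []
  out := relocate S
  own := id
  wf := trivial
  out_notMem r := by simp [MCommand.measured]
  own_out r := by by_cases hr : r ∈ S <;> simp [relocate_apply, hr]
  touch p hp := by simp at hp
  depth_le := by rw [chainDepth_nil]; exact Nat.zero_le _
  run_eq s ρ := rfl

open Classical in
/-- The record of the outcomes named in `N`, when the outcome named `k` is that of qubit `nm k`. -/
def pull {W : Type} (nm : ℕ → W) (N : Set ℕ) (s : W → Fin 2) : ℕ → Fin 2 :=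
  fun k => if k ∈ N then s (nm k) else 0

/-- A simulation of the program `Q` by a measurement pattern on the qubits `W`. The register starts
at `start` and ends up at `loc`; the outcome named `k` is that of the qubit `nm k`; a qubit `w`
belongs to the register qubit `own w`, if any. The pattern consists of one block for every
instruction. Commands of different blocks are dependent only if the instructions are: by `touch`,
`touch_reads` and `writes_nm`, a command acts on qubits belonging to those of its instruction, and
uses or produces the outcomes that the instruction uses or produces. -/
structure Sim {R : Type} [Fintype R] [DecidableEq R] (Q : List (Instr R)) where
  W : Type
  fintypeW : Fintype W
  decEqW : DecidableEq W
  start : R ↪ W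
  loc : R ↪ W
  nm : ℕ → W
  own : W → Option R
  blocks : List (Instr R × List (MCommand W))
  fst_eq : blocks.map Prod.fst = Q
  wf : MCommand.WF ∅ (blocks.flatMap Prod.snd)
  loc_notMem : ∀ r, loc r ∉ MCommand.measured (blocks.flatMap Prod.snd)
  own_loc : ∀ r, own (loc r) = some r
  nm_mem : ∀ k ∈ Instr.names Q, nm k ∈ MCommand.measured (blocks.flatMap Prod.snd)
  nm_inj : Set.InjOn nm (Instr.names Q)
  depth_le : ∀ b ∈ blocks, chainDepth MCommand.Dep b.2 ≤ 8
  touch : ∀ b ∈ blocks, ∀ p ∈ b.2, ∀ x ∈ p.qubits, ∃ r ∈ b.1.qubits, own x = some r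
  touch_reads : ∀ b ∈ blocks, ∀ p ∈ b.2, ∀ x ∈ p.reads,
    (∃ r ∈ b.1.qubits, own x = some r) ∨ ∃ k ∈ b.1.reads, k ∈ Instr.names Q ∧ x = nm k
  writes_nm : ∀ b ∈ blocks, ∀ p ∈ b.2, ∀ k ∈ Instr.names Q, nm k ∈ p.writes → k ∈ b.1.writes
  sem : ∀ {β : Type} [AddCommMonoid β] (κ : (ℕ → Fin 2) → Op R →+ β) (ρ : Op R),
    MCommand.runK (blocks.flatMap Prod.snd) 0 (prepare start ketPlus ρ)
        (fun s ρ' => κ (pull nm (Instr.names Q) s) (reduce loc ρ'))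
      = Instr.runK Q 0 ρ fun s ρ' => κ s ρ'

attribute [instance] Sim.fintypeW Sim.decEqW

namespace Sim

variable {R : Type} [Fintype R] [DecidableEq R] {Q : List (Instr R)}

/-- The empty program; one idle qubit provides a default value for names. -/
def nil : Sim ([] : List (Instr R)) where
  W := Option R
  fintypeW := inferInstance
  decEqW := inferInstance
  start := Function.Embedding.some
  loc := Function.Embedding.some
  nm _ := none
  own := id
  blocks := []
  fst_eq := rfl
  wf := trivial
  loc_notMem r := by simp [MCommand.measured]
  own_loc r := rfl
  nm_mem k hk := by simp [Instr.names] at hk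
  nm_inj k hk := by simp [Instr.names] at hk
  depth_le b hb := by simp at hb
  touch b hb := by simp at hb
  touch_reads b hb := by simp at hb
  writes_nm b hb := by simp at hb
  sem κ ρ := by
    have h : pull (fun _ => (none : Option R)) (Instr.names ([] : List (Instr R))) 0 = 0 := by
      funext k; simp [pull]
    simp only [List.flatMap_nil, MCommand.runK, Instr.runK, h, reduce_prepare _ ketPlus_norm]

/-- The commands of the simulating pattern. -/
abbrev cmds (T : Sim Q) : List (MCommand T.W) := T.blocks.flatMap Prod.snd

/-- A simulation is extended by a block `blk` for one more instruction `g`, which may use fresh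
ancillas `A`. -/
def extend (T : Sim Q) (g : Instr R) (A : Type) [Fintype A] [DecidableEq A] (ownA : A → R)
    (blk : List (MCommand (T.W ⊕ A))) (loc' : R ↪ T.W ⊕ A) (nm' : ℕ → T.W ⊕ A)
    (hwf : MCommand.WF (Sum.inl '' MCommand.measured T.cmds) blk)
    (hloc : ∀ r, loc' r ∉ Sum.inl '' MCommand.measured T.cmds)
    (hloc' : ∀ r, loc' r ∉ MCommand.measured blk)
    (hown : ∀ r, Sum.elim T.own (some ∘ ownA) (loc' r) = some r)
    (hnm : ∀ k ∈ Instr.names Q, nm' k = Sum.inl (T.nm k))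
    (hnm' : ∀ k ∈ g.writes, nm' k ∈ MCommand.measured blk)
    (hinj : Set.InjOn nm' g.writes)
    (hdepth : chainDepth MCommand.Dep blk ≤ 8)
    (htouch : ∀ p ∈ blk, ∀ x ∈ p.qubits,
      ∃ r ∈ g.qubits, Sum.elim T.own (some ∘ ownA) x = some r)
    (hreads : ∀ p ∈ blk, ∀ x ∈ p.reads,
      (∃ r ∈ g.qubits, Sum.elim T.own (some ∘ ownA) x = some r) ∨
        ∃ k ∈ g.reads, k ∈ Instr.names Q ∧ x = Sum.inl (T.nm k))
    (hsem : ∀ {β : Type} [AddCommMonoid β] (κ : (ℕ → Fin 2) → Op R →+ β) (s : T.W → Fin 2)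
      (ρ : Op T.W),
      MCommand.runK blk (Function.extend (Function.Embedding.inl : T.W ↪ T.W ⊕ A) s 0)
          (prepare .inl ketPlus ρ)
          (fun s' ρ' => κ (pull nm' (Instr.names (Q ++ [g])) s') (reduce loc' ρ'))
        = Instr.runK [g] (pull T.nm (Instr.names Q) s) (reduce T.loc ρ) fun s ρ' => κ s ρ') :
    Sim (Q ++ [g]) := by
  have hc : ((T.blocks.map fun b => (b.1, b.2.map (MCommand.map
      (Function.Embedding.inl : T.W ↪ T.W ⊕ A)))) ++ [(g, blk)]).flatMap Prod.snd
      = T.cmds.map (MCommand.map Function.Embedding.inl) ++ blk := by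
    rw [List.flatMap_append, List.flatMap_map, cmds, List.map_flatMap]
    simp
  have hm : MCommand.measured (T.cmds.map (MCommand.map
      (Function.Embedding.inl : T.W ↪ T.W ⊕ A)) ++ blk)
      = Sum.inl '' MCommand.measured T.cmds ∪ MCommand.measured blk := by
    rw [MCommand.measured_append, MCommand.measured_map]; rfl
  have hn : Instr.names (Q ++ [g]) = Instr.names Q ∪ g.writes := by
    rw [Instr.names_append, Instr.names_cons, Instr.names_nil, Set.union_empty]
  have hdisj : ∀ x ∈ MCommand.measured blk, x ∉ Sum.inl '' MCommand.measured T.cmds :=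
    fun x hx => Set.disjoint_left.1 hwf.disjoint hx
  exact
  { W := T.W ⊕ A
    fintypeW := inferInstance
    decEqW := inferInstance
    start := T.start.trans .inl
    loc := loc'
    nm := nm'
    own := Sum.elim T.own (some ∘ ownA)
    blocks := (T.blocks.map fun b => (b.1, b.2.map (MCommand.map .inl))) ++ [(g, blk)]
    fst_eq := by
      rw [List.map_append, List.map_map]
      simp only [List.map_cons, List.map_nil]
      congr 1
      exact T.fst_eq
    wf := by
      rw [hc, MCommand.wf_append, MCommand.measured_map]
      refine ⟨T.wf.map _ fun v => by simp, ?_⟩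
      rw [Set.empty_union]
      exact hwf
    loc_notMem := by
      intro r
      rw [hc, hm, Set.mem_union, not_or]
      exact ⟨hloc r, hloc' r⟩
    own_loc := hown
    nm_mem := by
      intro k hk
      rw [hc, hm]
      rw [hn] at hk
      rcases hk with hk | hk
      · exact Or.inl ⟨T.nm k, T.nm_mem k hk, (hnm k hk).symm⟩
      · exact Or.inr (hnm' k hk)
    nm_inj := by
      intro k hk l hl h
      rw [hn] at hk hl
      have aux : ∀ k ∈ Instr.names Q, ∀ l ∈ g.writes, nm' k ≠ nm' l := by
        intro k hk l hl h
        exact hdisj _ (hnm' l hl) ⟨T.nm k, T.nm_mem k hk, by rw [← h, hnm k hk]⟩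
      rcases hk with hk | hk <;> rcases hl with hl | hl
      · rw [hnm k hk, hnm l hl] at h
        exact T.nm_inj hk hl (Sum.inl_injective h)
      · exact absurd h (aux k hk l hl)
      · exact absurd h.symm (aux l hl k hk)
      · exact hinj hk hl h
    depth_le := by
      intro b hb
      rw [List.mem_append, List.mem_map, List.mem_singleton] at hb
      rcases hb with ⟨b, hb, rfl⟩ | rfl
      · exact (chainDepth_map_le _ _ (MCommand.dep_map _)).trans (T.depth_le b hb)
      · exact hdepth
    touch := by
      intro b hb p hp x hx
      rw [List.mem_append, List.mem_map, List.mem_singleton] at hb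
      rcases hb with ⟨b, hb, rfl⟩ | rfl
      · obtain ⟨p, hp', rfl⟩ := List.mem_map.1 hp
        rw [MCommand.qubits_map] at hx
        obtain ⟨x, hx, rfl⟩ := hx
        exact T.touch b hb p hp' x hx
      · exact htouch p hp x hx
    touch_reads := by
      intro b hb p hp x hx
      rw [List.mem_append, List.mem_map, List.mem_singleton] at hb
      rcases hb with ⟨b, hb, rfl⟩ | rfl
      · obtain ⟨p, hp', rfl⟩ := List.mem_map.1 hp
        rw [MCommand.reads_map] at hx
        obtain ⟨x, hx, rfl⟩ := hx
        rcases T.touch_reads b hb p hp' x hx with h | ⟨k, hk, hk', rfl⟩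
        · exact Or.inl h
        · exact Or.inr ⟨k, hk, hn ▸ Or.inl hk', (hnm k hk').symm⟩
      · rcases hreads p hp x hx with h | ⟨k, hk, hk', rfl⟩
        · exact Or.inl h
        · exact Or.inr ⟨k, hk, hn ▸ Or.inl hk', (hnm k hk').symm⟩
    writes_nm := by
      intro b hb p hp k hk hw
      rw [List.mem_append, List.mem_map, List.mem_singleton] at hb
      rw [hn] at hk
      rcases hb with ⟨b, hb, rfl⟩ | rfl
      · obtain ⟨p, hp', rfl⟩ := List.mem_map.1 hp
        rw [MCommand.writes_map] at hw
        obtain ⟨x, hx, hxk⟩ := hw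
        have hxm : nm' k ∈ Sum.inl '' MCommand.measured T.cmds :=
          ⟨x, ⟨p, List.mem_flatMap.2 ⟨b, hb, hp'⟩, hx⟩, hxk⟩
        rcases hk with hk | hk
        · rw [hnm k hk] at hxk
          obtain rfl := Sum.inl_injective hxk
          exact T.writes_nm b hb p hp' k hk hx
        · exact absurd hxm (hdisj _ (hnm' k hk))
      · rcases hk with hk | hk
        · exact absurd ⟨T.nm k, T.nm_mem k hk, (hnm k hk).symm⟩ (hdisj _ ⟨p, hp, hw⟩)
        · exact hk
    sem := by
      intro β _ κ ρ
      have h0 : (0 : T.W ⊕ A → Fin 2)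
          = Function.extend (Function.Embedding.inl : T.W ↪ T.W ⊕ A) 0 0 := by
        funext x
        rcases x with x | x
        · exact (extend_apply_range (Function.Embedding.inl : T.W ↪ T.W ⊕ A) 0 0 x).symm
        · rw [extend_apply_notMem]
          rintro ⟨y, hy⟩
          cases hy
      rw [hc, prepare_trans, MCommand.runK_append, h0, MCommand.runK_map_prepare]
      simp only [hsem]
      have hlin : ∀ s, ∃ κ' : Op R →+ β, ∀ ρ', κ' ρ' = Instr.runK [g] s ρ' fun s ρ' => κ s ρ' := by
        intro s
        have hphase : ∀ A : Op R, ∃ κ' : Op R →+ β, ∀ ρ', κ' ρ' = κ s (conj A ρ') :=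
          fun A => ⟨(κ s).comp (conjHom A), fun _ => rfl⟩
        have hprep : ∀ ρ σ : Op R,
            prepare (Function.Embedding.inl : R ↪ R ⊕ R) ketPlus (ρ + σ)
              = prepare .inl ketPlus ρ + prepare .inl ketPlus σ := by
          intro ρ σ
          simp only [prepare_eq, Matrix.mul_add, Matrix.add_mul]
        have hreset : ∀ S : Finset R, ∃ r : Op R →+ Op R, ∀ ρ, r ρ = resetPlus S ρ := by
          intro S
          refine ⟨AddMonoidHom.mk' (resetPlus S) fun ρ σ => ?_, fun _ => rfl⟩
          rw [resetPlus, hprep, reduce_add]; rfl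
        cases g with
        | init S =>
          obtain ⟨r, hr⟩ := hreset S
          exact ⟨(κ s).comp r, fun ρ' => by simp [Instr.runK, hr]⟩
        | had i => exact hphase _
        | diag S θ hθ => exact hphase _
        | meas i k =>
          obtain ⟨r, hr⟩ := hreset {i}
          exact ⟨∑ b : Fin 2, (κ (Function.update s k b)).comp
            (r.comp (conjHom (single i (projAngle 0 b)))), fun ρ' => by
              simp [Instr.runK, hr]⟩
        | flip i σ => exact hphase _
      choose κ' hκ' using hlin
      simp only [← hκ']
      rw [T.sem κ' ρ, Instr.runK_append]
      simp only [hκ'] }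

end Sim

/-! ### Extension of a simulation by one instruction -/

namespace Sim

variable {R : Type} [Fintype R] [DecidableEq R] {Q : List (Instr R)}

/-- A block of a well-formed pattern does not measure again the qubits that hold earlier
outcomes. -/
theorem mem_measured {T : Sim Q} {k : ℕ} (hk : k ∈ Instr.names Q) {A : Type}
    {blk : List (MCommand (T.W ⊕ A))}
    (h : MCommand.WF (Sum.inl '' MCommand.measured T.cmds) blk) :
    Sum.inl (T.nm k) ∉ MCommand.measured blk := fun h' =>
  Set.disjoint_left.1 h.disjoint h' ⟨_, T.nm_mem k hk, rfl⟩

/-- A simulation is extended by an instruction that produces and uses no outcomes. -/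
def extendGadget (T : Sim Q) (g : Instr R) (F : Op R → Op R) (G : Gadget R g.qubits F)
    (hw : g.writes = ∅)
    (hF : ∀ {β : Type} [AddCommMonoid β] (κ : (ℕ → Fin 2) → Op R → β) (s : ℕ → Fin 2) (ρ : Op R),
      Instr.runK [g] s ρ κ = κ s (F ρ)) : Sim (Q ++ [g]) := by
  let j : R ⊕ G.A ↪ T.W ⊕ G.A := T.loc.sumMap (Function.Embedding.refl G.A)
  have hj : ∀ x : R ⊕ G.A, j x ∉ Sum.inl '' MCommand.measured T.cmds := by
    rintro (x | x) ⟨w, hw, hx⟩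
    · obtain rfl := Sum.inl_injective hx
      exact T.loc_notMem x hw
    · cases hx
  have hown : ∀ x : R ⊕ G.A,
      Sum.elim T.own (some ∘ G.own) (j x) = some (Sum.elim id G.own x) := by
    rintro (x | x)
    · exact T.own_loc x
    · rfl
  have hwf : MCommand.WF (Sum.inl '' MCommand.measured T.cmds)
      (G.cmds.map (MCommand.map j)) :=
    G.wf.map j fun x => iff_of_false (hj x) (Set.notMem_empty x)
  have hn : Instr.names (Q ++ [g]) = Instr.names Q := by
    rw [Instr.names_append, Instr.names_cons, Instr.names_nil, hw, Set.union_empty,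
      Set.union_empty]
  refine T.extend g G.A G.own (G.cmds.map (MCommand.map j)) (G.out.trans j)
    (fun k => Sum.inl (T.nm k)) hwf (fun r => hj _) ?_ ?_ (fun _ _ => rfl) ?_ ?_ ?_ ?_ ?_ ?_
  · intro r
    rw [MCommand.measured_map]
    rintro ⟨x, hx, h⟩
    rw [j.injective h] at hx
    exact G.out_notMem r hx
  · intro r
    exact (hown _).trans (congrArg some (G.own_out r))
  · intro k hk; rw [hw] at hk; exact hk.elim
  · rw [hw]; exact Set.injOn_empty _
  · exact (chainDepth_map_le _ _ (MCommand.dep_map j)).trans G.depth_le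
  · intro p hp x hx
    obtain ⟨p, hp', rfl⟩ := List.mem_map.1 hp
    rw [MCommand.qubits_map] at hx
    obtain ⟨x, hx, rfl⟩ := hx
    exact ⟨_, G.touch p hp' x (Or.inl hx), hown x⟩
  · intro p hp x hx
    obtain ⟨p, hp', rfl⟩ := List.mem_map.1 hp
    rw [MCommand.reads_map] at hx
    obtain ⟨x, hx, rfl⟩ := hx
    exact Or.inl ⟨_, G.touch p hp' x (Or.inr hx), hown x⟩
  · intro β _ κ s ρ
    rw [hF, MCommand.runK_of_const _ _ _ _
      ((κ (pull T.nm (Instr.names Q) s)).comp (reduceHom (G.out.trans j)))]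
    · rw [AddMonoidHom.comp_apply, reduceHom_apply, reduce_trans, MCommand.run_map_reduce,
        reduce_sumMap_prepare, G.run_eq]
    · intro s' hs' ρ'
      rw [AddMonoidHom.comp_apply, reduceHom_apply, hn]
      congr 2
      funext k
      by_cases hk : k ∈ Instr.names Q
      · simp only [pull, if_pos hk]
        rw [hs' _ (mem_measured hk hwf)]
        exact extend_apply_range Function.Embedding.inl s 0 (T.nm k)
      · simp only [pull, if_neg hk]

/-- A simulation is extended by a measurement: after it the qubit is replaced by a fresh one. -/
def extendMeas (T : Sim Q) (i : R) (k : ℕ) (hk : k ∉ Instr.names Q) :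
    Sim (Q ++ [Instr.meas i k]) := by
  let j : R ⊕ R ↪ T.W ⊕ R := T.loc.sumMap (Function.Embedding.refl R)
  have hj : ∀ x : R ⊕ R, j x ∉ Sum.inl '' MCommand.measured T.cmds := by
    rintro (x | x) ⟨w, hw, hx⟩
    · obtain rfl := Sum.inl_injective hx
      exact T.loc_notMem x hw
    · cases hx
  have hown : ∀ x : R ⊕ R,
      Sum.elim T.own (some ∘ id) (j x) = some (Sum.elim id id x) := by
    rintro (x | x)
    · exact T.own_loc x
    · rfl
  have hwf : MCommand.WF (Sum.inl '' MCommand.measured T.cmds)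
      [MCommand.M (j (.inl i)) 0] := by
    refine ⟨?_, ?_, trivial⟩
    · rw [Set.disjoint_left]
      rintro _ rfl
      exact hj _
    · exact Set.empty_subset _
  have hm : MCommand.measured [MCommand.M (j (.inl i)) 0] = {j (.inl i)} := by
    simp [MCommand.measured, MCommand.writes]
  refine T.extend (Instr.meas i k) R id [MCommand.M (j (.inl i)) 0]
    ((relocate {i}).trans j) (fun l => if l = k then j (.inl i) else .inl (T.nm l)) hwf
    (fun r => hj _) ?_ ?_ ?_ ?_ ?_ ?_ ?_ ?_ ?_
  · intro r
    rw [hm, Set.mem_singleton_iff]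
    intro h
    have := j.injective h
    rw [relocate_apply] at this
    split_ifs at this with hr
    exact hr (Finset.mem_singleton.2 (Sum.inl_injective this))
  · intro r
    refine (hown _).trans (congrArg some ?_)
    by_cases hr : r ∈ ({i} : Finset R) <;> simp [relocate_apply, hr]
  · intro l hl
    refine if_neg ?_
    rintro rfl
    exact hk hl
  · intro l hl
    obtain rfl : l = k := hl
    rw [hm, if_pos rfl]; rfl
  · exact Set.injOn_singleton _ _
  · exact (chainDepth_le_length _).trans (by simp)
  · intro p hp x hx
    obtain rfl := List.mem_singleton.1 hp
    obtain rfl : x = j (.inl i) := hx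
    exact ⟨i, rfl, hown _⟩
  · intro p hp x hx
    obtain rfl := List.mem_singleton.1 hp
    exact hx.elim
  · intro β _ κ s ρ
    have hn : Instr.names (Q ++ [Instr.meas i k]) = Instr.names Q ∪ {k} := by
      rw [Instr.names_append, Instr.names_cons, Instr.names_nil, Set.union_empty]; rfl
    simp only [MCommand.runK, Instr.runK, hn]
    refine Finset.sum_congr rfl fun b _ => ?_
    have hrec : pull (fun l => if l = k then j (.inl i) else .inl (T.nm l)) (Instr.names Q ∪ {k})
        (Function.update (Function.extend (Function.Embedding.inl : T.W ↪ T.W ⊕ R) s 0)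
          (j (.inl i)) b) = Function.update (pull T.nm (Instr.names Q) s) k b := by
      funext l
      by_cases hl : l = k
      · subst hl
        simp [pull]
      · rw [Function.update_of_ne hl]
        simp only [pull, hl, if_false]
        by_cases hlQ : l ∈ Instr.names Q
        · rw [if_pos (Set.mem_union_left _ hlQ), if_pos hlQ, Function.update_of_ne]
          · exact extend_apply_range Function.Embedding.inl s 0 (T.nm l)
          · intro h
            refine T.loc_notMem i ?_
            rw [← Sum.inl_injective h]
            exact T.nm_mem l hlQ
        · rw [if_neg fun h => h.elim hlQ hl, if_neg hlQ]
    have hred : reduce ((relocate {i}).trans j) (conj (single (j (.inl i)) (projAngle 0 b))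
        (prepare .inl ketPlus ρ))
        = resetPlus {i} (conj (single i (projAngle 0 b)) (reduce T.loc ρ)) := by
      rw [reduce_trans, ← embed_single, reduce_conj_embed, reduce_sumMap_prepare,
        ← Function.Embedding.inl_apply, ← embed_single, conj_embed_prepare, resetPlus]
    rw [hrec, hred]

/-- A simulation is extended by a classically controlled `X`. -/
def extendFlip (T : Sim Q) (i : R) (σ : Finset ℕ) (hσ : (σ : Set ℕ) ⊆ Instr.names Q) :
    Sim (Q ++ [Instr.flip i σ]) := by
  let blk : List (MCommand (T.W ⊕ Empty)) :=
    [MCommand.X (.inl (T.loc i)) ((σ.image T.nm).map .inl)]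
  have hm : MCommand.measured blk = ∅ := by
    simp [blk, MCommand.measured, MCommand.writes]
  have hn : Instr.names (Q ++ [Instr.flip i σ]) = Instr.names Q := by
    rw [Instr.names_append, Instr.names_cons, Instr.names_nil, Set.union_empty]
    exact Set.union_empty _
  refine T.extend (Instr.flip i σ) Empty Empty.elim blk (T.loc.trans .inl)
    (fun k => .inl (T.nm k)) ?_ ?_ ?_ (fun r => T.own_loc r) (fun _ _ => rfl) ?_ ?_ ?_ ?_ ?_ ?_
  · refine ⟨?_, ?_, trivial⟩
    · rw [Set.disjoint_left]
      rintro _ rfl ⟨w, hw, h⟩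
      obtain rfl := Sum.inl_injective h
      exact T.loc_notMem i hw
    · intro x hx
      obtain ⟨w, hw, rfl⟩ := Finset.mem_map.1 (Finset.mem_coe.1 hx)
      obtain ⟨k, hk, rfl⟩ := Finset.mem_image.1 hw
      exact ⟨_, T.nm_mem k (hσ hk), rfl⟩
  · rintro r ⟨w, hw, h⟩
    obtain rfl := Sum.inl_injective h
    exact T.loc_notMem r hw
  · intro r
    rw [hm]
    exact Set.notMem_empty _
  · intro k hk; exact hk.elim
  · exact Set.injOn_empty _
  · exact (chainDepth_le_length _).trans (by simp [blk])
  · intro p hp x hx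
    obtain rfl := List.mem_singleton.1 hp
    obtain rfl : x = .inl (T.loc i) := hx
    exact ⟨i, rfl, T.own_loc i⟩
  · intro p hp x hx
    obtain rfl := List.mem_singleton.1 hp
    obtain ⟨w, hw, rfl⟩ := Finset.mem_map.1 (Finset.mem_coe.1 hx)
    obtain ⟨k, hk, rfl⟩ := Finset.mem_image.1 hw
    exact Or.inr ⟨k, hk, hσ hk, rfl⟩
  · intro β _ κ s ρ
    have hs : ∀ w, Function.extend (Function.Embedding.inl : T.W ↪ T.W ⊕ Empty) s 0 (.inl w)
        = s w := extend_apply_range Function.Embedding.inl s 0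
    simp only [blk, MCommand.runK, Instr.runK, hn]
    congr 2
    · funext k
      simp only [pull, hs]
    · have hsum : (∑ x ∈ (σ.image T.nm).map (Function.Embedding.inl : T.W ↪ T.W ⊕ Empty),
          Function.extend (Function.Embedding.inl : T.W ↪ T.W ⊕ Empty) s 0 x)
          = ∑ k ∈ σ, pull T.nm (Instr.names Q) s k := by
        rw [Finset.sum_map, Finset.sum_image fun k hk l hl h => T.nm_inj (hσ hk) (hσ hl) h]
        refine Finset.sum_congr rfl fun k hk => ?_
        rw [pull, if_pos (hσ hk)]
        exact hs _
      rw [hsum, reduce_trans, ← Function.Embedding.inl_apply, ← embed_single, reduce_conj_embed,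
        reduce_prepare _ ketPlus_norm, ← embed_single, reduce_conj_embed]

/-- The depth of a simulation is at most a constant times the depth of the program. -/
theorem depth_cmds_le (T : Sim Q) :
    chainDepth MCommand.Dep T.cmds ≤ 8 * chainDepth Instr.Dep Q := by
  have h := chainDepth_flatMap_le (dep := Instr.Dep) T.blocks T.depth_le ?_
  · rwa [T.fst_eq] at h
  refine List.pairwise_of_forall_mem_list fun a ha b hb p hp q hq hd => ?_
  rcases hd with ⟨x, hxp, hxq⟩ | ⟨x, hxp, hxq⟩
  · obtain ⟨r, hr, h1⟩ := T.touch a ha p hp x hxp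
    obtain ⟨r', hr', h2⟩ := T.touch b hb q hq x hxq
    rw [h1] at h2
    obtain rfl := Option.some_injective _ h2
    exact Or.inl ⟨r, hr, hr'⟩
  · obtain ⟨r, hr, h1⟩ := T.touch a ha p hp x (p.writes_subset_qubits hxp)
    rcases T.touch_reads b hb q hq x hxq with ⟨r', hr', h2⟩ | ⟨k, hk, hkQ, rfl⟩
    · rw [h1] at h2
      obtain rfl := Option.some_injective _ h2
      exact Or.inl ⟨r, hr, hr'⟩
    · exact Or.inr ⟨k, T.writes_nm a ha p hp k hkQ hxp, hk⟩

end Sim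

/-! ### Entries of operators -/

/-- The sign `(-1) ^ (a b)`. -/
def sg (a b : Fin 2) : ℂ := if a = 1 ∧ b = 1 then -1 else 1

/-- The phase `e ^ (i α a)`. -/
def ang (α : ℝ) (a : Fin 2) : ℂ := if a = 1 then Complex.exp (α * Complex.I) else 1

theorem star_ang (α : ℝ) (a : Fin 2) : star (ang α a) = ang (-α) a := by
  have hc : (starRingEnd ℂ) (Complex.exp (α * Complex.I)) = Complex.exp (-(α * Complex.I)) := by
    rw [← Complex.exp_conj]; simp
  fin_cases a <;> simp [ang, hc]

theorem ketPlus_apply (a : Fin 2) : ketPlus a = (Real.sqrt 2 : ℂ)⁻¹ := by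
  fin_cases a <;> simp [ketPlus, ketAngle]

theorem ketAngle_apply (α : ℝ) (b a : Fin 2) :
    ketAngle α b a = (Real.sqrt 2 : ℂ)⁻¹ * (sg b a * ang α a) := by
  fin_cases a <;> fin_cases b <;> simp [ketAngle, sg, ang]

theorem star_sg (a b : Fin 2) : star (sg a b) = sg a b := by
  unfold sg; split_ifs <;> simp

theorem projAngle_apply (α : ℝ) (b p q : Fin 2) :
    projAngle α b p q = 2⁻¹ * (sg b p * sg b q) * (ang α p * ang (-α) q) := by
  have hs : star ((Real.sqrt 2 : ℂ)⁻¹) = (Real.sqrt 2 : ℂ)⁻¹ := by simp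
  rw [projAngle, Matrix.vecMulVec_apply, Pi.star_apply, ketAngle_apply, ketAngle_apply, star_mul',
    star_mul', star_ang, star_sg, hs, ← sqrt_two_inv_mul_self]
  ring

theorem single_mul_apply {V X : Type} [Fintype V] [DecidableEq V] (i : V)
    (A : Matrix (Fin 2) (Fin 2) ℂ) (N : Matrix (Bits V) X ℂ) (w : Bits V) (x : X) :
    (single i A * N) w x = ∑ c, A (w i) c * N (Function.update w i c) x := by
  let e : Unit ↪ V := ⟨fun _ => i, fun _ _ _ => rfl⟩
  have h : single i A = embed e (single () A) := (embed_single e () A).symm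
  have hex : ∀ c : Fin 2, Function.extend e (fun _ => c) w = Function.update w i c := by
    intro c
    funext v
    by_cases hv : v = i
    · subst hv
      rw [Function.update_self]
      exact extend_apply_range e (fun _ => c) w ()
    · rw [Function.update_of_ne hv, extend_apply_notMem]
      rintro ⟨_, rfl⟩
      exact hv rfl
  rw [h, embed_mul_apply, ← (Equiv.funUnique Unit (Fin 2)).symm.sum_comp]
  refine Finset.sum_congr rfl fun c _ => ?_
  have hc : (Equiv.funUnique Unit (Fin 2)).symm c = fun _ => c := rfl
  rw [hc, hex, single, Matrix.of_apply, if_pos fun v hv => absurd rfl hv]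
  rfl

/-- If an isometry factors as `B ⊗ η`, with `η` on the discarded qubits, then it acts as `B` on
the reduced state. -/
theorem reduce_of_factor {U V W : Type} [Fintype U] [DecidableEq U] [Fintype V] [DecidableEq V]
    [Fintype W] [DecidableEq W] (out : V ↪ W)
    (N : Matrix (Bits W) (Bits U) ℂ) (B : Matrix (Bits V) (Bits U) ℂ) (η : Bits W → ℂ) (c : ℂ)
    (hN : ∀ w x, N w x = B (w ∘ out) x * η w) (hη : ∀ y w, η (Function.extend out y w) = η w)
    (hc : ∀ x : Bits V, (∑ u, if u ∘ out = x then η u * star (η u) else 0) = c) (ρ : Op U) :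
    reduce out (N * ρ * Nᴴ) = c • (B * ρ * Bᴴ) := by
  ext x y
  rw [reduce_apply, Matrix.smul_apply, smul_eq_mul, ← hc x, Finset.sum_mul]
  refine Finset.sum_congr rfl fun u _ => ?_
  split_ifs with h
  · simp only [Matrix.mul_apply, Matrix.conjTranspose_apply, hN, extend_comp_self, hη, h, star_mul',
      Finset.sum_mul, Finset.mul_sum]
    refine Finset.sum_congr rfl fun a _ => Finset.sum_congr rfl fun b _ => ?_
    ring
  · simp

/-! ### The Hadamard gadget -/

/-- The register with qubit `i` replaced by the ancilla. -/
def teleOut {R : Type} [DecidableEq R] (i : R) : R ↪ R ⊕ Unit where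
  toFun r := if r = i then .inr () else .inl r
  inj' a b h := by
    by_cases ha : a = i <;> by_cases hb : b = i <;> simp_all

theorem teleOut_apply {R : Type} [DecidableEq R] (i r : R) :
    teleOut i r = if r = i then .inr () else .inl r := rfl

/-- The branch `b` of the teleportation of qubit `i` through an edge to a fresh ancilla. -/
theorem teleport_branch {R : Type} [Fintype R] [DecidableEq R] (i : R) (b : Fin 2) (ρ : Op R) :
    reduce (teleOut i) (conj (single (.inr ()) (gateX ^ (b : ℕ)))
      (conj (single (.inl i) (projAngle 0 b))
        (conj (cz (.inl i) (.inr ())) (prepare .inl ketPlus ρ))))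
      = (2⁻¹ : ℂ) • conj (single i gateH) ρ := by
  classical
  let a : R ⊕ Unit := .inl i
  let c : R ⊕ Unit := .inr ()
  let J : Matrix (Bits (R ⊕ Unit)) (Bits R) ℂ := inj Function.Embedding.inl ketPlus
  set N : Matrix (Bits (R ⊕ Unit)) (Bits R) ℂ :=
    single c (gateX ^ (b : ℕ)) * (single a (projAngle 0 b) * (cz a c * J)) with hNdef
  have hrew : conj (single (.inr ()) (gateX ^ (b : ℕ)))
      (conj (single (.inl i) (projAngle 0 b))
        (conj (cz (.inl i) (.inr ())) (prepare .inl ketPlus ρ))) = N * ρ * Nᴴ := by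
    simp only [prepare_eq, conj, hNdef, J, a, c, Matrix.conjTranspose_mul, Matrix.mul_assoc]
  rw [hrew]
  have hcond : ∀ (w : Bits (R ⊕ Unit)) (x : Bits R) (c c' : Fin 2),
      Function.update (Function.update w (.inr ()) c') (.inl i) c ∘
        (Function.Embedding.inl : R ↪ R ⊕ Unit) = x ↔
        (∀ v, v ≠ i → w (.inl v) = x v) ∧ c = x i := by
    intro w x c c'
    constructor
    · rintro rfl
      refine ⟨fun v hv => ?_, by simp⟩
      simp [hv]
    · rintro ⟨h, rfl⟩
      funext v
      by_cases hv : v = i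
      · subst hv; simp
      · simp [hv, h v hv]
  refine reduce_of_factor (teleOut i) N (single i gateH) (fun w => 2⁻¹ * sg b (w (.inl i))) _
    ?_ ?_ ?_ ρ
  · intro w x
    rw [hNdef, single_mul_apply]
    simp only [a, c, J, single_mul_apply, cz, Matrix.diagonal_mul, inj_apply, hcond]
    have hB : single i gateH (w ∘ teleOut i) x
        = if ∀ v, v ≠ i → w (.inl v) = x v then gateH (w (.inr ())) (x i) else 0 := by
      rw [single, Matrix.of_apply]
      have h1 : (w ∘ teleOut i) i = w (.inr ()) := by simp [teleOut_apply]
      rw [h1]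
      refine if_congr (forall₂_congr fun v hv => ?_) rfl rfl
      simp [teleOut_apply, hv]
    rw [hB]
    by_cases h : ∀ v, v ≠ i → w (.inl v) = x v
    · simp only [if_pos h, and_iff_right h, mul_ite, mul_zero, Finset.sum_ite_eq',
        Finset.mem_univ, if_true]
      have hp : ∀ w : Bits (R ⊕ Unit), (∏ v, if v ∈ Set.range
          (Function.Embedding.inl : R ↪ R ⊕ Unit) then (1 : ℂ) else ketPlus (w v))
          = (Real.sqrt 2 : ℂ)⁻¹ := by
        intro w
        rw [Fintype.prod_sum_type]
        simp [ketPlus_apply]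
      simp only [hp, Function.update_self, Function.update_of_ne (Sum.inr_ne_inl (a := i)
        (b := ())), projAngle_apply]
      generalize x i = p
      generalize w (Sum.inr ()) = q
      simp only [ne_eq, reduceCtorEq, not_false_eq_true, Function.update_of_ne]
      generalize w (Sum.inl i) = r
      fin_cases b <;> fin_cases p <;> fin_cases q <;> fin_cases r <;>
        simp [gateX, gateH, sg, ang] <;> ring
    · simp only [h, false_and, if_false, mul_zero, Finset.sum_const_zero, zero_mul]
  · intro y w
    have : (Sum.inl i : R ⊕ Unit) ∉ Set.range (teleOut i) := by
      rintro ⟨r, hr⟩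
      rw [teleOut_apply] at hr
      split_ifs at hr with h
      exact h (Sum.inl_injective hr)
    simp only [extend_apply_notMem _ _ _ this]
  · intro x
    have hu : ∀ u : Bits (R ⊕ Unit), u ∘ teleOut i = x ↔
        u = Sum.elim x (fun _ => x i) ∨
        u = Sum.elim (Function.update x i (x i + 1)) (fun _ => x i) := by
      intro u
      constructor
      · rintro rfl
        have h2 : ∀ p q : Fin 2, p = q ∨ p = q + 1 := by decide
        rcases h2 (u (.inl i)) (u (.inr ())) with h | h
        · left
          funext v
          rcases v with v | v
          · by_cases hv : v = i
            · subst hv; simpa [teleOut_apply] using h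
            · simp [teleOut_apply, hv]
          · simp [teleOut_apply]
        · right
          funext v
          rcases v with v | v
          · by_cases hv : v = i
            · subst hv; simpa [teleOut_apply] using h
            · simp [teleOut_apply, hv]
          · simp [teleOut_apply]
      · have h1 : ∀ x' : Bits R, (∀ v, v ≠ i → x' v = x v) →
            Sum.elim x' (fun _ : Unit => x i) ∘ teleOut i = x := by
          intro x' hx'
          funext v
          by_cases hv : v = i
          · subst hv; simp [teleOut_apply]
          · simp [teleOut_apply, hv, hx' v hv]
        rintro (rfl | rfl)
        · exact h1 x fun _ _ => rfl
        · exact h1 _ fun v hv => Function.update_of_ne hv _ _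
    rw [← Finset.sum_filter]
    have hf : Finset.univ.filter (fun u : Bits (R ⊕ Unit) => u ∘ teleOut i = x)
        = {Sum.elim x (fun _ => x i),
          Sum.elim (Function.update x i (x i + 1)) (fun _ => x i)} := by
      ext u
      rw [Finset.mem_filter, hu, Finset.mem_insert, Finset.mem_singleton]
      exact and_iff_right (Finset.mem_univ u)
    have hne : (Sum.elim x (fun _ => x i) : Bits (R ⊕ Unit))
        ≠ Sum.elim (Function.update x i (x i + 1)) (fun _ => x i) := by
      intro h
      have h1 := congrFun h (.inl i)
      have h2 : ∀ p : Fin 2, p ≠ p + 1 := by decide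
      simp at h1
    rw [hf, Finset.sum_pair hne]
    have hsq : ∀ p, (2⁻¹ * sg b p) * star (2⁻¹ * sg b p) = (4⁻¹ : ℂ) := by
      intro p
      rw [star_mul', star_sg]
      unfold sg
      split_ifs <;> norm_num
    rw [hsq, hsq]
    norm_num

/-- Teleportation through an edge of a graph state performs a Hadamard gate. -/
def hadGadget {R : Type} [Fintype R] [DecidableEq R] (i : R) :
    Gadget R (Instr.had i).qubits (conj (single i gateH)) where
  A := Unit
  fintypeA := inferInstance
  decEqA := inferInstance
  cmds := [MCommand.E (.inl i) (.inr ()) (by simp), MCommand.M (.inl i) 0,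
    MCommand.X (.inr ()) {.inl i}]
  out := teleOut i
  own _ := i
  wf := by simp [MCommand.WF, MCommand.qubits, MCommand.reads, MCommand.writes]
  out_notMem r := by
    simp only [MCommand.measured_cons, MCommand.measured_nil, MCommand.writes]
    by_cases hr : r = i <;> simp [teleOut_apply, hr]
  own_out r := by by_cases hr : r = i <;> simp [teleOut_apply, hr]
  touch p hp x hx := by
    simp only [List.mem_cons, List.not_mem_nil, or_false] at hp
    rcases hp with rfl | rfl | rfl <;> rcases hx with hx | hx <;>
      simp only [MCommand.qubits, MCommand.reads, Finset.coe_singleton,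
        Set.mem_insert_iff, Set.mem_singleton_iff, Set.mem_empty_iff_false] at hx
    · rcases hx with rfl | rfl <;> rfl
    all_goals subst hx; rfl
  depth_le := (chainDepth_le_length _).trans (by simp)
  run_eq s ρ := by
    simp only [MCommand.run, Finset.sum_singleton, Function.update_self, Fin.sum_univ_two,
      reduce_add, teleport_branch]
    rw [← add_smul]
    norm_num

/-! ### Tensor products of one-qubit operators -/

section Multi

variable {V W : Type} [Fintype V] [DecidableEq V]

/-- The tensor product of the one-qubit operators `A v`. -/
def multi (A : V → Matrix (Fin 2) (Fin 2) ℂ) : Op V :=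
  Matrix.of fun x y => ∏ v, A v (x v) (y v)

theorem sum_bits_prod (F : V → Fin 2 → ℂ) :
    ∑ z : Bits V, ∏ v, F v (z v) = ∏ v, ∑ c, F v c := by
  rw [Finset.prod_univ_sum, Fintype.piFinset_univ]

theorem multi_mul (A B : V → Matrix (Fin 2) (Fin 2) ℂ) :
    multi A * multi B = multi fun v => A v * B v := by
  ext x y
  simp only [multi, Matrix.mul_apply, Matrix.of_apply, ← Finset.prod_mul_distrib]
  exact sum_bits_prod fun v c => A v (x v) c * B v c (y v)

theorem single_eq_multi (i : V) (A : Matrix (Fin 2) (Fin 2) ℂ) :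
    single i A = multi (Function.update 1 i A) := by
  ext x y
  simp only [single, multi, Matrix.of_apply]
  by_cases h : ∀ v, v ≠ i → x v = y v
  · rw [if_pos h, Finset.prod_eq_single i]
    · rw [Function.update_self]
    · intro v _ hv
      rw [Function.update_of_ne hv, Pi.one_apply, h v hv, Matrix.one_apply_eq]
    · intro hi; exact absurd (Finset.mem_univ i) hi
  · rw [if_neg h]
    push Not at h
    obtain ⟨v, hv, hxy⟩ := h
    rw [Finset.prod_eq_zero (Finset.mem_univ v)]
    rw [Function.update_of_ne hv, Pi.one_apply, Matrix.one_apply_ne hxy]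

theorem multi_one : multi (fun _ : V => (1 : Matrix (Fin 2) (Fin 2) ℂ)) = 1 := by
  ext x y
  simp only [multi, Matrix.of_apply, Matrix.one_apply]
  by_cases h : x = y
  · subst h; simp
  · rw [if_neg h]
    obtain ⟨v, hv⟩ := Function.ne_iff.1 h
    exact Finset.prod_eq_zero (Finset.mem_univ v) (if_neg hv)

end Multi

/-! ### Kraus operators of the branches of a pattern -/

namespace MCommand

variable {W : Type} [Fintype W] [DecidableEq W]

/-- The operator applied by a command when the outcomes are given by `o`. -/
def act (o : W → Fin 2) : MCommand W → Op W
  | E i j _ => cz i j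
  | M i α => single i (projAngle α (o i))
  | X i σ => single i (gateX ^ ((∑ j ∈ σ, o j : Fin 2) : ℕ))
  | Z i σ => single i (gateZ ^ ((∑ j ∈ σ, o j : Fin 2) : ℕ))

/-- The operator applied by a sequence of commands when the outcomes are given by `o`. -/
def kraus (o : W → Fin 2) : List (MCommand W) → Op W
  | [] => 1
  | p :: A => kraus o A * p.act o

theorem kraus_append (o : W → Fin 2) (A B : List (MCommand W)) :
    kraus o (A ++ B) = kraus o B * kraus o A := by
  induction A with
  | nil => simp [kraus]
  | cons p A ih => simp only [List.cons_append, kraus, ih, Matrix.mul_assoc]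

open Classical in
/-- A well-formed pattern is the sum of its branches, which are indexed by the outcomes: no
outcome is overwritten or used before it is obtained. -/
theorem run_eq_sum_kraus {m : Set W} {A : List (MCommand W)} (h : WF m A) (s : W → Fin 2)
    (ρ : Op W) :
    run A s ρ = ∑ o : W → Fin 2,
      if ∀ v, v ∉ measured A → o v = s v then conj (kraus o A) ρ else 0 := by
  induction A generalizing m s ρ with
  | nil =>
    have : ∀ o : W → Fin 2, (∀ v, v ∉ measured ([] : List (MCommand W)) → o v = s v) ↔ o = s := by
      intro o
      simp [measured_nil, funext_iff]
    simp only [this, Finset.sum_ite_eq', Finset.mem_univ, if_true, run, kraus, conj_one]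
  | cons p A ih =>
    have hd := h.2.2.disjoint
    have hm : p.writes = ∅ → measured (p :: A) = measured A := by
      intro hp
      rw [measured_cons, hp, Set.empty_union]
    have hr : ∀ o : W → Fin 2, (∀ v, v ∉ measured A → o v = s v) → ∀ v ∈ p.reads, o v = s v :=
      fun o ho v hv => ho v fun hv' =>
        Set.disjoint_left.1 hd hv' (Or.inl (h.2.1 hv))
    cases p with
    | E i j hij =>
      simp only [run, kraus, act, ih h.2.2, hm rfl, conj_conj]
    | M i α =>
      have hi : i ∉ measured A := fun hi => Set.disjoint_left.1 hd hi (Or.inr rfl)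
      simp only [run, kraus, act, ih h.2.2]
      rw [Finset.sum_comm]
      refine Finset.sum_congr rfl fun o _ => ?_
      have key : ∀ b : Fin 2, (∀ v, v ∉ measured A → o v = Function.update s i b v) ↔
          b = o i ∧ ∀ v, v ∉ measured (M i α :: A) → o v = s v := by
        intro b
        rw [measured_cons]
        constructor
        · intro h1
          refine ⟨?_, fun v hv => ?_⟩
          · rw [h1 i hi, Function.update_self]
          · rw [Set.mem_union, not_or] at hv
            rw [h1 v hv.2, Function.update_of_ne hv.1]
        · rintro ⟨rfl, h1⟩ v hv
          by_cases hvi : v = i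
          · subst hvi; rw [Function.update_self]
          · rw [Function.update_of_ne hvi, h1 v]
            rw [Set.mem_union, not_or]
            exact ⟨hvi, hv⟩
      simp only [key, conj_conj]
      by_cases hc : ∀ v, v ∉ measured (M i α :: A) → o v = s v
      · rw [if_pos hc]
        simp only [and_iff_left hc, Finset.sum_ite_eq', Finset.mem_univ, if_true]
      · simp only [hc, and_false, if_false, Finset.sum_const_zero]
    | X i σ =>
      simp only [run, kraus, act, ih h.2.2, hm rfl, conj_conj]
      refine Finset.sum_congr rfl fun o _ => ?_
      split_ifs with ho
      · rw [Finset.sum_congr rfl fun v hv => hr o ho v hv]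
      · rfl
    | Z i σ =>
      simp only [run, kraus, act, ih h.2.2, hm rfl, conj_conj]
      refine Finset.sum_congr rfl fun o _ => ?_
      split_ifs with ho
      · rw [Finset.sum_congr rfl fun v hv => hr o ho v hv]
      · rfl

/-- A layer of one-qubit commands on distinct qubits is a tensor product. -/
theorem kraus_layer {ι : Type} [Fintype ι] [DecidableEq ι] (f : ι ↪ W) (C : ι → MCommand W)
    (B : ι → Matrix (Fin 2) (Fin 2) ℂ) (o : W → Fin 2)
    (h : ∀ a, (C a).act o = single (f a) (B a)) :
    kraus o (Finset.univ.toList.map C) = embed f (multi B) := by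
  have key : ∀ l : List ι, l.Nodup →
      kraus o (l.map C) = embed f (multi fun a => if a ∈ l then B a else 1) := by
    intro l hl
    induction l with
    | nil => simp [kraus, multi_one, embed_one]
    | cons a l ih =>
      rw [List.nodup_cons] at hl
      rw [List.map_cons, kraus, ih hl.2, h, ← embed_single, embed_mul, single_eq_multi, multi_mul]
      congr 2
      funext b
      by_cases hb : b = a
      · subst hb
        simp [hl.1]
      · simp [hb]
  rw [key _ (Finset.nodup_toList _)]
  simp

theorem wf_of_no_writes {m : Set W} {A : List (MCommand W)} (h1 : ∀ p ∈ A, p.writes = ∅)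
    (h2 : ∀ p ∈ A, Disjoint p.qubits m ∧ p.reads ⊆ m) : WF m A := by
  induction A with
  | nil => trivial
  | cons p A ih =>
    refine ⟨(h2 p (by simp)).1, (h2 p (by simp)).2, ?_⟩
    rw [h1 p (by simp), Set.union_empty]
    exact ih (fun q hq => h1 q (by simp [hq])) fun q hq => h2 q (by simp [hq])

theorem measured_of_no_writes {A : List (MCommand W)} (h1 : ∀ p ∈ A, p.writes = ∅) :
    measured A = ∅ := by
  ext v
  simp only [measured, Set.mem_ofPred_eq, Set.mem_empty_iff_false, iff_false, not_exists, not_and]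
  intro p hp hv
  rw [h1 p hp] at hv
  exact hv

theorem measured_layer {ι : Type} (f : ι ↪ W) (α : ι → ℝ) (l : List ι) :
    measured (l.map fun a => M (f a) (α a)) = f '' {a | a ∈ l} := by
  ext v
  simp only [measured, List.mem_map, Set.mem_ofPred_eq, Set.mem_image]
  constructor
  · rintro ⟨_, ⟨a, ha, rfl⟩, hv⟩
    exact ⟨a, ha, hv.symm⟩
  · rintro ⟨a, ha, rfl⟩
    exact ⟨_, ⟨a, ha, rfl⟩, rfl⟩

theorem wf_layer {ι : Type} (f : ι ↪ W) (α : ι → ℝ) {m : Set W} {l : List ι} (hl : l.Nodup)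
    (h : ∀ a ∈ l, f a ∉ m) : WF m (l.map fun a => M (f a) (α a)) := by
  induction l generalizing m with
  | nil => trivial
  | cons a l ih =>
    rw [List.nodup_cons] at hl
    refine ⟨?_, Set.empty_subset _, ih hl.2 fun b hb => ?_⟩
    · rw [Set.disjoint_left]
      rintro _ rfl
      exact h a (by simp)
    · rintro (hb' | hb')
      · exact h b (by simp [hb]) hb'
      · rw [f.injective hb'] at hb
        exact hl.1 hb

theorem chainDepth_layer {ι : Type} (C : ι → MCommand W) {l : List ι} (hl : l.Nodup)
    (h : ∀ a b, Dep (C a) (C b) → a = b) : chainDepth Dep (l.map C) ≤ 1 := by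
  refine chainDepth_le_one ?_
  rw [List.pairwise_map]
  exact hl.imp fun hne hd => hne (h _ _ hd)

end MCommand

/-! ### Networks of parity constraints -/

theorem sg_add_left (a b c : Fin 2) : sg (a + b) c = sg a c * sg b c := by
  fin_cases a <;> fin_cases b <;> fin_cases c <;> simp [sg]

theorem sg_comm (a b : Fin 2) : sg a b = sg b a := by
  simp only [sg, and_comm]

theorem sg_zero_left (a : Fin 2) : sg 0 a = 1 := by simp [sg]

theorem sg_mul_self (a b : Fin 2) : sg a b * sg a b = 1 := by
  unfold sg; split_ifs <;> simp

theorem sg_sum_left {ι : Type*} (s : Finset ι) (f : ι → Fin 2) (c : Fin 2) :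
    sg (∑ i ∈ s, f i) c = ∏ i ∈ s, sg (f i) c := by
  classical
  induction s using Finset.induction_on with
  | empty => simp [sg_zero_left]
  | insert a s ha ih => rw [Finset.sum_insert ha, Finset.prod_insert ha, sg_add_left, ih]

/-- The sum modulo 2 of the qubits attached to the constraint `a`. -/
def parityAt {κ Y : Type} [DecidableEq Y] (edges : List (κ × Y)) (z : κ → Fin 2) (a : Y) : Fin 2 :=
  (edges.map fun q => if q.2 = a then z q.1 else 0).sum

theorem prod_edges {κ Y : Type} [Fintype Y] [DecidableEq Y] (edges : List (κ × Y))
    (z : κ → Fin 2) (b : Y → Fin 2) :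
    (edges.map fun q => sg (z q.1) (b q.2)).prod = ∏ a, sg (parityAt edges z a) (b a) := by
  induction edges with
  | nil => simp [parityAt, sg_zero_left]
  | cons q l ih =>
    rw [List.map_cons, List.prod_cons, ih]
    have : ∀ a, sg (parityAt (q :: l) z a) (b a)
        = (if q.2 = a then sg (z q.1) (b a) else 1) * sg (parityAt l z a) (b a) := by
      intro a
      rw [parityAt, List.map_cons, List.sum_cons, sg_add_left]
      split_ifs
      · rfl
      · rw [sg_zero_left]; rfl
    simp only [this, Finset.prod_mul_distrib, Finset.prod_ite_eq, Finset.mem_univ, if_true]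

/-- A network of parity constraints over the data qubits `ι` and variables `Y`: there is one
constraint for every variable, saying that the sum modulo 2 of the qubits joined to it by an edge
has a given value. Every constraint vector `s` has exactly one solution, in which the variable `a`
is a sum of data qubits (those in `F a`) and of entries of `s` (those in `G a`). Four layers of
edges suffice. -/
structure XorNet (ι Y : Type) [DecidableEq Y] where
  edges : List ((ι ⊕ Y) × Y)
  F : Y → Finset ι
  G : Y → Finset Y
  sol : ∀ (x : ι → Fin 2) (y s : Y → Fin 2),
    (∀ a, parityAt edges (Sum.elim x y) a = s a) ↔
      ∀ a, y a = ∑ i ∈ F a, x i + ∑ b ∈ G a, s b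
  depth_le : chainDepth (fun q q' => q.1 = q'.1 ∨ q.2 = q'.2) edges ≤ 4

namespace XorNet

variable {R ι Y : Type} [Fintype R] [DecidableEq R] [Fintype ι] [DecidableEq ι]
  [Fintype Y] [DecidableEq Y]

/-- The qubit of a variable. -/
def varQ : Y ↪ R ⊕ (Y ⊕ Y) := Function.Embedding.inl.trans Function.Embedding.inr

/-- The qubit of a constraint. -/
def conQ : Y ↪ R ⊕ (Y ⊕ Y) := Function.Embedding.inr.trans Function.Embedding.inr

/-- The qubit of a data qubit or variable. -/
def valQ (e : ι ↪ R) : ι ⊕ Y → R ⊕ (Y ⊕ Y) := Sum.elim (fun i => .inl (e i)) varQ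

/-- A data qubit inside the extended register. -/
def dataQ (e : ι ↪ R) : ι ↪ R ⊕ (Y ⊕ Y) := e.trans Function.Embedding.inl

theorem valQ_ne_conQ (e : ι ↪ R) (z : ι ⊕ Y) (a : Y) : valQ e z ≠ conQ a := by
  rcases z with i | a' <;> simp [valQ, varQ, conQ]

/-- The edge command joining a data qubit or variable to a constraint. -/
def edgeCmd (e : ι ↪ R) (q : (ι ⊕ Y) × Y) : MCommand (R ⊕ (Y ⊕ Y)) :=
  MCommand.E (valQ e q.1) (conQ q.2) (valQ_ne_conQ e q.1 q.2)

variable (N : XorNet ι Y) (e : ι ↪ R) (θ : Y → ℝ)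

/-- The pattern that applies the phase `θ a` to the parity of the data qubits in `F a`, for every
`a`. Measuring the constraint qubits makes the variables equal to these parities up to known bit
flips; the variables are then measured at the angles given by the phases. -/
def cmds : List (MCommand (R ⊕ (Y ⊕ Y))) :=
  N.edges.map (edgeCmd e) ++
    ((Finset.univ.toList.map fun a => MCommand.M (conQ a) 0) ++
    ((Finset.univ.toList.map fun a => MCommand.X (varQ a) ((N.G a).map conQ)) ++
    ((Finset.univ.toList.map fun a => MCommand.M (varQ a) (-θ a)) ++
      (Finset.univ.toList.map fun i => MCommand.Z (dataQ e i)
        ((Finset.univ.filter fun a => i ∈ N.F a).map varQ)))))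

/-- The total phase. -/
def total (x : Bits R) : ℝ := ∑ a, θ a * ((∑ i ∈ N.F a, x (e i) : Fin 2) : ℕ)

/-- Four layers of edges, followed by one layer of each of the other four kinds of commands. -/
theorem chainDepth_cmds : chainDepth MCommand.Dep (N.cmds e θ) ≤ 8 := by
  have h1 : chainDepth MCommand.Dep (N.edges.map (edgeCmd e)) ≤ 4 := by
    refine (chainDepth_map_le _ _ fun q q' h => ?_).trans N.depth_le
    rcases h with ⟨x, hx, hx'⟩ | ⟨x, hx, -⟩
    · have hv : Function.Injective (valQ (Y := Y) e) := by
        rintro (i | a) (i' | a') h <;> simp_all [valQ, varQ]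
      rcases hx with rfl | rfl <;> rcases hx' with h | h
      · exact Or.inl (hv h)
      · exact absurd h (valQ_ne_conQ _ _ _)
      · exact absurd h.symm (valQ_ne_conQ _ _ _)
      · exact Or.inr (conQ.injective h)
    · exact hx.elim
  have hlayer : ∀ {κ : Type} [Fintype κ] (f : κ ↪ R ⊕ (Y ⊕ Y)) (C : κ → MCommand (R ⊕ (Y ⊕ Y))),
      (∀ a, (C a).qubits = {f a}) → (∀ a b, Disjoint (C a).writes (C b).reads) →
      chainDepth MCommand.Dep (Finset.univ.toList.map C) ≤ 1 := by
    intro κ _ f C hC hC'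
    refine MCommand.chainDepth_layer _ (Finset.nodup_toList _) fun a b hd => ?_
    rcases hd with ⟨x, hx, hx'⟩ | h
    · rw [hC] at hx hx'
      obtain rfl : x = f a := hx
      exact f.injective hx'
    · rw [← Set.not_disjoint_iff_nonempty_inter] at h
      exact absurd (hC' a b) h
  refine (chainDepth_append_le_of_le h1 (chainDepth_append_le_of_le
    (hlayer conQ _ (fun _ => rfl) fun _ _ => Set.disjoint_empty _)
    (chainDepth_append_le_of_le (hlayer varQ _ (fun _ => rfl) fun _ _ => Set.empty_disjoint _)
    (chainDepth_append_le_of_le (hlayer varQ _ (fun _ => rfl) fun _ _ => Set.disjoint_empty _)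
    (hlayer (dataQ e) _ (fun _ => rfl) fun _ _ => Set.empty_disjoint _))))).trans ?_
  norm_num

theorem wf_and_measured : MCommand.WF ∅ (N.cmds e θ) ∧
    MCommand.measured (N.cmds e θ) = Set.range Sum.inr := by
  have hEw : ∀ p ∈ N.edges.map (edgeCmd e), p.writes = ∅ := by
    intro p hp
    obtain ⟨q, -, rfl⟩ := List.mem_map.1 hp
    rfl
  have hE := MCommand.measured_of_no_writes hEw
  have hX := MCommand.measured_of_no_writes
    (A := Finset.univ.toList.map fun a => MCommand.X (varQ (R := R) a) ((N.G a).map conQ))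
    (by simp [MCommand.writes])
  have hZ := MCommand.measured_of_no_writes
    (A := Finset.univ.toList.map fun i => MCommand.Z (dataQ e i)
        ((Finset.univ.filter fun a => i ∈ N.F a).map varQ))
    (by simp [MCommand.writes])
  have hMc := MCommand.measured_layer (conQ (R := R) (Y := Y)) (fun _ => 0) Finset.univ.toList
  have hMv := MCommand.measured_layer (varQ (R := R) (Y := Y)) (fun a => -θ a) Finset.univ.toList
  constructor
  · simp only [cmds, MCommand.wf_append, hE, hX, hMc, hMv, Set.union_empty, Set.empty_union,
      Finset.mem_toList, Finset.mem_univ]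
    refine ⟨?_, ?_, ?_, ?_, ?_⟩
    · refine MCommand.wf_of_no_writes hEw fun p hp => ?_
      obtain ⟨q, -, rfl⟩ := List.mem_map.1 hp
      exact ⟨Set.disjoint_empty _, Set.empty_subset _⟩
    · exact MCommand.wf_layer conQ _ (Finset.nodup_toList _) fun a _ => Set.notMem_empty _
    · refine MCommand.wf_of_no_writes (by simp [MCommand.writes]) fun p hp => ?_
      obtain ⟨a, -, rfl⟩ := List.mem_map.1 hp
      constructor
      · simp [MCommand.qubits, varQ, conQ]
      · intro x hx
        obtain ⟨b, -, rfl⟩ := Finset.mem_map.1 (Finset.mem_coe.1 hx)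
        exact ⟨b, trivial, rfl⟩
    · refine MCommand.wf_layer varQ _ (Finset.nodup_toList _) fun a _ => ?_
      simp [varQ, conQ]
    · refine MCommand.wf_of_no_writes (by simp [MCommand.writes]) fun p hp => ?_
      obtain ⟨a, -, rfl⟩ := List.mem_map.1 hp
      constructor
      · simp [MCommand.qubits, varQ, conQ, dataQ]
      · intro x hx
        obtain ⟨b, -, rfl⟩ := Finset.mem_map.1 (Finset.mem_coe.1 hx)
        exact Or.inr ⟨b, trivial, rfl⟩
  · simp only [cmds, MCommand.measured_append, hE, hX, hZ, hMc, hMv, Set.union_empty,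
      Set.empty_union, Finset.mem_toList, Finset.mem_univ]
    ext x
    rcases x with x | x | x <;> simp [varQ, conQ]

/-! The amplitude of a branch is computed layer by layer. -/

/-- A constraint qubit joined to qubits of parity `l` is measured in `|±⟩` with outcome `l`. -/
theorem sum_projAngle_sg (o b l : Fin 2) :
    ∑ c, projAngle 0 o b c * sg l c = sg o b * (if l = o then 1 else 0) := by
  simp only [projAngle_apply, Fin.sum_univ_two]
  fin_cases o <;> fin_cases b <;> fin_cases l <;> simp [sg, ang] <;> norm_num

theorem gateX_pow_apply (g y c : Fin 2) :
    (gateX ^ (g : ℕ)) y c = if c = y + g then 1 else 0 := by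
  fin_cases g <;> fin_cases y <;> fin_cases c <;> simp [gateX]

theorem gateZ_pow_apply (g y c : Fin 2) :
    (gateZ ^ (g : ℕ)) y c = if y = c then sg g y else 0 := by
  fin_cases g <;> fin_cases y <;> fin_cases c <;> simp [gateZ, sg]

theorem extend_varQ (x : Bits R) (y b c : Y → Fin 2) :
    Function.extend (varQ (R := R)) c (Sum.elim x (Sum.elim y b) : Bits (R ⊕ (Y ⊕ Y)))
      = Sum.elim x (Sum.elim c b) := by
  symm
  rw [← comp_eq_iff]
  refine ⟨rfl, ?_⟩
  rintro (v | v | v) hv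
  · rfl
  · exact absurd ⟨v, rfl⟩ hv
  · rfl

theorem extend_conQ (x : Bits R) (y b c : Y → Fin 2) :
    Function.extend (conQ (R := R)) c (Sum.elim x (Sum.elim y b) : Bits (R ⊕ (Y ⊕ Y)))
      = Sum.elim x (Sum.elim y c) := by
  symm
  rw [← comp_eq_iff]
  refine ⟨rfl, ?_⟩
  rintro (v | v | v) hv
  · rfl
  · rfl
  · exact absurd ⟨v, rfl⟩ hv

theorem sum_extend_inl {V A : Type} [Fintype V] [DecidableEq V] [Fintype A] [DecidableEq A]
    (x : Bits V) (c : ℂ) :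
    (∑ u : Bits (V ⊕ A), if u ∘ Sum.inl = x then c else 0) = 2 ^ Fintype.card A * c := by
  rw [← (Equiv.sumArrowEquivProdArrow V A (Fin 2)).symm.sum_comp, Fintype.sum_prod_type]
  have : ∀ (a : V → Fin 2) (b : A → Fin 2),
      ((Equiv.sumArrowEquivProdArrow V A (Fin 2)).symm (a, b)) ∘ Sum.inl = a := fun a b => rfl
  simp only [this]
  rw [Finset.sum_comm]
  simp

theorem kraus_edges (o : R ⊕ (Y ⊕ Y) → Fin 2) (l : List ((ι ⊕ Y) × Y)) :
    MCommand.kraus o (l.map (edgeCmd e)) = Matrix.diagonal fun w : Bits (R ⊕ (Y ⊕ Y)) =>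
      (l.map fun q => sg (w (valQ e q.1)) (w (conQ q.2))).prod := by
  induction l with
  | nil => simp [MCommand.kraus]
  | cons q l ih =>
    rw [List.map_cons, MCommand.kraus, ih]
    simp only [edgeCmd, MCommand.act, cz, Matrix.diagonal_mul_diagonal, List.map_cons,
      List.prod_cons]
    congr 1
    funext w
    rw [mul_comm]; rfl

/-- The phases of the corrections on the data qubits are those of the outcomes. -/
theorem prod_corrections (s : Y → Fin 2) (x : ι → Fin 2) :
    ∏ i, sg (∑ a ∈ Finset.univ.filter (fun a => i ∈ N.F a), s a) (x i)
      = ∏ a, sg (s a) (∑ i ∈ N.F a, x i) := by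
  have h1 : ∀ i, sg (∑ a ∈ Finset.univ.filter (fun a => i ∈ N.F a), s a) (x i)
      = ∏ a, if i ∈ N.F a then sg (s a) (x i) else 1 := by
    intro i
    rw [sg_sum_left, Finset.prod_filter]
  have h2 : ∀ a, sg (s a) (∑ i ∈ N.F a, x i) = ∏ i, if i ∈ N.F a then sg (s a) (x i) else 1 := by
    intro a
    rw [sg_comm, sg_sum_left, ← Finset.prod_filter, Finset.filter_mem_eq_inter, Finset.univ_inter]
    exact Finset.prod_congr rfl fun i _ => sg_comm _ _
  simp only [h1, h2]
  exact Finset.prod_comm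

theorem prod_indicator (p : Y → Prop) [DecidablePred p] :
    ∏ a, (if p a then (1 : ℂ) else 0) = if ∀ a, p a then 1 else 0 := by
  rw [Finset.prod_boole]
  simp

/-- The amplitude of a branch of the pattern: the phases on the data times a factor that does not
depend on the data. -/
theorem kraus_cmds (o : R ⊕ (Y ⊕ Y) → Fin 2) (J : Matrix (Bits (R ⊕ (Y ⊕ Y))) (Bits R) ℂ)
    (hJ : J = inj Function.Embedding.inl ketPlus) (x x₀ : Bits R) (y b : Y → Fin 2) :
    (MCommand.kraus o (N.cmds e θ) * J) (Sum.elim x (Sum.elim y b)) x₀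
      = phase (N.total e θ) x x₀ * ((2⁻¹ : ℂ) ^ Fintype.card Y *
        ∏ a, (sg (o (conQ a)) (b a) * (2⁻¹ * (sg (o (varQ a)) (y a) * ang (-θ a) (y a))))) := by
  classical
  set ob : Y → Fin 2 := fun a => o (conQ a) with hob
  set oy : Y → Fin 2 := fun a => o (varQ a) with hoy
  set g : Y → Fin 2 := fun a => ∑ c ∈ N.G a, ob c with hg
  set p : Y → Fin 2 := fun a => ∑ i ∈ N.F a, x (e i) with hp
  set z : ι → Fin 2 := fun i => ∑ a ∈ Finset.univ.filter (fun a => i ∈ N.F a), oy a with hz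
  have hC := MCommand.kraus_layer (conQ (R := R)) (fun a => MCommand.M (conQ a) 0)
    (fun a => projAngle 0 (ob a)) o fun a => rfl
  have hX := MCommand.kraus_layer (varQ (R := R))
    (fun a => MCommand.X (varQ a) ((N.G a).map conQ)) (fun a => gateX ^ (g a : ℕ)) o
    fun a => by simp only [MCommand.act, Finset.sum_map]; rfl
  have hV := MCommand.kraus_layer (varQ (R := R)) (fun a => MCommand.M (varQ a) (-θ a))
    (fun a => projAngle (-θ a) (oy a)) o fun a => rfl
  have hZ := MCommand.kraus_layer (dataQ (Y := Y) e)
    (fun i => MCommand.Z (dataQ e i) ((Finset.univ.filter fun a => i ∈ N.F a).map varQ))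
    (fun i => gateZ ^ (z i : ℕ)) o
    fun a => by simp only [MCommand.act, Finset.sum_map]; rfl
  simp only [cmds, MCommand.kraus_append, hC, hX, hV, hZ, kraus_edges, Matrix.mul_assoc]
  -- the prepared register
  have s0 : ∀ (x : Bits R) (y b : Y → Fin 2), J (Sum.elim x (Sum.elim y b)) x₀
      = if x = x₀ then (2⁻¹ : ℂ) ^ Fintype.card Y else 0 := by
    intro x y b
    rw [hJ, inj_apply]
    refine if_congr Iff.rfl ?_ rfl
    rw [Fintype.prod_sum_type, Fintype.prod_sum_type]
    simp only [Function.Embedding.inl_apply, Set.mem_range, Sum.inl.injEq, exists_eq, if_true,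
      Finset.prod_const_one, one_mul, reduceCtorEq, exists_false, if_false, ketPlus_apply,
      Finset.prod_const, Finset.card_univ]
    rw [← mul_pow, sqrt_two_inv_mul_self]
  -- the edges
  generalize hE : (Matrix.diagonal fun w : Bits (R ⊕ (Y ⊕ Y)) =>
      (N.edges.map fun q => sg (w (valQ e q.1)) (w (conQ q.2))).prod) * J = J₁
  have s1 : ∀ (x : Bits R) (y b : Y → Fin 2), J₁ (Sum.elim x (Sum.elim y b)) x₀
      = (∏ a, sg (parityAt N.edges (Sum.elim (x ∘ e) y) a) (b a)) *
        if x = x₀ then (2⁻¹ : ℂ) ^ Fintype.card Y else 0 := by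
    intro x y b
    rw [← hE, Matrix.diagonal_mul, s0, ← prod_edges]
    congr 3
    funext q
    rcases q with ⟨i | a, c⟩ <;> rfl
  -- the measurements of the constraints select the solution of the network
  generalize hJ₂ : embed (conQ (R := R)) (multi fun a => projAngle 0 (ob a)) * J₁ = J₂
  have s2 : ∀ (y b : Y → Fin 2), J₂ (Sum.elim x (Sum.elim y b)) x₀
      = ((∏ a, sg (ob a) (b a)) * if x = x₀ then (2⁻¹ : ℂ) ^ Fintype.card Y else 0) *
        (if y = fun a => p a + g a then 1 else 0) := by
    intro y b
    have hsol := N.sol (x ∘ e) y ob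
    rw [← hJ₂, embed_mul_apply]
    simp only [extend_conQ, s1, multi, Matrix.of_apply]
    have h1 : ∀ c : Y → Fin 2, (∏ a, projAngle 0 (ob a)
        (((Sum.elim x (Sum.elim y b) : Bits (R ⊕ (Y ⊕ Y))) ∘ conQ) a) (c a)) *
        ((∏ a, sg (parityAt N.edges (Sum.elim (x ∘ e) y) a) (c a)) *
          if x = x₀ then (2⁻¹ : ℂ) ^ Fintype.card Y else 0)
        = (∏ a, projAngle 0 (ob a) (b a) (c a) *
            sg (parityAt N.edges (Sum.elim (x ∘ e) y) a) (c a)) *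
          if x = x₀ then (2⁻¹ : ℂ) ^ Fintype.card Y else 0 := by
      intro c
      rw [← mul_assoc, ← Finset.prod_mul_distrib]
      rfl
    simp only [h1, ← Finset.sum_mul]
    rw [sum_bits_prod fun a c => projAngle 0 (ob a) (b a) c *
            sg (parityAt N.edges (Sum.elim (x ∘ e) y) a) c]
    simp only [sum_projAngle_sg, Finset.prod_mul_distrib, prod_indicator, hsol]
    have h2 : (∀ a, y a = ∑ i ∈ N.F a, (x ∘ e) i + ∑ c ∈ N.G a, ob c) ↔
        y = fun a => p a + g a := by
      rw [funext_iff]; rfl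
    simp only [h2]
    ring
  -- the bit flips remove the dependence on the outcomes
  generalize hJ₃ : embed (varQ (R := R)) (multi fun a => gateX ^ (g a : ℕ)) * J₂ = J₃
  have s3 : ∀ (y b : Y → Fin 2), J₃ (Sum.elim x (Sum.elim y b)) x₀
      = ((∏ a, sg (ob a) (b a)) * if x = x₀ then (2⁻¹ : ℂ) ^ Fintype.card Y else 0) *
        (if y = p then 1 else 0) := by
    intro y b
    rw [← hJ₃, embed_mul_apply]
    simp only [extend_varQ, s2, multi, Matrix.of_apply, gateX_pow_apply, prod_indicator]
    have h1 : ∀ c : Y → Fin 2, (∀ a, c a = ((Sum.elim x (Sum.elim y b) :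
        Bits (R ⊕ (Y ⊕ Y))) ∘ varQ) a + g a) ↔ c = fun a => y a + g a := by
      intro c; rw [funext_iff]; rfl
    have h2 : ((fun a => y a + g a) = fun a => p a + g a) ↔ y = p := by
      simp only [funext_iff, add_left_inj]
    simp only [h1, ite_mul, one_mul, zero_mul, Finset.sum_ite_eq', Finset.mem_univ, if_true, h2]
  -- the measurements of the variables apply the phases
  generalize hJ₄ : embed (varQ (R := R)) (multi fun a => projAngle (-θ a) (oy a)) * J₃ = J₄
  have s4 : J₄ (Sum.elim x (Sum.elim y b)) x₀
      = (∏ a, projAngle (-θ a) (oy a) (y a) (p a)) *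
        ((∏ a, sg (ob a) (b a)) * if x = x₀ then (2⁻¹ : ℂ) ^ Fintype.card Y else 0) := by
    rw [← hJ₄, embed_mul_apply]
    simp only [extend_varQ, s3, multi, Matrix.of_apply, mul_ite, mul_one, mul_zero,
      Finset.sum_ite_eq', Finset.mem_univ, if_true]
    rfl
  -- the phase flips on the data
  have s5 : (multi fun i => gateZ ^ (z i : ℕ))
      = Matrix.diagonal fun w : Bits ι => ∏ i, sg (z i) (w i) := by
    ext w w'
    simp only [multi, Matrix.of_apply, gateZ_pow_apply, Matrix.diagonal_apply]
    by_cases hw : w = w'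
    · subst hw; simp
    · rw [if_neg hw]
      obtain ⟨i, hi⟩ := Function.ne_iff.1 hw
      exact Finset.prod_eq_zero (Finset.mem_univ i) (if_neg hi)
  rw [s5, embed_diagonal, Matrix.diagonal_mul, s4]
  have s6 : (∏ i, sg (z i) (((Sum.elim x (Sum.elim y b) : Bits (R ⊕ (Y ⊕ Y))) ∘ dataQ e) i))
      = ∏ a, sg (oy a) (p a) := N.prod_corrections oy (x ∘ e)
  rw [s6, phase, Matrix.diagonal_apply]
  by_cases hx : x = x₀
  · rw [if_pos hx, if_pos hx]
    have s7 : Complex.exp (N.total e θ x * Complex.I) = ∏ a, ang (θ a) (p a) := by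
      rw [total, Complex.ofReal_sum, Finset.sum_mul, Complex.exp_sum]
      refine Finset.prod_congr rfl fun a _ => ?_
      change Complex.exp (((θ a * ((p a : Fin 2) : ℕ) : ℝ) : ℂ) * Complex.I) = _
      generalize p a = q
      fin_cases q <;> simp [ang]
    have s8 : (∏ a, sg (oy a) (p a)) * ((∏ a, projAngle (-θ a) (oy a) (y a) (p a)) *
        ∏ a, sg (ob a) (b a)) = (∏ a, ang (θ a) (p a)) *
        ∏ a, (sg (ob a) (b a) * (2⁻¹ * (sg (oy a) (y a) * ang (-θ a) (y a)))) := by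
      simp only [← Finset.prod_mul_distrib]
      refine Finset.prod_congr rfl fun a _ => ?_
      rw [projAngle_apply, neg_neg]
      linear_combination sg (ob a) (b a) * 2⁻¹ * sg (oy a) (y a) * ang (-θ a) (y a) *
        ang (θ a) (p a) * sg_mul_self (oy a) (p a)
    rw [s7]
    linear_combination (2⁻¹ : ℂ) ^ Fintype.card Y * s8
  · rw [if_neg hx, if_neg hx]
    simp

/-- The pattern of a network of parity constraints applies phases to parities of data qubits. -/
theorem run_cmds (s : R ⊕ (Y ⊕ Y) → Fin 2) (ρ : Op R) :
    reduce .inl (MCommand.run (N.cmds e θ) s (prepare .inl ketPlus ρ))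
      = conj (phase (N.total e θ)) ρ := by
  classical
  obtain ⟨hwf, hm⟩ := N.wf_and_measured e θ
  have hbranch : ∀ o : R ⊕ (Y ⊕ Y) → Fin 2,
      reduce .inl (conj (MCommand.kraus o (N.cmds e θ)) (prepare .inl ketPlus ρ))
        = ((2⁻¹ : ℂ) ^ Fintype.card (Y ⊕ Y)) • conj (phase (N.total e θ)) ρ := by
    intro o
    let J : Matrix (Bits (R ⊕ (Y ⊕ Y))) (Bits R) ℂ := inj Function.Embedding.inl ketPlus
    let K : Matrix (Bits (R ⊕ (Y ⊕ Y))) (Bits R) ℂ := MCommand.kraus o (N.cmds e θ) * J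
    have h1 : conj (MCommand.kraus o (N.cmds e θ)) (prepare .inl ketPlus ρ) = K * ρ * Kᴴ := by
      simp only [prepare_eq, conj, K, J, Matrix.conjTranspose_mul, Matrix.mul_assoc]
    rw [h1]
    let η : Bits (R ⊕ (Y ⊕ Y)) → ℂ := fun w => (2⁻¹ : ℂ) ^ Fintype.card Y *
        ∏ a, (sg (o (conQ a)) (w (conQ a)) *
          (2⁻¹ * (sg (o (varQ a)) (w (varQ a)) * ang (-θ a) (w (varQ a)))))
    refine reduce_of_factor .inl K (phase (N.total e θ)) η _ ?_ ?_ ?_ ρ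
    · intro w x
      have hw : w = Sum.elim (w ∘ Sum.inl)
          (Sum.elim (fun a => w (varQ a)) (fun a => w (conQ a))) := by
        funext v
        rcases v with v | v | v <;> rfl
      conv_lhs => rw [hw]
      exact N.kraus_cmds e θ o J rfl _ _ _ _
    · intro y w
      have h2 : ∀ v : Y ⊕ Y, Function.extend (Function.Embedding.inl : R ↪ R ⊕ (Y ⊕ Y)) y w
          (.inr v) = w (.inr v) := fun v =>
        extend_apply_notMem _ _ _ (by simp)
      have h3 : ∀ a, Function.extend (Function.Embedding.inl : R ↪ R ⊕ (Y ⊕ Y)) y w (varQ a)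
          = w (varQ a) := fun a => h2 _
      have h4 : ∀ a, Function.extend (Function.Embedding.inl : R ↪ R ⊕ (Y ⊕ Y)) y w (conQ a)
          = w (conQ a) := fun a => h2 _
      simp only [η, h3, h4]
    · intro x
      have hη : ∀ w, η w * star (η w) = ((2⁻¹ : ℂ) ^ Fintype.card (Y ⊕ Y)) ^ 2 := by
        intro w
        have h5 : ∀ a : Y, (sg (o (conQ a)) (w (conQ a)) *
          (2⁻¹ * (sg (o (varQ a)) (w (varQ a)) * ang (-θ a) (w (varQ a))))) *
          star (sg (o (conQ a)) (w (conQ a)) *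
          (2⁻¹ * (sg (o (varQ a)) (w (varQ a)) * ang (-θ a) (w (varQ a))))) = 2⁻¹ * 2⁻¹ := by
          intro a
          have h6 : ang (-θ a) (w (varQ a)) * ang (- -θ a) (w (varQ a)) = 1 := by
            unfold ang
            split_ifs
            · rw [← Complex.exp_add]; simp
            · simp
          have h7 : star (2⁻¹ : ℂ) = 2⁻¹ := by simp
          simp only [star_mul', star_sg, star_ang, h7]
          linear_combination 2⁻¹ * 2⁻¹ * (sg (o (varQ a)) (w (varQ a)) *
            sg (o (varQ a)) (w (varQ a))) * (ang (-θ a) (w (varQ a)) * ang (- -θ a) (w (varQ a))) *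
            sg_mul_self (o (conQ a)) (w (conQ a)) + 2⁻¹ * 2⁻¹ * (ang (-θ a) (w (varQ a)) *
            ang (- -θ a) (w (varQ a))) * sg_mul_self (o (varQ a)) (w (varQ a)) + 2⁻¹ * 2⁻¹ * h6
        have h8 : star ((2⁻¹ : ℂ) ^ Fintype.card Y) = (2⁻¹ : ℂ) ^ Fintype.card Y := by simp
        simp only [η]
        rw [star_mul', star_prod, h8, mul_mul_mul_comm, ← Finset.prod_mul_distrib,
          Finset.prod_congr rfl fun a _ => h5 a, Finset.prod_const, Finset.card_univ,
          Fintype.card_sum, mul_pow]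
        ring
      simp only [hη]
      refine (sum_extend_inl x _).trans ?_
      rw [sq, ← mul_assoc, ← mul_pow]
      norm_num
  have hs : ∀ o : R ⊕ (Y ⊕ Y) → Fin 2,
      (∀ v, v ∉ MCommand.measured (N.cmds e θ) → o v = s v) ↔ o ∘ Sum.inl = s ∘ Sum.inl := by
    intro o
    rw [hm, funext_iff]
    constructor
    · intro h r
      exact h _ (by simp)
    · rintro h (v | v) hv
      · exact h v
      · exact absurd ⟨v, rfl⟩ hv
  rw [MCommand.run_eq_sum_kraus hwf, reduce_sum]
  have h9 : ∀ o : R ⊕ (Y ⊕ Y) → Fin 2, reduce .inl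
      (if ∀ v, v ∉ MCommand.measured (N.cmds e θ) → o v = s v
        then conj (MCommand.kraus o (N.cmds e θ)) (prepare .inl ketPlus ρ) else 0)
      = (if o ∘ Sum.inl = s ∘ Sum.inl then ((2⁻¹ : ℂ) ^ Fintype.card (Y ⊕ Y)) else 0) •
        conj (phase (N.total e θ)) ρ := by
    intro o
    by_cases ho : o ∘ Sum.inl = s ∘ Sum.inl
    · rw [if_pos ((hs o).2 ho), if_pos ho, hbranch]
    · rw [if_neg (mt (hs o).1 ho), if_neg ho, zero_smul]
      exact (reduceHom _).map_zero
  rw [Finset.sum_congr rfl fun o _ => h9 o, ← Finset.sum_smul]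
  have h10 := sum_extend_inl (A := Y ⊕ Y) (s ∘ Sum.inl : Bits R)
    ((2⁻¹ : ℂ) ^ Fintype.card (Y ⊕ Y))
  rw [h10, ← mul_pow]
  norm_num

end XorNet

/-! ### Diagonal unitaries -/

/-- The value before `u k` in the sequence `x₀, u 0, u 1, …`. -/
def shift {n : ℕ} (x₀ : Fin 2) (u : Fin n → Fin 2) (k : Fin n) : Fin 2 :=
  if (k : ℕ) = 0 then x₀ else u ⟨k - 1, by omega⟩

theorem shift_sum {n : ℕ} (x₀ : Fin 2) (s : Fin n → Fin 2) (k : Fin n) :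
    s k + shift x₀ (fun k => x₀ + ∑ l ∈ Finset.Iic k, s l) k = x₀ + ∑ l ∈ Finset.Iic k, s l := by
  unfold shift
  split_ifs with h
  · have : Finset.Iic k = {k} := by
      ext l; simp only [Finset.mem_Iic, Finset.mem_singleton, Fin.le_def, Fin.ext_iff]; omega
    rw [this, Finset.sum_singleton, add_comm]
  · have : Finset.Iic k = insert k (Finset.Iic ⟨k - 1, by omega⟩) := by
      ext l
      simp only [Finset.mem_Iic, Finset.mem_insert, Fin.le_def, Fin.ext_iff]; omega
    rw [this, Finset.sum_insert (by simp only [Finset.mem_Iic, Fin.le_def]; omega)]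
    exact add_left_comm _ _ _

/-- A chain of binary equations, each involving two neighbours, is solved by partial sums. -/
theorem shift_add_eq_iff {n : ℕ} (x₀ : Fin 2) (u s : Fin n → Fin 2) :
    (∀ k, u k + shift x₀ u k = s k) ↔ ∀ k, u k = x₀ + ∑ l ∈ Finset.Iic k, s l := by
  have hneg : ∀ a b c : Fin 2, a + b = c ↔ a = c + b := by decide
  constructor
  · intro h
    have key : ∀ m (hm : m < n), u ⟨m, hm⟩ = x₀ + ∑ l ∈ Finset.Iic ⟨m, hm⟩, s l := by
      intro m
      induction m with
      | zero =>
        intro hm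
        rw [← shift_sum, (hneg _ _ _).1 (h ⟨0, hm⟩)]
        simp [shift]
      | succ m ih =>
        intro hm
        rw [← shift_sum, (hneg _ _ _).1 (h ⟨m + 1, hm⟩)]
        simp only [shift, Nat.succ_ne_zero, if_false, Nat.add_sub_cancel]
        rw [ih]
    exact fun k => key k k.2
  · intro h k
    obtain rfl : u = fun k => x₀ + ∑ l ∈ Finset.Iic k, s l := funext h
    rw [hneg, shift_sum]

theorem parityAt_append {κ Y : Type} [DecidableEq Y] (A B : List (κ × Y)) (z : κ → Fin 2) (a : Y) :
    parityAt (A ++ B) z a = parityAt A z a + parityAt B z a := by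
  simp [parityAt]

/-- In a matching, the constraint `g t` is met by the edge of `t` only. -/
theorem parityAt_layer {κ Y τ : Type} [DecidableEq Y] (s : Finset τ) (f : τ → κ) (g : τ → Y)
    (z : κ → Fin 2) (a : Y) :
    parityAt (s.toList.map fun t => (f t, g t)) z a = ∑ t ∈ s, if g t = a then z (f t) else 0 := by
  rw [parityAt, List.map_map, ← Finset.sum_map_toList]
  rfl

theorem chainDepth_matching {κ Y τ : Type} (s : Finset τ) (f : τ → κ) (g : τ → Y)
    (hf : Set.InjOn f s) (hg : Set.InjOn g s) :
    chainDepth (fun q q' : κ × Y => q.1 = q'.1 ∨ q.2 = q'.2)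
      (s.toList.map fun t => (f t, g t)) ≤ 1 := by
  refine chainDepth_le_one ?_
  rw [List.pairwise_map]
  have h : s.toList.Pairwise (· ≠ ·) := s.nodup_toList
  refine (List.pairwise_iff_forall_sublist.2 fun {a b} hab hd => ?_)
  have ha : a ∈ s := Finset.mem_toList.1 (hab.subset (by simp))
  have hb : b ∈ s := Finset.mem_toList.1 (hab.subset (by simp))
  have hne : a ≠ b := (List.pairwise_iff_forall_sublist.1 h) hab
  rcases hd with hd | hd
  · exact hne (hf ha hb hd)
  · exact hne (hg ha hb hd)

section Grid

variable {n M : ℕ} (T : Fin M → Finset (Fin n))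

/-- The data qubit or variable that precedes the copy `(i, k)` of the data qubit `i`. -/
def prevCopy (t : Fin n × Fin M) : Fin n ⊕ ((Fin n × Fin M) ⊕ (Fin n × Fin M)) :=
  if (t.2 : ℕ) = 0 then .inl t.1 else .inr (.inl (t.1, ⟨t.2 - 1, by omega⟩))

/-- The partial parity that precedes the partial parity `(i, k)`; it is used for `i ≠ 0` only. -/
def prevParity (t : Fin n × Fin M) : Fin n ⊕ ((Fin n × Fin M) ⊕ (Fin n × Fin M)) :=
  .inr (.inr (⟨t.1 - 1, by omega⟩, t.2))

theorem prevCopy_injective : Function.Injective (prevCopy (n := n) (M := M)) := by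
  rintro ⟨i, k⟩ ⟨i', k'⟩ h
  unfold prevCopy at h
  split_ifs at h with h1 h2 h2 <;>
    simp only [Sum.inl.injEq, Sum.inr.injEq, Prod.mk.injEq, Fin.ext_iff] at h ⊢ <;>
    simp only at h1 h2 <;> omega

/-- The edges joining every variable of the grid to its own constraint. -/
def selfEdges (n M : ℕ) :
    List ((Fin n ⊕ ((Fin n × Fin M) ⊕ (Fin n × Fin M))) × ((Fin n × Fin M) ⊕ (Fin n × Fin M))) :=
  Finset.univ.toList.map fun a => (.inr a, a)

/-- The edges joining every copy to the preceding one. -/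
def copyEdges (n M : ℕ) :
    List ((Fin n ⊕ ((Fin n × Fin M) ⊕ (Fin n × Fin M))) × ((Fin n × Fin M) ⊕ (Fin n × Fin M))) :=
  Finset.univ.toList.map fun t => (prevCopy t, .inl t)

/-- The edges joining the partial parities to the copies that contribute to them. -/
def addEdges :
    List ((Fin n ⊕ ((Fin n × Fin M) ⊕ (Fin n × Fin M))) × ((Fin n × Fin M) ⊕ (Fin n × Fin M))) :=
  (Finset.univ.filter fun t : Fin n × Fin M => t.1 ∈ T t.2).toList.map
    fun t => (.inr (.inl t), .inr t)

/-- The edges joining every partial parity to the preceding one. -/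
def carryEdges (n M : ℕ) :
    List ((Fin n ⊕ ((Fin n × Fin M) ⊕ (Fin n × Fin M))) × ((Fin n × Fin M) ⊕ (Fin n × Fin M))) :=
  (Finset.univ.filter fun t : Fin n × Fin M => (t.1 : ℕ) ≠ 0).toList.map
    fun t => (prevParity t, .inr t)

variable (x : Fin n → Fin 2) (y : (Fin n × Fin M) ⊕ (Fin n × Fin M) → Fin 2)

theorem elim_prevCopy (i : Fin n) (k : Fin M) :
    Sum.elim x y (prevCopy (i, k)) = shift (x i) (fun k => y (.inl (i, k))) k := by
  unfold prevCopy shift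
  split_ifs <;> rfl

theorem parityAt_grid_inl (i : Fin n) (k : Fin M) :
    parityAt (selfEdges n M ++ (copyEdges n M ++ (addEdges T ++ carryEdges n M))) (Sum.elim x y)
      (.inl (i, k)) = y (.inl (i, k)) + shift (x i) (fun k => y (.inl (i, k))) k := by
  simp only [parityAt_append, selfEdges, copyEdges, addEdges, carryEdges, parityAt_layer,
    Finset.sum_ite_eq', Finset.mem_univ, if_true, Sum.inl.injEq, reduceCtorEq, if_false,
    Finset.sum_const_zero, add_zero, elim_prevCopy, Sum.elim_inr]

theorem parityAt_grid_inr (i : Fin n) (k : Fin M) :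
    parityAt (selfEdges n M ++ (copyEdges n M ++ (addEdges T ++ carryEdges n M))) (Sum.elim x y)
      (.inr (i, k)) = y (.inr (i, k)) + shift 0 (fun i => y (.inr (i, k))) i +
        if i ∈ T k then y (.inl (i, k)) else 0 := by
  simp only [parityAt_append, selfEdges, copyEdges, addEdges, carryEdges, parityAt_layer,
    Finset.sum_ite_eq', Finset.mem_univ, if_true, Sum.inr.injEq, reduceCtorEq, if_false,
    Finset.sum_const_zero, zero_add, Sum.elim_inr, Finset.mem_filter, true_and, prevParity, shift]
  rw [add_assoc]
  congr 1
  rw [add_comm, ite_not]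

/-- A grid of parity constraints, in which row `i` carries copies of the data qubit `i` and column
`k` accumulates the parity of the data qubits in `T k`. Its depth is bounded because every
constraint involves only neighbours in the grid. -/
def grid : XorNet (Fin n) ((Fin n × Fin M) ⊕ (Fin n × Fin M)) where
  edges := selfEdges n M ++ (copyEdges n M ++ (addEdges T ++ carryEdges n M))
  F := Sum.elim (fun t => {t.1}) fun t => Finset.Iic t.1 ∩ T t.2
  G := Sum.elim (fun t => ({t.1} ×ˢ Finset.Iic t.2).disjSum ∅)
    fun t => ((Finset.Iic t.1 ∩ T t.2) ×ˢ Finset.Iic t.2).disjSum (Finset.Iic t.1 ×ˢ {t.2})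
  sol x y s := by
    have hneg : ∀ a b c : Fin 2, a + b = c ↔ a = c + b := by decide
    simp only [Sum.forall, Prod.forall, parityAt_grid_inl, parityAt_grid_inr, Sum.elim_inl,
      Sum.elim_inr, Finset.sum_disjSum, Finset.sum_product, Finset.sum_singleton,
      Finset.sum_empty, add_zero]
    have h1 : (∀ i k, y (.inl (i, k)) + shift (x i) (fun k => y (.inl (i, k))) k = s (.inl (i, k)))
        ↔ ∀ i k, y (.inl (i, k)) = x i + ∑ l ∈ Finset.Iic k, s (.inl (i, l)) :=
      forall_congr' fun i => shift_add_eq_iff (x i) (fun k => y (.inl (i, k))) _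
    rw [h1]
    refine and_congr_right fun h2 => ?_
    rw [forall_comm, forall_comm (β := Fin M)]
    refine forall_congr' fun k => ?_
    simp only [hneg _ (ite _ _ _) _]
    rw [shift_add_eq_iff]
    refine forall_congr' fun i => ?_
    rw [zero_add, Finset.sum_add_distrib, add_comm (∑ l ∈ _, s _), ← Finset.sum_filter,
      Finset.filter_mem_eq_inter, ← add_assoc, ← Finset.sum_add_distrib]
    simp only [h2]
  depth_le := by
    refine (chainDepth_append_le_of_le (chainDepth_matching _ _ _
        (Sum.inr_injective.injOn) (Function.injective_id.injOn))
      (chainDepth_append_le_of_le (chainDepth_matching _ _ _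
        (prevCopy_injective.injOn) (Sum.inl_injective.injOn))
      (chainDepth_append_le_of_le (chainDepth_matching _ _ _
        ((Sum.inr_injective.comp Sum.inl_injective).injOn) (Sum.inr_injective.injOn))
      (chainDepth_matching _ _ _ ?_ (Sum.inr_injective.injOn))))).trans ?_
    · rintro ⟨i, k⟩ hi ⟨i', k'⟩ hi' h
      simp only [Finset.coe_filter, Finset.mem_univ, true_and, Set.mem_ofPred_eq] at hi hi'
      simp only [prevParity, Sum.inr.injEq, Prod.mk.injEq, Fin.ext_iff] at h ⊢
      omega
    · norm_num

end Grid

/-- The sign of a bit, as a real number. -/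
def sgn (a : Fin 2) : ℝ := 1 - 2 * ((a : ℕ) : ℝ)

theorem sgn_add (a b : Fin 2) : sgn (a + b) = sgn a * sgn b := by
  fin_cases a <;> fin_cases b <;> norm_num [sgn]

theorem sgn_sum {ι : Type*} (s : Finset ι) (f : ι → Fin 2) :
    sgn (∑ i ∈ s, f i) = ∏ i ∈ s, sgn (f i) := by
  classical
  induction s using Finset.induction_on with
  | empty => simp [sgn]
  | insert a s ha ih => rw [Finset.sum_insert ha, Finset.prod_insert ha, sgn_add, ih]

theorem one_add_sgn_mul (a b : Fin 2) : 1 + sgn a * sgn b = if b = a then 2 else 0 := by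
  fin_cases a <;> fin_cases b <;> norm_num [sgn]

/-- Fourier expansion of a function of bits, written in terms of parities. -/
theorem exists_parity_expansion {ι : Type} [Fintype ι] [DecidableEq ι] (f : Bits ι → ℝ) :
    ∃ (c : ℝ) (θ : Finset ι → ℝ), ∀ x, f x = c + ∑ T, θ T * ((∑ i ∈ T, x i : Fin 2) : ℕ) := by
  have h1 : ∀ x y : Bits ι, ∑ T : Finset ι, sgn (∑ i ∈ T, x i) * sgn (∑ i ∈ T, y i)
      = if y = x then 2 ^ Fintype.card ι else 0 := by
    intro x y
    simp only [sgn_sum, ← Finset.prod_mul_distrib]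
    rw [← Finset.powerset_univ, ← Finset.prod_one_add]
    simp only [one_add_sgn_mul]
    split_ifs with h
    · subst h; simp
    · obtain ⟨i, hi⟩ := Function.ne_iff.1 h
      exact Finset.prod_eq_zero (Finset.mem_univ i) (if_neg hi)
  let F : Finset ι → ℝ := fun T => ((2 : ℝ) ^ Fintype.card ι)⁻¹ * ∑ y, f y * sgn (∑ i ∈ T, y i)
  -- the characters `sgn` of the parities are an orthogonal basis, and `sgn a = 1 - 2 a`
  refine ⟨∑ T, F T, fun T => -2 * F T, fun x => ?_⟩
  have h2 : ∑ T, F T * sgn (∑ i ∈ T, x i) = f x := by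
    simp only [F, mul_assoc, Finset.sum_mul]
    rw [← Finset.mul_sum, Finset.sum_comm]
    have : ∀ y, ∑ T : Finset ι, f y * (sgn (∑ i ∈ T, y i) * sgn (∑ i ∈ T, x i))
        = if y = x then f y * 2 ^ Fintype.card ι else 0 := by
      intro y
      rw [← Finset.mul_sum, h1, mul_ite, mul_zero]
      exact if_congr eq_comm rfl rfl
    simp only [this, Finset.sum_ite_eq', Finset.mem_univ, if_true]
    rw [mul_comm, mul_assoc, mul_inv_cancel₀ (by positivity), mul_one]
  rw [← h2, ← Finset.sum_add_distrib]
  refine Finset.sum_congr rfl fun T _ => ?_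
  rw [sgn]
  ring

/-- A global phase is immaterial. -/
theorem conj_phase_add_const {R : Type} [Fintype R] [DecidableEq R] (c : ℝ) (θ : Bits R → ℝ) :
    conj (phase fun x => c + θ x) = conj (phase θ) := by
  funext ρ
  ext x y
  simp only [conj, phase, Matrix.diagonal_conjTranspose, Matrix.diagonal_mul,
    Matrix.mul_diagonal, Pi.star_apply, Complex.ofReal_add, add_mul, Complex.exp_add, star_mul']
  have : Complex.exp (c * Complex.I) * star (Complex.exp (c * Complex.I)) = 1 := by
    rw [Complex.star_def, Complex.mul_conj, Complex.normSq_eq_norm_sq,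
      Complex.norm_exp_ofReal_mul_I]
    norm_num
  linear_combination Complex.exp (θ x * Complex.I) * ρ x y *
    star (Complex.exp (θ y * Complex.I)) * this

/-- A network of parity constraints on the qubits of `S` as a gadget. -/
def netGadget {R : Type} [Fintype R] [DecidableEq R] (S : Set R) {ι Y : Type} [Fintype ι]
    [DecidableEq ι] [Fintype Y] [DecidableEq Y] (N : XorNet ι Y) (e : ι ↪ R) (he : ∀ i, e i ∈ S)
    (o : Y → ι) (θ : Y → ℝ) : Gadget R S (conj (phase (N.total e θ))) where
  A := Y ⊕ Y
  fintypeA := inferInstance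
  decEqA := inferInstance
  cmds := N.cmds e θ
  out := .inl
  own := Sum.elim (fun a => e (o a)) fun a => e (o a)
  wf := (N.wf_and_measured e θ).1
  out_notMem r := by rw [(N.wf_and_measured e θ).2]; simp
  own_out r := rfl
  touch p hp x hx := by
    have hv : ∀ z, Sum.elim id (Sum.elim (fun a => e (o a)) fun a => e (o a))
        (XorNet.valQ e z) ∈ S := by
      rintro (i | a)
      exacts [he i, he _]
    have hy : ∀ a, Sum.elim id (Sum.elim (fun a => e (o a)) fun a => e (o a))
        (XorNet.varQ (R := R) a) ∈ S := fun a => he _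
    have hc : ∀ a, Sum.elim id (Sum.elim (fun a => e (o a)) fun a => e (o a))
        (XorNet.conQ (R := R) a) ∈ S := fun a => he _
    simp only [XorNet.cmds, List.mem_append, List.mem_map] at hp
    rcases hp with ⟨q, -, rfl⟩ | ⟨a, -, rfl⟩ | ⟨a, -, rfl⟩ | ⟨a, -, rfl⟩ | ⟨i, -, rfl⟩
    · rcases hx with (rfl | rfl) | hx
      exacts [hv _, hc _, hx.elim]
    · rcases hx with rfl | hx
      exacts [hc _, hx.elim]
    · rcases hx with rfl | hx
      · exact hy _
      · obtain ⟨b, -, rfl⟩ := Finset.mem_map.1 (Finset.mem_coe.1 hx)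
        exact hc _
    · rcases hx with rfl | hx
      exacts [hy _, hx.elim]
    · rcases hx with rfl | hx
      · exact he _
      · obtain ⟨b, -, rfl⟩ := Finset.mem_map.1 (Finset.mem_coe.1 hx)
        exact hy _
  depth_le := N.chainDepth_cmds e θ
  run_eq s ρ := N.run_cmds e θ s ρ

/-- A diagonal unitary with phases depending on the qubits `e i` is performed by the grid of all
their parities, with the Fourier coefficients as angles at the ends of the columns. -/
theorem exists_diag_gadget {R : Type} [Fintype R] [DecidableEq R] (S : Finset R)
    (θ : Bits R → ℝ) (hθ : ∀ x y, (∀ v ∈ S, x v = y v) → θ x = θ y) :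
    Nonempty (Gadget R (S : Set R) (conj (phase θ))) := by
  let n := S.card
  let e : Fin n ↪ R := S.equivFin.symm.toEmbedding.trans (Function.Embedding.subtype _)
  have he : ∀ i, e i ∈ S := fun i => (S.equivFin.symm i).2
  have he' : ∀ v ∈ S, ∃ i, e i = v := fun v hv => ⟨S.equivFin ⟨v, hv⟩, by simp [e]⟩
  obtain ⟨f, hf⟩ : ∃ f : Bits (Fin n) → ℝ, ∀ x, θ x = f (x ∘ e) :=
    ⟨fun z => θ (Function.extend e z 0), fun x => hθ _ _ fun v hv => by
      obtain ⟨i, rfl⟩ := he' v hv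
      rw [e.injective.extend_apply]; rfl⟩
  obtain ⟨c, κ, hκ⟩ := exists_parity_expansion f
  let M := Fintype.card (Finset (Fin n))
  let T : Fin M → Finset (Fin n) := (Fintype.equivFin (Finset (Fin n))).symm
  let N := grid T
  -- the last entry of column `k` is the parity of all of `T k`
  let η : (Fin n × Fin M) ⊕ (Fin n × Fin M) → ℝ :=
    Sum.elim (fun _ => 0) fun t => if (t.1 : ℕ) + 1 = n then κ (T t.2) else 0
  have key : ∃ c' : ℝ, ∀ x, θ x = c' + N.total e η x := by
    rcases Nat.eq_zero_or_pos n with hn | hn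
    · refine ⟨θ 0, fun x => ?_⟩
      have : IsEmpty (Fin n) := by rw [hn]; infer_instance
      rw [XorNet.total, Finset.sum_of_isEmpty, add_zero]
      refine hθ _ _ fun v hv => ?_
      obtain ⟨i, -⟩ := he' v hv
      exact this.elim i
    · refine ⟨c, fun x => ?_⟩
      rw [hf, hκ, XorNet.total, Fintype.sum_sum_type]
      congr 1
      have hl : ∀ i : Fin n, (i : ℕ) + 1 = n ↔ i = ⟨n - 1, by omega⟩ := by
        intro i; rw [Fin.ext_iff]; simp only; omega
      have hI : Finset.Iic (⟨n - 1, by omega⟩ : Fin n) = Finset.univ := by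
        exact Finset.eq_univ_iff_forall.2 fun i => Finset.mem_Iic.2 (Nat.le_sub_one_of_lt i.2)
      simp only [η, Sum.elim_inl, Sum.elim_inr, zero_mul, Finset.sum_const_zero, zero_add,
        Fintype.sum_prod_type, ite_mul, hl]
      rw [Finset.sum_comm]
      simp only [Finset.sum_ite_eq', Finset.mem_univ, if_true, N, grid, Sum.elim_inr, hI,
        Finset.univ_inter]
      exact (Equiv.sum_comp (Fintype.equivFin (Finset (Fin n))).symm
        fun U => κ U * ((∑ i ∈ U, (x ∘ e) i : Fin 2) : ℕ)).symm
  obtain ⟨c', hc'⟩ := key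
  have : conj (phase θ) = conj (phase (N.total e η)) := by
    rw [← conj_phase_add_const c' (N.total e η), ← funext hc']
  rw [this]
  exact ⟨netGadget _ N e he (Sum.elim Prod.fst Prod.fst) η⟩

/-- Every well-formed program is simulated by a measurement pattern. -/
theorem exists_sim {R : Type} [Fintype R] [DecidableEq R] (Q : List (Instr R))
    (hQ : Instr.WF ∅ Q) : Nonempty (Sim Q) := by
  induction Q using List.reverseRecOn with
  | nil => exact ⟨Sim.nil⟩
  | append_singleton Q g ih =>
    rw [Instr.wf_append, Set.empty_union] at hQ
    obtain ⟨h1, hd, hr, -⟩ := hQ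
    obtain ⟨T⟩ := ih h1
    cases g with
    | init S => exact ⟨T.extendGadget _ _ (initGadget S) rfl fun _ _ _ => rfl⟩
    | had i => exact ⟨T.extendGadget _ _ (hadGadget i) rfl fun _ _ _ => rfl⟩
    | diag S θ hθ =>
      obtain ⟨G⟩ := exists_diag_gadget S θ hθ
      exact ⟨T.extendGadget _ _ G rfl fun _ _ _ => rfl⟩
    | meas i k => exact ⟨T.extendMeas i k (Set.disjoint_singleton_left.1 hd)⟩
    | flip i σ => exact ⟨T.extendFlip i σ hr⟩

/-! ### Programs for circuits with fan-out -/

theorem gateH_apply (a b : Fin 2) : gateH a b = (Real.sqrt 2 : ℂ)⁻¹ * sg a b := by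
  fin_cases a <;> fin_cases b <;> simp [gateH, sg]

section HasProgram

variable {R : Type} [Fintype R] [DecidableEq R]

/-- The operator `A` is performed by a program without measurements and corrections, of depth at
most `c`, on the qubits of `S`. -/
def HasProgram (S : Set R) (c : ℕ) (A : Op R) : Prop :=
  ∃ Q : List (Instr R),
    (∀ g ∈ Q, g.qubits ⊆ S ∧ g.writes = ∅ ∧ g.reads = ∅) ∧ chainDepth Instr.Dep Q ≤ c ∧
    ∀ {β : Type} [AddCommMonoid β] (s : ℕ → Fin 2) (ρ : Op R) (κ : (ℕ → Fin 2) → Op R → β),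
      Instr.runK Q s ρ κ = κ s (conj A ρ)

theorem HasProgram.mono {S S' : Set R} {c c' : ℕ} {A : Op R} (h : HasProgram S c A) (hS : S ⊆ S')
    (hc : c ≤ c') : HasProgram S' c' A := by
  obtain ⟨Q, h1, h2, h3⟩ := h
  exact ⟨Q, fun g hg => ⟨(h1 g hg).1.trans hS, (h1 g hg).2⟩, h2.trans hc, h3⟩

theorem HasProgram.mul {S : Set R} {c c' : ℕ} {A B : Op R} (hB : HasProgram S c' B)
    (hA : HasProgram S c A) : HasProgram S (c + c') (B * A) := by
  obtain ⟨Q, h1, h2, h3⟩ := hA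
  obtain ⟨Q', h1', h2', h3'⟩ := hB
  refine ⟨Q ++ Q', fun g hg => (List.mem_append.1 hg).elim (h1 g) (h1' g),
    chainDepth_append_le_of_le h2 h2', fun s ρ κ => ?_⟩
  rw [Instr.runK_append, h3, h3', conj_conj]

theorem not_dep_of_writes {g h : Instr R} (hg : g.writes = ∅)
    (hq : Disjoint g.qubits h.qubits) : ¬ Instr.Dep g h := by
  rintro (hd | hd)
  · exact (Set.not_disjoint_iff_nonempty_inter.2 hd) hq
  · rw [hg, Set.empty_inter] at hd
    exact Set.not_nonempty_empty hd

/-- Hadamard gates on the qubits `t k`. -/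
def hadLayer {κ : Type} [Fintype κ] (t : κ ↪ R) : List (Instr R) :=
  Finset.univ.toList.map fun k => Instr.had (t k)

variable {κ : Type} [Fintype κ] [DecidableEq κ] (t : κ ↪ R)

theorem runK_hadLayer {β : Type} [AddCommMonoid β] (s : ℕ → Fin 2) (ρ : Op R)
    (f : (ℕ → Fin 2) → Op R → β) :
    Instr.runK (hadLayer t) s ρ f = f s (conj (embed t (multi fun _ => gateH)) ρ) := by
  have key : ∀ l : List κ, l.Nodup → ∀ ρ, Instr.runK (l.map fun k => Instr.had (t k)) s ρ f
      = f s (conj (embed t (multi fun a => if a ∈ l then gateH else 1)) ρ) := by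
    intro l hl
    induction l with
    | nil => intro ρ; simp [Instr.runK, multi_one, embed_one, conj_one]
    | cons a l ih =>
      intro ρ
      rw [List.nodup_cons] at hl
      rw [List.map_cons, Instr.runK, ih hl.2, conj_conj, ← embed_single, embed_mul,
        single_eq_multi, multi_mul]
      congr 4
      funext b
      by_cases hb : b = a
      · subst hb
        simp [hl.1]
      · simp [hb]
  rw [hadLayer, key _ (Finset.nodup_toList _)]
  simp

theorem chainDepth_hadLayer : chainDepth Instr.Dep (hadLayer t) ≤ 1 := by
  refine chainDepth_le_one ?_
  rw [hadLayer, List.pairwise_map]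
  have h : (Finset.univ : Finset κ).toList.Pairwise (· ≠ ·) := Finset.nodup_toList _
  exact h.imp fun {a b} hab => not_dep_of_writes rfl
    (Set.disjoint_singleton.2 fun h => hab (t.injective h))

theorem qubits_hadLayer {g : Instr R} (hg : g ∈ hadLayer t) :
    g.qubits ⊆ Set.range t ∧ g.writes = ∅ ∧ g.reads = ∅ := by
  obtain ⟨k, -, rfl⟩ := List.mem_map.1 hg
  exact ⟨Set.singleton_subset_iff.2 ⟨k, rfl⟩, rfl, rfl⟩

theorem hasProgram_hadLayer : HasProgram (Set.range t) 1 (embed t (multi fun _ => gateH)) :=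
  ⟨hadLayer t, fun _ hg => qubits_hadLayer t hg, chainDepth_hadLayer t,
    fun s ρ f => runK_hadLayer t s ρ f⟩

theorem hasProgram_phase (S : Finset R) (θ : Bits R → ℝ)
    (hθ : ∀ x y, (∀ v ∈ S, x v = y v) → θ x = θ y) : HasProgram (S : Set R) 1 (phase θ) :=
  ⟨[Instr.diag S θ hθ], by simp [Instr.qubits, Instr.writes, Instr.reads],
    (chainDepth_le_length _).trans (by simp), fun s ρ f => rfl⟩

/-- The operator that permutes the basis, `π` being the inverse of the permutation. -/
def pullOp (π : Bits R → Bits R) : Op R :=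
  Matrix.of fun x y => if y = π x then 1 else 0

theorem pullOp_mul_apply {X : Type*} (π : Bits R → Bits R) (N : Matrix (Bits R) X ℂ) (x : Bits R)
    (y : X) : (pullOp π * N) x y = N (π x) y := by
  simp [pullOp, Matrix.mul_apply]

theorem pullOp_mul (π σ : Bits R → Bits R) : pullOp π * pullOp σ = pullOp (σ ∘ π) := by
  ext x y
  rw [pullOp_mul_apply]
  rfl

/-- The bits `f x k` are added modulo 2 to the qubits `t k`. -/
def addBits (t : κ ↪ R) (f : Bits R → κ → Fin 2) (x : Bits R) : Bits R :=
  Function.extend t (fun k => x (t k) + f x k) x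

theorem phase_eq_sg (f : Bits R → κ → Fin 2) (x : Bits R) :
    Complex.exp (((∑ k, if x (t k) = 1 ∧ f x k = 1 then Real.pi else 0 : ℝ) : ℂ) * Complex.I)
      = ∏ k, sg (x (t k)) (f x k) := by
  rw [Complex.ofReal_sum, Finset.sum_mul, Complex.exp_sum]
  refine Finset.prod_congr rfl fun k _ => ?_
  unfold sg
  split_ifs <;> simp [Complex.exp_pi_mul_I]

theorem sum_gateH_sg_gateH (a b f : Fin 2) :
    ∑ c, gateH a c * sg c f * gateH c b = if b = a + f then 1 else 0 := by
  simp only [gateH_apply]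
  have h : ∀ c, (Real.sqrt 2 : ℂ)⁻¹ * sg a c * sg c f * ((Real.sqrt 2 : ℂ)⁻¹ * sg c b)
      = 2⁻¹ * (sg a c * sg c f * sg c b) := fun c => by
    rw [← sqrt_two_inv_mul_self]; ring
  simp only [h, Fin.sum_univ_two]
  fin_cases a <;> fin_cases b <;> fin_cases f <;> (norm_num [sg]; try decide)

/-- Adding bits modulo 2 is a diagonal unitary in the basis `|±⟩`. -/
theorem hadamard_phase_hadamard (f : Bits R → κ → Fin 2)
    (hf : ∀ a x, f (Function.extend t a x) = f x) :
    embed t (multi fun _ => gateH) *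
      (phase (fun x => ∑ k, if x (t k) = 1 ∧ f x k = 1 then Real.pi else 0) *
        embed t (multi fun _ => gateH)) = pullOp (addBits t f) := by
  classical
  ext x y
  rw [embed_mul_apply]
  simp only [phase, Matrix.diagonal_mul, phase_eq_sg t, embed_apply, extend_comp_self, hf,
    multi, Matrix.of_apply, extend_apply_range, pullOp]
  have h1 : ∀ a : Bits κ, (∀ v, v ∉ Set.range t → Function.extend t a x v = y v) ↔
      ∀ v, v ∉ Set.range t → x v = y v := fun a =>
    forall₂_congr fun v hv => by rw [extend_apply_notMem t _ _ hv]
  have h2 : y = addBits t f x ↔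
      (∀ v, v ∉ Set.range t → x v = y v) ∧ ∀ k, y (t k) = x (t k) + f x k := by
    rw [agree_iff]
    constructor
    · intro h
      have h3 : ∀ k, y (t k) = x (t k) + f x k := fun k => by
        rw [h]; exact extend_apply_range _ _ _ _
      refine ⟨?_, h3⟩
      conv_lhs => rw [h]
      exact congrArg₂ _ (funext fun k => (h3 k).symm) rfl
    · rintro ⟨h, h3⟩
      rw [h, addBits]
      exact congrArg₂ _ (funext h3) rfl
  simp only [h1, h2, ite_and]
  split_ifs with h h3
  · simp only [← Finset.prod_mul_distrib, Function.comp_apply]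
    have h4 := sum_bits_prod fun (k : κ) (c : Fin 2) =>
      gateH (x (t k)) c * (sg c (f x k) * gateH c (y (t k)))
    rw [h4]
    refine Finset.prod_eq_one fun k _ => ?_
    simp only [← mul_assoc]
    rw [sum_gateH_sg_gateH, if_pos (h3 k)]
  · simp only [← Finset.prod_mul_distrib, Function.comp_apply]
    have h4 := sum_bits_prod fun (k : κ) (c : Fin 2) =>
      gateH (x (t k)) c * (sg c (f x k) * gateH c (y (t k)))
    rw [h4]
    push Not at h3
    obtain ⟨k, hk⟩ := h3
    refine Finset.prod_eq_zero (Finset.mem_univ k) ?_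
    simp only [← mul_assoc]
    rw [sum_gateH_sg_gateH, if_neg hk]
  · simp

/-- Two layers of Hadamard gates around one diagonal unitary add any functions of the other
qubits. -/
theorem hasProgram_addBits (S : Finset R) (f : Bits R → κ → Fin 2) (ht : ∀ k, t k ∈ S)
    (hf : ∀ a x, f (Function.extend t a x) = f x)
    (hS : ∀ x y, (∀ v ∈ S, x v = y v) → f x = f y) :
    HasProgram (S : Set R) 3 (pullOp (addBits t f)) := by
  rw [← hadamard_phase_hadamard t f hf]
  have h : HasProgram (S : Set R) 1 (embed t (multi fun _ => gateH)) :=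
    (hasProgram_hadLayer t).mono (by rintro _ ⟨k, rfl⟩; exact ht k) le_rfl
  refine (h.mul ((hasProgram_phase S _ ?_).mul h))
  intro x y hxy
  simp only [hS x y hxy, hxy _ (ht _)]

theorem extend_comp_of_disjoint {κ' : Type} {a : κ ↪ R} {b : κ' ↪ R}
    (hab : Disjoint (Set.range a) (Set.range b)) (u : Bits κ) (x : Bits R) :
    Function.extend a u x ∘ b = x ∘ b :=
  funext fun k => extend_apply_notMem a u x fun h =>
    Set.disjoint_left.1 hab h ⟨k, rfl⟩

/-- The contents of the qubits `a k` and `b k` are exchanged. -/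
def swapBits (a b : κ ↪ R) (x : Bits R) : Bits R :=
  Function.extend a (x ∘ b) (Function.extend b (x ∘ a) x)

/-- Three additions modulo 2 exchange two sets of qubits. -/
theorem hasProgram_swapBits (S : Finset R) (a b : κ ↪ R) (ha : ∀ k, a k ∈ S) (hb : ∀ k, b k ∈ S)
    (hab : Disjoint (Set.range a) (Set.range b)) :
    HasProgram (S : Set R) 9 (pullOp (swapBits a b)) := by
  have h1 : HasProgram (S : Set R) 3 (pullOp (addBits a fun x => x ∘ b)) :=
    hasProgram_addBits a S _ ha (fun u x => extend_comp_of_disjoint hab u x)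
      fun x y h => funext fun k => h _ (hb k)
  have h2 : HasProgram (S : Set R) 3 (pullOp (addBits b fun x => x ∘ a)) :=
    hasProgram_addBits b S _ hb (fun u x => extend_comp_of_disjoint hab.symm u x)
      fun x y h => funext fun k => h _ (ha k)
  have h3 : swapBits a b = addBits a (fun x => x ∘ b) ∘ (addBits b (fun x => x ∘ a) ∘
      addBits a fun x => x ∘ b) := by
    funext x
    have hfin : ∀ p q : Fin 2, q + (p + q) = p ∧ p + q + p = q := by decide
    have ea : ∀ y : Bits R, addBits a (fun x => x ∘ b) y ∘ a = fun k => y (a k) + y (b k) :=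
      fun y => extend_comp_self _ _ _
    have ea' : ∀ y : Bits R, addBits a (fun x => x ∘ b) y ∘ b = y ∘ b :=
      fun y => extend_comp_of_disjoint hab _ _
    have eb : ∀ y : Bits R, addBits b (fun x => x ∘ a) y ∘ b = fun k => y (b k) + y (a k) :=
      fun y => extend_comp_self _ _ _
    have eb' : ∀ y : Bits R, addBits b (fun x => x ∘ a) y ∘ a = y ∘ a :=
      fun y => extend_comp_of_disjoint hab.symm _ _
    have ea1 := fun y k => congrFun (ea y) k
    have ea1' := fun y k => congrFun (ea' y) k
    have eb1 := fun y k => congrFun (eb y) k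
    have eb1' := fun y k => congrFun (eb' y) k
    simp only [Function.comp_apply] at ea1 ea1' eb1 eb1'
    funext v
    simp only [Function.comp_apply]
    by_cases hv : v ∈ Set.range a
    · obtain ⟨k, rfl⟩ := hv
      rw [ea1, eb1', ea1, eb1, ea1, ea1', (hfin _ _).1]
      exact extend_apply_range _ _ _ _
    · by_cases hv' : v ∈ Set.range b
      · obtain ⟨k, rfl⟩ := hv'
        rw [ea1', eb1, ea1, ea1', (hfin _ _).1]
        rw [swapBits, extend_apply_notMem _ _ _ hv, extend_apply_range]
        rfl
      · rw [addBits, extend_apply_notMem _ _ _ hv, addBits, extend_apply_notMem _ _ _ hv', addBits,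
          extend_apply_notMem _ _ _ hv, swapBits, extend_apply_notMem _ _ _ hv,
          extend_apply_notMem _ _ _ hv']
  rw [h3, ← Function.comp_assoc, ← pullOp_mul, ← pullOp_mul]
  exact h1.mul (h2.mul h1)

end HasProgram

/-! ### Programs for gates -/

namespace Gate

variable {W : Type} [Fintype W] [DecidableEq W]

theorem toOp_Rz (i : W) (α : ℝ) :
    (Rz i α).toOp = phase fun x => if x i = 1 then α else 0 := by
  ext x y
  simp only [toOp, single, Matrix.of_apply, phase, Matrix.diagonal_apply]
  by_cases h : x = y
  · subst h
    rcases (show x i = 0 ∨ x i = 1 by omega) with h | h <;> simp [gateRz, h]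
  · rw [if_neg h]
    split_ifs with h'
    · have hi : x i ≠ y i := fun hi => h (funext fun v => by
        by_cases hv : v = i
        · rw [hv, hi]
        · exact h' v hv)
      rcases (show x i = 0 ∨ x i = 1 by omega) with h1 | h1 <;>
        rcases (show y i = 0 ∨ y i = 1 by omega) with h2 | h2 <;> simp_all [gateRz]
    · rfl

theorem toOp_CZ (i j : W) (hij : i ≠ j) :
    (CZ i j hij).toOp = phase fun x => if x i = 1 ∧ x j = 1 then Real.pi else 0 := by
  simp only [toOp, cz, phase]
  congr 1
  funext x
  split_ifs <;> simp [Complex.exp_pi_mul_I]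

theorem embed_phase {R : Type} [Fintype R] [DecidableEq R] (j : W ↪ R) (θ : Bits W → ℝ) :
    embed j (phase θ) = phase fun x => θ (x ∘ j) :=
  embed_diagonal j _

/-- A fan-out gate adds the control to the targets. -/
theorem embed_fan {R : Type} [Fintype R] [DecidableEq R] (j : W ↪ R) (c : W) (T : Finset W)
    (hc : c ∉ T) : embed j (fan c T) = pullOp (addBits
      ((Function.Embedding.subtype fun v => v ∈ T).trans j) fun x _ => x (j c)) := by
  classical
  have hadd : ∀ a b d : Fin 2, a = b + d ↔ b = a + d := by decide
  ext x y
  set t : {v // v ∈ T} ↪ R := (Function.Embedding.subtype fun v => v ∈ T).trans j with ht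
  have htj : ∀ k, t k = j k := fun k => rfl
  have hadd' : ∀ r, addBits t (fun x _ => x (j c)) x r
      = if r ∈ T.map j then x r + x (j c) else x r := by
    intro r
    by_cases hr : r ∈ T.map j
    · rw [if_pos hr]
      obtain ⟨w, hw, rfl⟩ := Finset.mem_map.1 hr
      exact extend_apply_range t _ _ ⟨w, hw⟩
    · rw [if_neg hr]
      refine extend_apply_notMem t _ _ ?_
      rintro ⟨k, rfl⟩
      exact hr (Finset.mem_map_of_mem j k.2)
  have key : ((∀ v, v ∉ Set.range j → x v = y v) ∧
      x ∘ j = fun w => if w ∈ T then (y ∘ j) w + (y ∘ j) c else (y ∘ j) w) ↔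
      y = addBits t (fun x _ => x (j c)) x := by
    simp only [funext_iff, hadd', Function.comp_apply]
    constructor
    · rintro ⟨h1, h2⟩ r
      have hcc := h2 c
      rw [if_neg hc] at hcc
      by_cases hr : r ∈ Set.range j
      · obtain ⟨w, rfl⟩ := hr
        have h3 := h2 w
        by_cases hw : w ∈ T
        · rw [if_pos (Finset.mem_map_of_mem j hw), hcc, ← hadd, h3, if_pos hw]
        · rw [if_neg (by simpa using hw), h3, if_neg hw]
      · rw [if_neg fun h => hr ?_, h1 r hr]
        obtain ⟨w, -, rfl⟩ := Finset.mem_map.1 h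
        exact ⟨w, rfl⟩
    · intro h
      have hcc := h (j c)
      rw [if_neg (by simpa using hc)] at hcc
      refine ⟨fun r hr => ?_, fun w => ?_⟩
      · rw [h r, if_neg fun h => hr ?_]
        obtain ⟨w, -, rfl⟩ := Finset.mem_map.1 h
        exact ⟨w, rfl⟩
      · have h3 := h (j w)
        by_cases hw : w ∈ T
        · rw [if_pos (Finset.mem_map_of_mem j hw)] at h3
          rw [if_pos hw, hadd, h3, hcc]
        · rw [if_neg (by simpa using hw)] at h3
          rw [if_neg hw, h3]
  rw [embed_apply, pullOp, Matrix.of_apply, fan, Matrix.of_apply, ← ite_and]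
  exact if_congr key rfl rfl

theorem hasProgram {R : Type} [Fintype R] [DecidableEq R] (j : W ↪ R) (g : Gate W) :
    HasProgram (j '' g.qubits) 3 (embed j g.toOp) := by
  cases g with
  | H i =>
    have h : embed j (H i).toOp = single (j i) gateH := embed_single j i _
    rw [h]
    exact ⟨[Instr.had (j i)], by simp [Instr.qubits, Instr.writes, Instr.reads, qubits],
      (chainDepth_le_length _).trans (by simp), fun s ρ κ => rfl⟩
  | Rz i α =>
    rw [toOp_Rz, embed_phase]
    have h := hasProgram_phase (R := R) {j i} (fun x => if (x ∘ j) i = 1 then α else 0)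
      fun x y h => by rw [Function.comp_apply, Function.comp_apply, h _ (by simp)]
    exact h.mono (by simp [qubits]) (by norm_num)
  | CZ i i' hij =>
    rw [toOp_CZ, embed_phase]
    have h := hasProgram_phase (R := R) {j i, j i'}
      (fun x => if (x ∘ j) i = 1 ∧ (x ∘ j) i' = 1 then Real.pi else 0)
      fun x y h => by simp only [Function.comp_apply, h (j i) (by simp), h (j i') (by simp)]
    exact h.mono (by simp [qubits, Set.image_insert_eq]) (by norm_num)
  | fanout c T hc =>
    have h : embed j (fanout c T hc).toOp = _ := embed_fan j c T hc
    rw [h]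
    refine (hasProgram_addBits _ (insert (j c) (T.map j)) _ ?_ ?_ ?_).mono ?_ le_rfl
    · intro k
      exact Finset.mem_insert_of_mem (Finset.mem_map_of_mem j k.2)
    · intro a x
      funext k
      refine extend_apply_notMem _ _ _ ?_
      rintro ⟨k', hk'⟩
      exact hc (j.injective hk' ▸ k'.2)
    · intro x y h
      funext k
      exact h _ (Finset.mem_insert_self _ _)
    · simp [qubits, Set.image_insert_eq]

end Gate

/-! ### Circuits and their inverses -/

theorem phase_conjTranspose {R : Type} [Fintype R] [DecidableEq R] (θ : Bits R → ℝ) :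
    (phase θ)ᴴ = phase fun x => -θ x := by
  rw [phase, phase, Matrix.diagonal_conjTranspose]
  congr 1
  funext x
  rw [Pi.star_apply, Complex.star_def, ← Complex.exp_conj]
  simp

theorem phase_conjTranspose_mul {R : Type} [Fintype R] [DecidableEq R] (θ : Bits R → ℝ) :
    (phase θ)ᴴ * phase θ = 1 := by
  rw [phase_conjTranspose, phase, phase, Matrix.diagonal_mul_diagonal, ← Matrix.diagonal_one]
  congr 1
  funext x
  rw [← Complex.exp_add]
  simp

theorem gateH_conjTranspose : gateHᴴ = gateH := by
  ext a b
  rw [Matrix.conjTranspose_apply, gateH_apply, gateH_apply, star_mul', star_sg, sg_comm]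
  simp

namespace Gate

variable {W : Type}

/-- The inverse gate. -/
def inv : Gate W → Gate W
  | H i => H i
  | Rz i α => Rz i (-α)
  | CZ i j hij => CZ i j hij
  | fanout c T hc => fanout c T hc

theorem qubits_inv (g : Gate W) : g.inv.qubits = g.qubits := by
  cases g <;> rfl

variable [Fintype W] [DecidableEq W]

theorem fan_hermitian (c : W) (T : Finset W) (hc : c ∉ T) :
    (fan c T)ᴴ = fan c T ∧ fan c T * fan c T = 1 := by
  have hfin : ∀ a b : Fin 2, a + b + b = a := by decide
  have hinv : ∀ y : Bits W, (fun v => if v ∈ T then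
      (fun v => if v ∈ T then y v + y c else y v) v + (fun v => if v ∈ T then y v + y c else y v) c
      else (fun v => if v ∈ T then y v + y c else y v) v) = y := by
    intro y
    funext v
    by_cases hv : v ∈ T
    · simp only [hv, hc, if_true, if_false, hfin]
    · simp only [hv, if_false]
  constructor
  · ext x y
    simp only [fan, Matrix.conjTranspose_apply, Matrix.of_apply, apply_ite star, star_one,
      star_zero]
    refine if_congr ⟨?_, ?_⟩ rfl rfl
    · rintro rfl; exact (hinv x).symm
    · rintro rfl; exact (hinv y).symm
  · ext x y
    simp only [fan, Matrix.mul_apply, Matrix.of_apply, mul_ite, mul_one, mul_zero,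
      Finset.sum_ite_eq', Finset.mem_univ, if_true, Matrix.one_apply]
    refine if_congr ?_ rfl rfl
    rw [hinv]

theorem toOp_inv (g : Gate W) : g.inv.toOp = g.toOpᴴ := by
  cases g with
  | H i => exact (congrArg _ gateH_conjTranspose.symm).trans (single_conjTranspose i gateH).symm
  | Rz i α =>
    rw [inv, toOp_Rz, toOp_Rz, phase_conjTranspose]
    congr 1
    funext x
    split_ifs <;> simp
  | CZ i j hij =>
    rw [inv, toOp, cz, Matrix.diagonal_conjTranspose]
    congr 1
    funext x
    rw [Pi.star_apply]
    split_ifs <;> simp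
  | fanout c T hc => exact (fan_hermitian c T hc).1.symm

theorem toOp_conjTranspose_mul (g : Gate W) : g.toOpᴴ * g.toOp = 1 := by
  cases g with
  | H i =>
    rw [toOp, single_conjTranspose, single_mul, gateH_conjTranspose]
    have h := gateH_mul
    rw [gateH_conjTranspose] at h
    rw [h, single_one]
  | Rz i α => rw [toOp_Rz, phase_conjTranspose_mul]
  | CZ i j hij => rw [toOp_CZ, phase_conjTranspose_mul]
  | fanout c T hc => rw [toOp, (fan_hermitian c T hc).1, (fan_hermitian c T hc).2]

/-- The operator of a sequence of gates. -/
def circuitOp : List (Gate W) → Op W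
  | [] => 1
  | g :: l => circuitOp l * g.toOp

theorem foldl_conj (l : List (Gate W)) (τ : Op W) :
    l.foldl (fun τ g => conj g.toOp τ) τ = conj (circuitOp l) τ := by
  induction l generalizing τ with
  | nil => exact (conj_one τ).symm
  | cons g l ih => rw [List.foldl_cons, ih, conj_conj]; rfl

theorem circuitOp_append (l l' : List (Gate W)) :
    circuitOp (l ++ l') = circuitOp l' * circuitOp l := by
  induction l with
  | nil => exact (mul_one _).symm
  | cons g l ih => rw [List.cons_append, circuitOp, ih, circuitOp, Matrix.mul_assoc]

theorem circuitOp_inv (l : List (Gate W)) :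
    circuitOp (l.map inv).reverse = (circuitOp l)ᴴ := by
  induction l with
  | nil => exact (Matrix.conjTranspose_one).symm
  | cons g l ih =>
    rw [List.map_cons, List.reverse_cons, circuitOp_append, ih, circuitOp, circuitOp,
      one_mul, toOp_inv, ← Matrix.conjTranspose_mul, ← circuitOp]

theorem circuitOp_conjTranspose_mul (l : List (Gate W)) :
    (circuitOp l)ᴴ * circuitOp l = 1 := by
  induction l with
  | nil => simp [circuitOp]
  | cons g l ih =>
    rw [circuitOp, Matrix.conjTranspose_mul, Matrix.mul_assoc, ← Matrix.mul_assoc (circuitOp l)ᴴ,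
      ih, one_mul, toOp_conjTranspose_mul]

theorem chainDepth_inv (l : List (Gate W)) :
    chainDepth Dep (l.map inv).reverse ≤ chainDepth Dep l := by
  refine (chainDepth_reverse_le (fun a b h => ?_) _).trans
    (chainDepth_map_le _ _ fun a b h => ?_)
  · rwa [Dep, Set.inter_comm]
  · rwa [Dep, qubits_inv, qubits_inv] at h

/-- A circuit on a subregister, as a program: every gate takes three instructions. -/
theorem hasProgram_circuitOp {R : Type} [Fintype R] [DecidableEq R] (j : W ↪ R)
    (l : List (Gate W)) :
    HasProgram (Set.range j) (3 * chainDepth Dep l) (embed j (circuitOp l)) := by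
  choose Q h1 h2 h3 using fun g : Gate W => hasProgram j g
  have hL : (l.map fun g => (g, Q g)).flatMap Prod.snd = l.flatMap Q := by
    rw [List.flatMap_map]
  have hL' : (l.map fun g => (g, Q g)).map Prod.fst = l := by
    rw [List.map_map]; exact List.map_id l
  refine ⟨l.flatMap Q, ?_, ?_, ?_⟩
  · intro q hq
    obtain ⟨g, -, hq⟩ := List.mem_flatMap.1 hq
    exact ⟨(h1 g q hq).1.trans (Set.image_subset_range _ _), (h1 g q hq).2⟩
  · have h := chainDepth_flatMap_le (dep := Dep) (dep' := Instr.Dep) (c := 3)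
      (l.map fun g => (g, Q g)) ?_ ?_
    · rwa [hL, hL'] at h
    · intro b hb
      obtain ⟨g, -, rfl⟩ := List.mem_map.1 hb
      exact h2 g
    · rw [List.pairwise_map]
      refine List.pairwise_of_forall fun {g g'} p hp q hq hd => ?_
      rcases hd with ⟨x, hx, hx'⟩ | ⟨x, hx, -⟩
      · obtain ⟨w, hw, rfl⟩ := (h1 g p hp).1 hx
        obtain ⟨w', hw', h⟩ := (h1 g' q hq).1 hx'
        exact ⟨w, hw, j.injective h ▸ hw'⟩
      · rw [(h1 g p hp).2.1] at hx
        exact hx.elim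
  · intro β _ s ρ κ
    clear hL hL'
    induction l generalizing ρ with
    | nil => rw [circuitOp, embed_one, conj_one]; rfl
    | cons g l ih =>
      rw [List.flatMap_cons, Instr.runK_append, h3, ih, conj_conj, embed_mul]
      rfl

end Gate

/-! ### Circuits that realise a unitary -/

section Factor

variable {W : Type} {n : ℕ} [Fintype W] [DecidableEq W]

theorem sum_fiber_extend {V : Type} [Fintype V] [DecidableEq V] (out : V ↪ W) (x y : Bits V)
    (f : Bits W → ℂ) :
    (∑ u : Bits W, if u ∘ out = x then f (Function.extend out y u) else 0)
      = ∑ u : Bits W, if u ∘ out = y then f u else 0 := by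
  rw [← Finset.sum_filter, ← Finset.sum_filter]
  refine Finset.sum_nbij' (fun u => Function.extend out y u) (fun u => Function.extend out x u)
    ?_ ?_ ?_ ?_ fun _ _ => rfl
  · intro u _
    simp [extend_comp_self]
  · intro u _
    simp [extend_comp_self]
  · intro u hu
    simp only [Finset.mem_filter, Finset.mem_univ, true_and] at hu
    rw [extend_extend, ← hu, extend_self]
  · intro u hu
    simp only [Finset.mem_filter, Finset.mem_univ, true_and] at hu
    rw [extend_extend, ← hu, extend_self]

/-- If discarding qubits turns `ρ ↦ L ρ L†` into the identity, then `L` is `1 ⊗ g` for a unit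
vector `g`: the environment learns nothing about the state. -/
theorem exists_factor_of_reduce_eq {V : Type} [Fintype V] [DecidableEq V] (out : V ↪ W)
    (L : Matrix (Bits W) (Bits V) ℂ) (h : ∀ ρ : Op V, reduce out (L * ρ * Lᴴ) = ρ) :
    ∃ g : Bits W → ℂ, (∀ w b, L w b = if w ∘ out = b then g w else 0) ∧
      (∀ y w, g (Function.extend out y w) = g w) ∧
      ∀ x, (∑ u : Bits W, if u ∘ out = x then g u * star (g u) else 0) = 1 := by
  classical
  -- the hypothesis, for matrix units `ρ`
  have h1 : ∀ x y b b' : Bits V, (∑ u : Bits W, if u ∘ out = x then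
      L u b * star (L (Function.extend out y u) b') else 0) = if x = b ∧ y = b' then 1 else 0 := by
    intro x y b b'
    have h2 := congrFun (congrFun (h (Matrix.single b b' 1)) x) y
    rw [reduce_apply, Matrix.single_apply] at h2
    simp only [eq_comm (a := x) (b := b), eq_comm (a := y) (b := b')]
    rw [← h2]
    refine Finset.sum_congr rfl fun u _ => ?_
    congr 1
    rw [Matrix.mul_apply]
    simp [Matrix.mul_apply, Matrix.single_apply, ite_and, Matrix.conjTranspose_apply]
  have hpos : ∀ (f : Bits W → ℂ) (p : Bits W → Prop) [DecidablePred p],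
      (∑ u : Bits W, if p u then f u * star (f u) else 0) = 0 → ∀ u, p u → f u = 0 := by
    intro f p _ hf u hu
    have h3 : (∑ u : Bits W, if p u then ‖f u‖ ^ 2 else 0) = 0 := by
      have h4 : ∀ u, (if p u then f u * star (f u) else 0)
          = (((if p u then ‖f u‖ ^ 2 else 0 : ℝ)) : ℂ) := by
        intro u
        split_ifs
        · rw [Complex.star_def, Complex.mul_conj, Complex.normSq_eq_norm_sq]
        · simp
      simp only [h4] at hf
      exact_mod_cast hf
    have h5 := (Finset.sum_eq_zero_iff_of_nonneg fun u _ => by split_ifs <;> positivity).1 h3 u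
      (Finset.mem_univ u)
    rw [if_pos hu] at h5
    simpa using h5
  -- from `ρ = |b⟩⟨b|`: the output is `b` with certainty
  have hL : ∀ w b, w ∘ out ≠ b → L w b = 0 := by
    intro w b hwb
    refine hpos (fun u => L u b) (fun u => u ∘ out = w ∘ out) ?_ w rfl
    have h6 := h1 (w ∘ out) (w ∘ out) b b
    rw [if_neg fun h => hwb h.1] at h6
    refine Eq.trans (Finset.sum_congr rfl fun u _ => ?_) h6
    split_ifs with hu
    · rw [← hu, extend_self]
    · rfl
  let g : Bits W → ℂ := fun u => L u (u ∘ out)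
  have h7 : ∀ x y : Bits V, (∑ u : Bits W, if u ∘ out = x then
      g u * star (g (Function.extend out y u)) else 0) = 1 := by
    intro x y
    have h8 := h1 x y x y
    rw [if_pos ⟨rfl, rfl⟩] at h8
    rw [← h8]
    refine Finset.sum_congr rfl fun u _ => ?_
    split_ifs with hu
    · simp only [g, extend_comp_self, hu]
    · rfl
  have h9 : ∀ x, (∑ u : Bits W, if u ∘ out = x then g u * star (g u) else 0) = 1 := by
    intro x
    rw [← h7 x x]
    refine Finset.sum_congr rfl fun u _ => ?_
    split_ifs with hu
    · rw [← hu, extend_self]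
    · rfl
  refine ⟨g, fun w b => ?_, fun y w => ?_, h9⟩
  · split_ifs with hwb
    · rw [← hwb]
    · exact hL w b hwb
  -- the vectors left on the discarded qubits by any two inputs have norm 1 and overlap 1
  · have h10 := hpos (fun u => g (Function.extend out y u) - g u) (fun u => u ∘ out = w ∘ out) ?_
      w rfl
    · exact sub_eq_zero.1 h10
    · have e1 := sum_fiber_extend out (w ∘ out) y fun u => g u * star (g u)
      have e2 := h9 y
      have e3 := h9 (w ∘ out)
      have e4 := h7 (w ∘ out) y
      have e5 := congrArg star e4
      rw [star_sum, star_one] at e5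
      have e6 : ∀ u : Bits W, (if u ∘ out = w ∘ out then
          (g (Function.extend out y u) - g u) * star (g (Function.extend out y u) - g u) else 0)
          = (if u ∘ out = w ∘ out then
              g (Function.extend out y u) * star (g (Function.extend out y u)) else 0)
            - star (if u ∘ out = w ∘ out then g u * star (g (Function.extend out y u)) else 0)
            - (if u ∘ out = w ∘ out then g u * star (g (Function.extend out y u)) else 0)
            + (if u ∘ out = w ∘ out then g u * star (g u) else 0) := by
        intro u
        split_ifs
        · simp only [star_sub, star_mul', star_star]; ring
        · simp
      simp only [e6, Finset.sum_add_distrib, Finset.sum_sub_distrib, e1, e2, e3, e4, e5]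
      norm_num

end Factor

/-! ### Implementations with ancillas -/

/-- The meaning of a step on the register `V`: the sum, over the branches of the step, of the value
of a continuation at the record and the unnormalised state after the step. Continuations describe
everything that happens later, including the use of the outcomes recorded during the step. -/
abbrev Sem (V : Type) : Type 1 :=
  ∀ {β : Type} [AddCommMonoid β], (ℕ → Fin 2) → Op V → ((ℕ → Fin 2) → Op V → β) → β

section Implementations

variable {V : Type} [Fintype V] [DecidableEq V]

/-- The step `F` on the register `V` is implemented by a program of depth at most `c` which uses
ancillas of its own, acts on the qubits of `S` only, produces the outcomes `wr` and uses only those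
in `rd`. -/
def HasImpl (S : Set V) (wr rd : Set ℕ) (c : ℕ) (F : Sem V) : Prop :=
  ∃ (A : Type) (_ : Fintype A) (_ : DecidableEq A) (Q : List (Instr (V ⊕ A))),
    (∀ g ∈ Q, ∀ v, Sum.inl v ∈ g.qubits → v ∈ S) ∧ (∀ g ∈ Q, g.reads ⊆ rd) ∧
    Instr.names Q = wr ∧ (∀ m, rd ⊆ m → Disjoint wr m → Instr.WF m Q) ∧
    chainDepth Instr.Dep Q ≤ c ∧
    ∀ {β : Type} [AddCommMonoid β] (s : ℕ → Fin 2) (ρ : Op (V ⊕ A))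
      (κ : (ℕ → Fin 2) → Op V → β),
      Instr.runK Q s ρ (fun s' ρ' => κ s' (reduce .inl ρ')) = F s (reduce .inl ρ) κ

theorem Instr.writes_subset_names {R : Type} {Q : List (Instr R)} {g : Instr R} (hg : g ∈ Q) :
    g.writes ⊆ Instr.names Q := fun _ hk => ⟨g, hg, hk⟩

theorem chainDepth_instr_map {R R' : Type} (j : R ↪ R') (Q : List (Instr R)) :
    chainDepth Instr.Dep (Q.map (Instr.map j)) ≤ chainDepth Instr.Dep Q :=
  chainDepth_map_le _ _ fun g h hd => Instr.dep_map j g h hd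

theorem inl_mem_qubits_map {A B : Type} (f : A ↪ B) {g : Instr (V ⊕ A)} {v : V}
    (h : Sum.inl v ∈ (g.map ((Function.Embedding.refl V).sumMap f)).qubits) :
    Sum.inl v ∈ g.qubits := by
  rw [Instr.qubits_map] at h
  obtain ⟨v' | a, h, hv⟩ := h
  · obtain rfl : v' = v := Sum.inl_injective hv
    exact h
  · exact absurd hv (by simp)

/-- A program on the register and some ancillas may be run with more ancillas. -/
theorem runK_map_sumMap {A B β : Type} [Fintype A] [DecidableEq A] [Fintype B] [DecidableEq B]
    [AddCommMonoid β] (f : A ↪ B) {Q : List (Instr (V ⊕ A))} {F : Sem V}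
    (h : ∀ {β : Type} [AddCommMonoid β] (s : ℕ → Fin 2) (ρ : Op (V ⊕ A))
      (κ : (ℕ → Fin 2) → Op V → β),
      Instr.runK Q s ρ (fun s' ρ' => κ s' (reduce .inl ρ')) = F s (reduce .inl ρ) κ)
    (s : ℕ → Fin 2) (ρ : Op (V ⊕ B)) (κ : (ℕ → Fin 2) → Op V → β) :
    Instr.runK (Q.map (Instr.map ((Function.Embedding.refl V).sumMap f))) s ρ
      (fun s' ρ' => κ s' (reduce .inl ρ')) = F s (reduce .inl ρ) κ := by
  have h1 : ∀ ρ' : Op (V ⊕ B), reduce .inl ρ'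
      = reduce .inl (reduce ((Function.Embedding.refl V).sumMap f) ρ') := by
    intro ρ'
    rw [← reduce_trans]
    rfl
  simp only [h1]
  rw [← h]
  exact Instr.runK_map_reduce ((Function.Embedding.refl V).sumMap f) Q s ρ
    fun s' ρ' => κ s' (reduce .inl ρ')

theorem HasImpl.mono {S S' : Set V} {wr rd rd' : Set ℕ} {c c' : ℕ} {F : Sem V}
    (h : HasImpl S wr rd c F) (hS : S ⊆ S') (hr : rd ⊆ rd') (hc : c ≤ c') :
    HasImpl S' wr rd' c' F := by
  obtain ⟨A, _, _, Q, h1, h2, h3, h4, h5, h6⟩ := h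
  exact ⟨A, inferInstance, inferInstance, Q, fun g hg v hv => hS (h1 g hg v hv),
    fun g hg => (h2 g hg).trans hr, h3, fun m hm hd => h4 m (hr.trans hm) hd, h5.trans hc, h6⟩

/-- Two steps in succession; each has its own ancillas. -/
theorem HasImpl.comp {S : Set V} {wr wr' rd rd' : Set ℕ} {c c' : ℕ} {F F' : Sem V}
    (h : HasImpl S wr rd c F) (h' : HasImpl S wr' rd' c' F') (hw : Disjoint wr wr') :
    HasImpl S (wr ∪ wr') (rd ∪ rd') (c + c')
      (fun s ρ κ => F s ρ fun s' ρ' => F' s' ρ' κ) := by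
  obtain ⟨A, _, _, Q, h1, h2, h3, h4, h5, h6⟩ := h
  obtain ⟨A', _, _, Q', h1', h2', h3', h4', h5', h6'⟩ := h'
  refine ⟨A ⊕ A', inferInstance, inferInstance,
    Q.map (Instr.map ((Function.Embedding.refl V).sumMap .inl)) ++
      Q'.map (Instr.map ((Function.Embedding.refl V).sumMap .inr)), ?_, ?_, ?_, ?_, ?_, ?_⟩
  · intro g hg v hv
    rcases List.mem_append.1 hg with hg | hg <;> obtain ⟨g, hg', rfl⟩ := List.mem_map.1 hg
    · exact h1 g hg' v (inl_mem_qubits_map _ hv)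
    · exact h1' g hg' v (inl_mem_qubits_map _ hv)
  · intro g hg
    rcases List.mem_append.1 hg with hg | hg <;> obtain ⟨g, hg', rfl⟩ := List.mem_map.1 hg <;>
      rw [Instr.reads_map]
    · exact (h2 g hg').trans Set.subset_union_left
    · exact (h2' g hg').trans Set.subset_union_right
  · rw [Instr.names_append, Instr.names_map, Instr.names_map, h3, h3']
  · intro m hm hd
    rw [Instr.wf_append, Instr.names_map, h3]
    rw [Set.disjoint_union_left] at hd
    exact ⟨(h4 m (Set.subset_union_left.trans hm) hd.1).map _,
      (h4' _ ((Set.subset_union_right.trans hm).trans Set.subset_union_left)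
        (Set.disjoint_union_right.2 ⟨hd.2, hw.symm⟩)).map _⟩
  · exact chainDepth_append_le_of_le ((chainDepth_instr_map _ _).trans h5)
      ((chainDepth_instr_map _ _).trans h5')
  · intro β _ s ρ κ
    rw [Instr.runK_append]
    simp only [runK_map_sumMap _ (F := F') h6']
    exact runK_map_sumMap _ (F := F) h6 s ρ fun s' ρ' => F' s' ρ' κ

/-- A step on a larger register, seen on the register `V`. -/
theorem HasImpl.hide {B : Type} [Fintype B] [DecidableEq B] {S : Set (V ⊕ B)} {S' : Set V}
    {wr rd : Set ℕ} {c : ℕ} {F : Sem (V ⊕ B)} {F' : Sem V} (h : HasImpl S wr rd c F)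
    (hS : ∀ v, Sum.inl v ∈ S → v ∈ S')
    (hF : ∀ {β : Type} [AddCommMonoid β] (s : ℕ → Fin 2) (ρ : Op (V ⊕ B))
      (κ : (ℕ → Fin 2) → Op V → β),
      F s ρ (fun s' ρ' => κ s' (reduce .inl ρ')) = F' s (reduce .inl ρ) κ) :
    HasImpl S' wr rd c F' := by
  obtain ⟨A, _, _, Q, h1, h2, h3, h4, h5, h6⟩ := h
  let j : (V ⊕ B) ⊕ A ↪ V ⊕ (B ⊕ A) := (Equiv.sumAssoc V B A).toEmbedding
  refine ⟨B ⊕ A, inferInstance, inferInstance, Q.map (Instr.map j), ?_, ?_, ?_, ?_, ?_, ?_⟩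
  · intro g hg v hv
    obtain ⟨g, hg', rfl⟩ := List.mem_map.1 hg
    rw [Instr.qubits_map] at hv
    obtain ⟨(v' | b) | a, hv', hj⟩ := hv
    · obtain rfl : v' = v := Sum.inl_injective hj
      exact hS _ (h1 g hg' _ hv')
    · exact absurd hj (by simp [j])
    · exact absurd hj (by simp [j])
  · intro g hg
    obtain ⟨g, hg', rfl⟩ := List.mem_map.1 hg
    rw [Instr.reads_map]
    exact h2 g hg'
  · rw [Instr.names_map, h3]
  · exact fun m hm hd => (h4 m hm hd).map _
  · exact (chainDepth_instr_map _ _).trans h5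
  · intro β _ s ρ κ
    have h7 : ∀ ρ' : Op (V ⊕ (B ⊕ A)), reduce .inl ρ'
        = reduce .inl (reduce .inl (reduce j ρ')) := by
      intro ρ'
      rw [← reduce_trans, ← reduce_trans]
      rfl
    simp only [h7]
    exact (Instr.runK_map_reduce j Q s ρ fun s' ρ' =>
      κ s' (reduce .inl (reduce .inl ρ'))).trans ((h6 _ _ _).trans (hF _ _ _))

theorem Instr.wf_of_silent {R : Type} {Q : List (Instr R)}
    (h : ∀ g ∈ Q, g.writes = ∅ ∧ g.reads = ∅) (m : Set ℕ) : Instr.WF m Q := by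
  induction Q generalizing m with
  | nil => trivial
  | cons g Q ih =>
    obtain ⟨h1, h2⟩ := h g List.mem_cons_self
    refine ⟨?_, ?_, ih (fun g hg => h g (List.mem_cons_of_mem _ hg)) _⟩
    · rw [h1]; exact Set.empty_disjoint m
    · rw [h2]; exact Set.empty_subset m

theorem Instr.names_of_silent {R : Type} {Q : List (Instr R)}
    (h : ∀ g ∈ Q, g.writes = ∅ ∧ g.reads = ∅) : Instr.names Q = ∅ :=
  Set.eq_empty_of_forall_notMem fun k ⟨g, hg, hk⟩ => by rw [(h g hg).1] at hk; exact hk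

theorem HasProgram.hasImpl {S : Set V} {c : ℕ} {A : Op V} (h : HasProgram S c A) :
    HasImpl S ∅ ∅ c (fun s ρ κ => κ s (conj A ρ)) := by
  obtain ⟨Q, h1, h2, h3⟩ := h
  have hs : ∀ g ∈ Q, g.writes = ∅ ∧ g.reads = ∅ := fun g hg => (h1 g hg).2
  let j : V ↪ V ⊕ Empty := .inl
  refine ⟨Empty, inferInstance, inferInstance, Q.map (Instr.map j), ?_, ?_, ?_, ?_, ?_, ?_⟩
  · intro g hg v hv
    obtain ⟨g, hg', rfl⟩ := List.mem_map.1 hg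
    rw [Instr.qubits_map] at hv
    obtain ⟨v', hv', hj⟩ := hv
    obtain rfl : v' = v := Sum.inl_injective hj
    exact (h1 g hg').1 hv'
  · intro g hg
    obtain ⟨g, hg', rfl⟩ := List.mem_map.1 hg
    rw [Instr.reads_map, (hs g hg').2]
  · rw [Instr.names_map, Instr.names_of_silent hs]
  · exact fun m _ _ => (Instr.wf_of_silent hs m).map _
  · exact (chainDepth_instr_map _ _).trans h2
  · intro β _ s ρ κ
    exact (Instr.runK_map_reduce j Q s ρ κ).trans (h3 _ _ _)

/-- Every instruction implements itself. -/
theorem hasImpl_instr (g : Instr V) :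
    HasImpl g.qubits g.writes g.reads 1 (fun s ρ κ => Instr.runK [g] s ρ κ) := by
  let j : V ↪ V ⊕ Empty := .inl
  refine ⟨Empty, inferInstance, inferInstance, [g.map j], ?_, ?_, ?_, ?_, ?_, ?_⟩
  · intro g' hg v hv
    obtain rfl := List.mem_singleton.1 hg
    rw [Instr.qubits_map] at hv
    obtain ⟨v', hv', hj⟩ := hv
    obtain rfl : v' = v := Sum.inl_injective hj
    exact hv'
  · intro g' hg
    obtain rfl := List.mem_singleton.1 hg
    rw [Instr.reads_map]
  · rw [Instr.names_cons, Instr.names_nil, Set.union_empty, Instr.writes_map]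
  · intro m hm hd
    exact ⟨by rwa [Instr.writes_map], by rwa [Instr.reads_map], trivial⟩
  · exact (chainDepth_le_length _).trans (by simp)
  · intro β _ s ρ κ
    exact Instr.runK_map_reduce j [g] s ρ κ

theorem inj_ket0_apply {W V : Type} [Fintype V] [DecidableEq V] (e : W ↪ V) (x : Bits V)
    (a : Bits W) [Decidable (x = Function.extend e a 0)] :
    inj e ket0 x a = if x = Function.extend e a 0 then 1 else 0 := by
  classical
  rw [inj_apply]
  have h0 : ∀ b : Fin 2, ket0 b = if b = 0 then 1 else 0 := by
    intro b; fin_cases b <;> simp [ket0]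
  have h1 : x = Function.extend e a 0 ↔ x ∘ e = a ∧ ∀ v, v ∉ Set.range e → x v = 0 := by
    rw [← comp_eq_iff]
    refine and_congr_right fun _ => forall₂_congr fun v _ => eq_comm
  by_cases hx : x ∘ e = a
  · rw [if_pos hx]
    by_cases h2 : ∀ v, v ∉ Set.range e → x v = 0
    · rw [if_pos (h1.2 ⟨hx, h2⟩)]
      refine Finset.prod_eq_one fun v _ => ?_
      split_ifs with hv
      · rfl
      · rw [h0, if_pos (h2 v hv)]
    · rw [if_neg fun h => h2 (h1.1 h).2]
      push Not at h2
      obtain ⟨v, hv, hv0⟩ := h2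
      refine Finset.prod_eq_zero (Finset.mem_univ v) ?_
      rw [if_neg hv, h0, if_neg hv0]
  · rw [if_neg hx, if_neg fun h => hx (h1.1 h).1]

theorem elim_eta {W : Type} (w : Bits (V ⊕ W)) : w = Sum.elim (w ∘ Sum.inl) (w ∘ Sum.inr) :=
  (Sum.elim_comp_inl_inr w).symm

theorem extend_inl_elim {W : Type} (a x : Bits V) (z : Bits W) :
    Function.extend (Function.Embedding.inl : V ↪ V ⊕ W) a (Sum.elim x z) = Sum.elim a z := by
  funext v
  rcases v with v | v
  · exact extend_apply_range _ _ _ v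
  · exact extend_apply_notMem _ _ _ (by simp)

theorem extend_inr_elim {W : Type} (a : Bits W) (x : Bits V) (z : Bits W) :
    Function.extend (Function.Embedding.inr : W ↪ V ⊕ W) a (Sum.elim x z) = Sum.elim x a := by
  funext v
  rcases v with v | v
  · exact extend_apply_notMem _ _ _ (by simp)
  · exact extend_apply_range _ _ _ v

theorem inj_inl_ket0_apply {W : Type} [Fintype W] [DecidableEq W] (x a : Bits V) (z : Bits W) :
    inj (Function.Embedding.inl : V ↪ V ⊕ W) ket0 (Sum.elim x z) a
      = if x = a ∧ z = 0 then 1 else 0 := by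
  rw [inj_ket0_apply]
  have : (0 : Bits (V ⊕ W)) = Sum.elim (0 : Bits V) (0 : Bits W) := by funext v; rcases v <;> rfl
  rw [this, extend_inl_elim]
  refine if_congr ⟨fun h => ?_, ?_⟩ rfl rfl
  · exact ⟨congrArg (· ∘ Sum.inl) h, congrArg (· ∘ Sum.inr) h⟩
  · rintro ⟨rfl, rfl⟩; rfl

theorem sum_gateH_mul_ketPlus (b : Fin 2) :
    ∑ c, gateH b c * ketPlus c = if b = 0 then 1 else 0 := by
  simp only [gateH_apply, ketPlus_apply, mul_right_comm _ (sg _ _), sqrt_two_inv_mul_self,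
    Fin.sum_univ_two]
  fin_cases b <;> norm_num [sg]

theorem embed_hadamard_mul_inj {W : Type} [Fintype W] [DecidableEq W] :
    embed (Function.Embedding.inr : W ↪ V ⊕ W) (multi fun _ => gateH) *
      inj (Function.Embedding.inl : V ↪ V ⊕ W) ketPlus = inj Function.Embedding.inl ket0 := by
  classical
  ext w a
  rw [elim_eta w]
  generalize w ∘ Sum.inl = x
  generalize w ∘ Sum.inr = z
  rw [embed_mul_apply, inj_inl_ket0_apply]
  have h1 : ∀ b : Bits W, inj (Function.Embedding.inl : V ↪ V ⊕ W) ketPlus (Sum.elim x b) a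
      = (∏ v : W, ketPlus (b v)) * if x = a then 1 else 0 := by
    intro b
    rw [inj_apply, Fintype.prod_sum_type]
    simp
    rfl
  simp only [extend_inr_elim, h1, multi, Matrix.of_apply, ← mul_assoc, ← Finset.sum_mul,
    ← Finset.prod_mul_distrib]
  have h2 := sum_bits_prod fun (v : W) c => gateH (z v) c * ketPlus c
  refine (congrArg (· * _) h2).trans ?_
  simp only [sum_gateH_mul_ketPlus, Finset.prod_boole, funext_iff, Finset.mem_univ, true_implies,
    ite_and, mul_ite, mul_one, mul_zero, Pi.zero_apply]

theorem conj_hadamard_prepare {W : Type} [Fintype W] [DecidableEq W] (ρ : Op V) :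
    conj (embed (Function.Embedding.inr : W ↪ V ⊕ W) (multi fun _ => gateH))
      (prepare (Function.Embedding.inl : V ↪ V ⊕ W) ketPlus ρ)
      = prepare (Function.Embedding.inl : V ↪ V ⊕ W) ket0 ρ := by
  rw [prepare_eq, prepare_eq, ← embed_hadamard_mul_inj, conj, Matrix.conjTranspose_mul]
  simp only [Matrix.mul_assoc]

theorem HasImpl.congr {S : Set V} {wr rd : Set ℕ} {c : ℕ} {F F' : Sem V}
    (h : HasImpl S wr rd c F)
    (hF : ∀ {β : Type} [AddCommMonoid β] (s : ℕ → Fin 2) (ρ : Op V) (κ : (ℕ → Fin 2) → Op V → β),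
      F s ρ κ = F' s ρ κ) : HasImpl S wr rd c F' := by
  obtain ⟨A, _, _, Q, h1, h2, h3, h4, h5, h6⟩ := h
  exact ⟨A, inferInstance, inferInstance, Q, h1, h2, h3, h4, h5, fun s ρ κ =>
    (h6 s ρ κ).trans (hF _ _ _)⟩

/-- A program using ancillas in the state `|0⟩`. -/
theorem HasProgram.hasImpl_of_ancillas {W : Type} [Fintype W] [DecidableEq W] {S : Set (V ⊕ W)}
    {S' : Set V} {c : ℕ} {A : Op (V ⊕ W)} {f : Op V → Op V} (h : HasProgram S c A)
    (hS : ∀ v, Sum.inl v ∈ S → v ∈ S')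
    (hf : ∀ ρ : Op V, reduce .inl (conj A (prepare .inl ket0 ρ)) = f ρ) :
    HasImpl S' ∅ ∅ (c + 2) (fun s ρ κ => κ s (f ρ)) := by
  have h1 := hasImpl_instr (Instr.init (Finset.univ.map (Function.Embedding.inr : W ↪ V ⊕ W)))
  have h2 := (hasProgram_hadLayer (Function.Embedding.inr : W ↪ V ⊕ W)).mono
    (Set.subset_union_right (s := S)) le_rfl
  have h3 := (h.mono Set.subset_union_left le_rfl).mul h2
  have h4 := (h1.mono (S' := S ∪ Set.range Sum.inr) (rd' := ∅) (c' := 1)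
    (by simp [Instr.qubits]) (Set.Subset.refl _) le_rfl).comp h3.hasImpl (Set.disjoint_empty _)
  have h5 : HasImpl S' (∅ ∪ ∅) (∅ ∪ ∅) (1 + (1 + c)) (fun s ρ κ => κ s (f ρ)) := by
    refine h4.hide ?_ fun s ρ κ => ?_
    · rintro v (hv | ⟨w, hw⟩)
      · exact hS v hv
      · cases hw
    · simp only [Instr.runK, resetPlus_inr, ← conj_conj]
      rw [conj_hadamard_prepare, hf]
  rw [Set.union_empty] at h5
  exact h5.mono subset_rfl subset_rfl (by omega)

end Implementations

/-! ### Unitaries and controlled corrections in constant depth -/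

/-- A circuit that realises `U` up to discarded qubits maps `ψ ⊗ |0…0⟩` to `U ψ ⊗ g` for a unit
vector `g` that does not depend on `ψ`. -/
theorem exists_circuit_factor {d n : ℕ} {U : Op (Fin n)} (h : U ∈ UQNCf d n) :
    ∃ (W : Type) (_ : Fintype W) (_ : DecidableEq W) (l : List (Gate W)) (inp out : Fin n ↪ W)
      (g : Bits W → ℂ), chainDepth Gate.Dep l ≤ d ∧
      (∀ w a, (Gate.circuitOp l * inj inp ket0) w a = U (w ∘ out) a * g w) ∧
      (∀ y w, g (Function.extend out y w) = g w) ∧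
      ∀ x, (∑ u : Bits W, if u ∘ out = x then g u * star (g u) else 0) = 1 := by
  obtain ⟨hU, W, _, _, C, hd, hC⟩ := h
  rw [Matrix.mem_unitaryGroup_iff, Matrix.star_eq_conjTranspose] at hU
  have hU' : Uᴴ * U = 1 := mul_eq_one_comm.1 hU
  let K : Matrix (Bits W) (Bits (Fin n)) ℂ := Gate.circuitOp C.gates * inj C.inp ket0
  obtain ⟨g, h1, h2, h3⟩ := exists_factor_of_reduce_eq C.out (K * Uᴴ) (by
    intro ρ
    have h4 := hC (conj Uᴴ ρ)
    rw [Circuit.channel, Gate.foldl_conj, conj_conj, hU, conj_one, prepare_eq] at h4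
    conv_rhs => rw [← h4]
    simp only [conj, K, Matrix.conjTranspose_mul, Matrix.mul_assoc])
  refine ⟨W, _, _, C.gates, C.inp, C.out, g, hd, fun w a => ?_, h2, h3⟩
  have h5 : K = (K * Uᴴ) * U := by rw [Matrix.mul_assoc, hU', Matrix.mul_one]
  change K w a = _
  rw [h5, Matrix.mul_apply]
  simp only [h1, ite_mul, zero_mul, Finset.sum_ite_eq, Finset.mem_univ, if_true]
  rw [mul_comm]

section Swap

variable {V W κ : Type} [Fintype V] [DecidableEq V] [Fintype W] [DecidableEq W] [Fintype κ]
  [DecidableEq κ]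

theorem extend_trans_inl (e : κ ↪ V) (u : Bits κ) (x : Bits V) (z : Bits W) :
    Function.extend (e.trans (Function.Embedding.inl : V ↪ V ⊕ W)) u (Sum.elim x z)
      = Sum.elim (Function.extend e u x) z := by
  funext v
  rcases v with v | v
  · by_cases hv : v ∈ Set.range e
    · obtain ⟨k, rfl⟩ := hv
      rw [Sum.elim_inl, extend_apply_range]
      exact extend_apply_range (e.trans Function.Embedding.inl) u _ k
    · rw [extend_apply_notMem, Sum.elim_inl, Sum.elim_inl, extend_apply_notMem _ _ _ hv]
      rintro ⟨k, hk⟩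
      exact hv ⟨k, Sum.inl_injective hk⟩
  · exact extend_apply_notMem _ _ _ (by simp)

theorem extend_trans_inr (p : κ ↪ W) (u : Bits κ) (x : Bits V) (z : Bits W) :
    Function.extend (p.trans (Function.Embedding.inr : W ↪ V ⊕ W)) u (Sum.elim x z)
      = Sum.elim x (Function.extend p u z) := by
  funext v
  rcases v with v | v
  · exact extend_apply_notMem _ _ _ (by simp)
  · by_cases hv : v ∈ Set.range p
    · obtain ⟨k, rfl⟩ := hv
      rw [Sum.elim_inr, extend_apply_range]
      exact extend_apply_range (p.trans Function.Embedding.inr) u _ k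
    · rw [extend_apply_notMem, Sum.elim_inr, Sum.elim_inr, extend_apply_notMem _ _ _ hv]
      rintro ⟨k, hk⟩
      exact hv ⟨k, Sum.inr_injective hk⟩

/-- The exchange of the qubits `e k` of the register and `p k` of the ancillas. -/
def swapAnc (e : κ ↪ V) (p : κ ↪ W) : Bits (V ⊕ W) → Bits (V ⊕ W) :=
  swapBits (e.trans Function.Embedding.inl) (p.trans Function.Embedding.inr)

theorem swapAnc_elim (e : κ ↪ V) (p : κ ↪ W) (x : Bits V) (z : Bits W) :
    swapAnc e p (Sum.elim x z)
      = Sum.elim (Function.extend e (z ∘ p) x) (Function.extend p (x ∘ e) z) := by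
  rw [swapAnc, swapBits, extend_trans_inr, extend_trans_inl]
  rfl

theorem hasProgram_swapAnc (e : κ ↪ V) (p : κ ↪ W) :
    HasProgram (Set.range (Sum.inl ∘ e) ∪ Set.range Sum.inr) 9
      (pullOp (swapAnc e p) : Op (V ⊕ W)) := by
  have h := hasProgram_swapBits
    (Finset.univ.map (e.trans Function.Embedding.inl) ∪
      Finset.univ.map (p.trans (Function.Embedding.inr : W ↪ V ⊕ W)))
    (e.trans Function.Embedding.inl) (p.trans Function.Embedding.inr) (by simp) (by simp) (by
      rw [Set.disjoint_left]
      rintro _ ⟨k, rfl⟩ ⟨k', hk⟩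
      cases hk)
  refine h.mono ?_ le_rfl
  intro v hv
  simp only [Finset.coe_union, Finset.coe_map, Finset.coe_univ, Set.image_univ] at hv
  rcases hv with ⟨k, rfl⟩ | ⟨k, rfl⟩
  · exact Or.inl ⟨k, rfl⟩
  · exact Or.inr ⟨p k, rfl⟩

theorem extend_eq_extend_iff (e : κ ↪ V) (a b : Bits κ) (x y : Bits V) :
    Function.extend e a x = Function.extend e b y ↔
      a = b ∧ ∀ v, v ∉ Set.range e → x v = y v := by
  constructor
  · intro h
    refine ⟨?_, fun v hv => ?_⟩
    · rw [← extend_comp_self e a x, h, extend_comp_self]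
    · rw [← extend_apply_notMem e a x hv, h, extend_apply_notMem e b y hv]
  · rintro ⟨rfl, h⟩
    funext v
    by_cases hv : v ∈ Set.range e
    · obtain ⟨k, rfl⟩ := hv
      rw [extend_apply_range, extend_apply_range]
    · rw [extend_apply_notMem e a x hv, h v hv, extend_apply_notMem e a y hv]

/-- Moving data into the input qubits of an ancilla register. -/
theorem swapAnc_mul_inj_apply (e : κ ↪ V) (p : κ ↪ W) (x x₀ : Bits V) (z : Bits W) :
    (pullOp (swapAnc e p) * inj (Function.Embedding.inl : V ↪ V ⊕ W) ket0) (Sum.elim x z) x₀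
      = if x = Function.extend e 0 x₀ then inj p ket0 z (x₀ ∘ e) else 0 := by
  classical
  rw [pullOp_mul_apply, swapAnc_elim, inj_inl_ket0_apply, inj_ket0_apply, ← ite_and]
  refine if_congr ?_ rfl rfl
  have h1 : Function.extend e (z ∘ p) x = x₀ ↔
      z ∘ p = x₀ ∘ e ∧ ∀ v, v ∉ Set.range e → x v = x₀ v := by
    conv_lhs => rw [← extend_self e x₀]
    exact extend_eq_extend_iff _ _ _ _ _
  have h2 : Function.extend p (x ∘ e) z = 0 ↔
      x ∘ e = 0 ∧ ∀ v, v ∉ Set.range p → z v = 0 := by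
    conv_lhs => rw [← extend_self p (0 : Bits W)]
    exact extend_eq_extend_iff _ _ _ _ _
  have h3 : x = Function.extend e 0 x₀ ↔ x ∘ e = 0 ∧ ∀ v, v ∉ Set.range e → x v = x₀ v := by
    conv_lhs => rw [← extend_self e x]
    exact extend_eq_extend_iff _ _ _ _ _
  have h4 : z = Function.extend p (x₀ ∘ e) 0 ↔
      z ∘ p = x₀ ∘ e ∧ ∀ v, v ∉ Set.range p → z v = 0 := by
    conv_lhs => rw [← extend_self p z]
    exact extend_eq_extend_iff _ _ _ _ _
  rw [h1, h2, h3, h4]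
  tauto

theorem embed_inr_mul_apply {X : Type*} (G : Op W) (N : Matrix (Bits (V ⊕ W)) X ℂ) (x : Bits V)
    (z : Bits W) (y : X) :
    (embed (Function.Embedding.inr : W ↪ V ⊕ W) G * N) (Sum.elim x z) y
      = ∑ a, G z a * N (Sum.elim x a) y := by
  rw [embed_mul_apply]
  simp only [extend_inr_elim]
  rfl

theorem sum_fiber_inl (x : Bits V) (f : Bits W → ℂ) :
    (∑ u : Bits (V ⊕ W), if u ∘ (Function.Embedding.inl : V ↪ V ⊕ W) = x then f (u ∘ Sum.inr)
      else 0) = ∑ z, f z := by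
  rw [← (Equiv.sumArrowEquivProdArrow V W (Fin 2)).symm.sum_comp, Fintype.sum_prod_type]
  have h : ∀ (a : Bits V) (b : Bits W),
      ((Equiv.sumArrowEquivProdArrow V W (Fin 2)).symm (a, b)) ∘
        (Function.Embedding.inl : V ↪ V ⊕ W) = a ∧
      ((Equiv.sumArrowEquivProdArrow V W (Fin 2)).symm (a, b)) ∘ Sum.inr = b :=
    fun a b => ⟨rfl, rfl⟩
  simp only [h]
  rw [Finset.sum_comm]
  simp

theorem conj_prepare_inl_ket0 (A : Op (V ⊕ W)) (ρ : Op V) :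
    ∃ J : Matrix (Bits (V ⊕ W)) (Bits V) ℂ, J = inj (Function.Embedding.inl : V ↪ V ⊕ W) ket0 ∧
      conj A (prepare (Function.Embedding.inl : V ↪ V ⊕ W) ket0 ρ) = (A * J) * ρ * (A * J)ᴴ := by
  refine ⟨_, rfl, ?_⟩
  rw [prepare_eq, conj, Matrix.conjTranspose_mul]
  simp only [Matrix.mul_assoc]

end Swap

section InPlace

variable {V : Type} [Fintype V] [DecidableEq V] {d n : ℕ}

/-- A unitary of constant depth is applied in place: the data are moved into an ancilla register,
which runs the circuit, and the output is moved back. -/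
theorem hasImpl_unitary (e : Fin n ↪ V) {U : Op (Fin n)} (hU : U ∈ UQNCf d n) :
    HasImpl (Set.range e) ∅ ∅ (20 + 3 * d) (fun s ρ κ => κ s (conj (embed e U) ρ)) := by
  classical
  obtain ⟨W, _, _, l, inp, out, g, hd, hK, hg, hg1⟩ := exists_circuit_factor hU
  have h1 := (hasProgram_swapAnc e inp)
  have h2 := (Gate.hasProgram_circuitOp (Function.Embedding.inr : W ↪ V ⊕ W) l).mono
    (S' := Set.range (Sum.inl ∘ e) ∪ Set.range Sum.inr) (fun _ h => Or.inr h)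
    (Nat.mul_le_mul_left 3 hd)
  have h3 := (hasProgram_swapAnc e out)
  refine ((h3.mul (h2.mul h1)).hasImpl_of_ancillas (S' := Set.range e) ?_
    (f := conj (embed e U)) ?_).mono subset_rfl subset_rfl (by omega)
  · rintro v (⟨k, hk⟩ | ⟨k, hk⟩)
    · exact ⟨k, Sum.inl_injective hk⟩
    · cases hk
  · intro ρ
    obtain ⟨J, hJ, h4⟩ := conj_prepare_inl_ket0 (pullOp (swapAnc e out) *
      (embed Function.Embedding.inr (Gate.circuitOp l) * pullOp (swapAnc e inp))) ρ
    rw [h4]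
    have h5 := reduce_of_factor (Function.Embedding.inl : V ↪ V ⊕ W)
      (pullOp (swapAnc e out) * (embed Function.Embedding.inr (Gate.circuitOp l) *
        pullOp (swapAnc e inp)) * J) (embed e U)
      (fun w => if (w ∘ Sum.inr) ∘ out = 0 then g (w ∘ Sum.inr) else 0) 1 ?_ ?_ ?_ ρ
    · rw [h5, one_smul]; rfl
    · intro w x₀
      rw [elim_eta w]
      generalize w ∘ Sum.inl = x
      generalize w ∘ Sum.inr = z
      let N₁ : Matrix (Bits (V ⊕ W)) (Bits V) ℂ := pullOp (swapAnc e inp) * J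
      let N₂ : Matrix (Bits (V ⊕ W)) (Bits V) ℂ :=
        embed (Function.Embedding.inr : W ↪ V ⊕ W) (Gate.circuitOp l) * N₁
      -- the state after the circuit: the emptied register, and `U` on the circuit's outputs
      have h6 : ∀ (x : Bits V) (z : Bits W), N₂ (Sum.elim x z) x₀
          = if x = Function.extend e 0 x₀ then U (z ∘ out) (x₀ ∘ e) * g z else 0 := by
        intro x z
        simp only [N₂, N₁, embed_inr_mul_apply, hJ]
        simp only [swapAnc_mul_inj_apply, mul_ite, mul_zero]
        split_ifs
        · rw [← hK, Matrix.mul_apply]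
        · exact Finset.sum_const_zero
      rw [Matrix.mul_assoc, Matrix.mul_assoc]
      change (pullOp (swapAnc e out) * N₂) _ _ = _
      rw [pullOp_mul_apply, swapAnc_elim, h6, extend_comp_self, hg]
      simp only [extend_eq_extend_iff, Sum.elim_comp_inr]
      rw [embed_apply]
      change _ = (if ∀ v, v ∉ Set.range e → x v = x₀ v then U (x ∘ e) (x₀ ∘ e) else 0) * _
      by_cases h7 : z ∘ out = 0 <;> simp [h7]
    · intro y w
      rw [elim_eta w, extend_inl_elim]
      rfl
    · intro x
      have h9 := sum_fiber_inl (W := W) x (fun z => (if z ∘ out = 0 then g z else 0) *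
        star (if z ∘ out = 0 then g z else 0))
      refine h9.trans ((Finset.sum_congr rfl fun z _ => ?_).trans (hg1 0))
      split_ifs <;> simp

/-- The operator `M` on the qubits selected by `e`, controlled by the qubit `c`. -/
def ctrl (e : Fin n ↪ V) (c : V) (M : Op (Fin n)) : Op V :=
  Matrix.of fun x y => embed e (M ^ (x c : ℕ)) x y

/-- A unitary that is diagonalised in constant depth is applied in place under quantum control:
the data are moved into an ancilla register, which runs the diagonalising circuit, controlled
phases, and the inverse of the circuit; this restores the ancillas. -/
theorem hasImpl_ctrl (e : Fin n ↪ V) (c : V) (hc : c ∉ Set.range e) {U M : Op (Fin n)}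
    (hU : U ∈ UQNCf d n) (θ : Bits (Fin n) → ℝ) (hM : U * M * Uᴴ = phase θ) :
    HasImpl (insert c (Set.range e)) ∅ ∅ (21 + 6 * d) (fun s ρ κ => κ s (conj (ctrl e c M) ρ)) := by
  classical
  have hUU : Uᴴ * U = 1 := by
    have h := hU.1
    rw [Matrix.mem_unitaryGroup_iff, Matrix.star_eq_conjTranspose] at h
    exact mul_eq_one_comm.1 h
  have hUM : U * M = phase θ * U := by
    rw [← hM, Matrix.mul_assoc, hUU, Matrix.mul_one]
  obtain ⟨W, _, _, l, inp, out, g, hd, hK, hg, hg1⟩ := exists_circuit_factor hU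
  let S : Set (V ⊕ W) := insert (Sum.inl c) (Set.range (Sum.inl ∘ e) ∪ Set.range Sum.inr)
  have h1 := (hasProgram_swapAnc e inp).mono (S' := S) (Set.subset_insert _ _) le_rfl
  have h2 := (Gate.hasProgram_circuitOp (Function.Embedding.inr : W ↪ V ⊕ W) l).mono
    (S' := S) (fun _ h => Or.inr (Or.inr h)) (Nat.mul_le_mul_left 3 hd)
  have h2' := (Gate.hasProgram_circuitOp (Function.Embedding.inr : W ↪ V ⊕ W)
    (l.map Gate.inv).reverse).mono (S' := S) (fun _ h => Or.inr (Or.inr h))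
    (Nat.mul_le_mul_left 3 ((Gate.chainDepth_inv l).trans hd))
  rw [Gate.circuitOp_inv] at h2'
  let η : Bits (V ⊕ W) → ℝ := fun w => if w (Sum.inl c) = 1 then θ ((w ∘ Sum.inr) ∘ out) else 0
  have h3 := (hasProgram_phase (insert (Sum.inl c) (Finset.univ.map Function.Embedding.inr)) η (by
    intro x y h
    have e1 : x (Sum.inl c) = y (Sum.inl c) := h _ (Finset.mem_insert_self _ _)
    have e2 : x ∘ Sum.inr = y ∘ Sum.inr := funext fun w =>
      h _ (Finset.mem_insert_of_mem (Finset.mem_map_of_mem _ (Finset.mem_univ w)))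
    simp only [η, e1, e2])).mono (S' := S) (by
      intro v hv
      simp only [Finset.coe_insert, Finset.coe_map, Finset.coe_univ, Set.image_univ] at hv
      exact hv.imp id Or.inr) le_rfl
  refine ((h1.mul (h2'.mul (h3.mul (h2.mul h1)))).hasImpl_of_ancillas
    (S' := insert c (Set.range e)) ?_ (f := conj (ctrl e c M)) ?_).mono subset_rfl subset_rfl
      (by omega)
  · rintro v (hv | ⟨k, hk⟩ | ⟨k, hk⟩)
    · exact Or.inl (Sum.inl_injective hv)
    · exact Or.inr ⟨k, Sum.inl_injective hk⟩
    · cases hk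
  · intro ρ
    obtain ⟨J, hJ, h4⟩ := conj_prepare_inl_ket0 (pullOp (swapAnc e inp) *
      (embed Function.Embedding.inr (Gate.circuitOp l)ᴴ * (phase η *
      (embed Function.Embedding.inr (Gate.circuitOp l) * pullOp (swapAnc e inp))))) ρ
    rw [h4]
    suffices h5 : pullOp (swapAnc e inp) *
        (embed Function.Embedding.inr (Gate.circuitOp l)ᴴ * (phase η *
        (embed Function.Embedding.inr (Gate.circuitOp l) * pullOp (swapAnc e inp)))) * J
        = J * ctrl e c M by
      rw [h5, Matrix.conjTranspose_mul]
      have h6 : J * ctrl e c M * ρ * ((ctrl e c M)ᴴ * Jᴴ)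
          = J * conj (ctrl e c M) ρ * Jᴴ := by
        simp only [conj, Matrix.mul_assoc]
      rw [h6, hJ, ← prepare_eq]
      exact reduce_prepare _ ket0_norm _
    let K : Matrix (Bits W) (Bits (Fin n)) ℂ := inj inp ket0
    -- running the circuit after `M ^ b` amounts to running it first and applying the phases then
    have hGK : ∀ b : Fin 2, ∀ z a,
        Complex.exp ((if b = 1 then θ (z ∘ out) else 0 : ℝ) * Complex.I) * (U (z ∘ out) a * g z)
          = (Gate.circuitOp l * (K * M ^ (b : ℕ))) z a := by
      intro b z a
      have e1 : Gate.circuitOp l * (K * M ^ (b : ℕ)) = (Gate.circuitOp l * K) * M ^ (b : ℕ) :=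
        (Matrix.mul_assoc _ _ _).symm
      have e2 : ((Gate.circuitOp l * K) * M ^ (b : ℕ)) z a
          = (U * M ^ (b : ℕ)) (z ∘ out) a * g z := by
        rw [Matrix.mul_apply, Matrix.mul_apply, Finset.sum_mul]
        refine Finset.sum_congr rfl fun a' _ => ?_
        rw [hK]; ring
      rw [e1, e2]
      rcases (show b = 0 ∨ b = 1 by omega) with rfl | rfl
      · simp
      · rw [Fin.val_one, pow_one, hUM, phase, Matrix.diagonal_mul, if_pos rfl]
        ring
    ext w x₀
    rw [elim_eta w]
    generalize w ∘ Sum.inl = x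
    generalize w ∘ Sum.inr = z
    let N₁ : Matrix (Bits (V ⊕ W)) (Bits V) ℂ := pullOp (swapAnc e inp) * J
    let N₂ : Matrix (Bits (V ⊕ W)) (Bits V) ℂ :=
      embed (Function.Embedding.inr : W ↪ V ⊕ W) (Gate.circuitOp l) * N₁
    let N₃ : Matrix (Bits (V ⊕ W)) (Bits V) ℂ := phase η * N₂
    let N₄ : Matrix (Bits (V ⊕ W)) (Bits V) ℂ :=
      embed (Function.Embedding.inr : W ↪ V ⊕ W) (Gate.circuitOp l)ᴴ * N₃
    -- the state after the controlled phases
    have h6 : ∀ (x : Bits V) (z : Bits W), N₃ (Sum.elim x z) x₀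
        = if x = Function.extend e 0 x₀ then
            (Gate.circuitOp l * (K * M ^ (x₀ c : ℕ))) z (x₀ ∘ e) else 0 := by
      intro x z
      simp only [N₃, N₂, N₁, phase, Matrix.diagonal_mul, embed_inr_mul_apply, hJ]
      simp only [swapAnc_mul_inj_apply, mul_ite, mul_zero]
      split_ifs with hx
      · rw [← hGK, ← hK, Matrix.mul_apply]
        have e1 : η (Sum.elim x z) = if x₀ c = 1 then θ (z ∘ out) else 0 := by
          simp only [η, Sum.elim_inl, Sum.elim_comp_inr, hx, extend_apply_notMem e _ _ hc]
        rw [e1]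
      · rw [Finset.sum_const_zero, mul_zero]
    -- the inverse circuit leaves `M ^ (x₀ c)` applied to the data, and clears the ancillas
    have h7 : ∀ (x : Bits V) (z : Bits W), N₄ (Sum.elim x z) x₀
        = if x = Function.extend e 0 x₀ then (K * M ^ (x₀ c : ℕ)) z (x₀ ∘ e) else 0 := by
      intro x z
      simp only [N₄, embed_inr_mul_apply, h6, mul_ite, mul_zero]
      split_ifs
      · rw [← Matrix.mul_apply, ← Matrix.mul_assoc, Gate.circuitOp_conjTranspose_mul,
          Matrix.one_mul]
      · exact Finset.sum_const_zero
    simp only [Matrix.mul_assoc]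
    change (pullOp (swapAnc e inp) * N₄) _ _ = _
    rw [pullOp_mul_apply, swapAnc_elim, h7, hJ, Matrix.mul_apply, Matrix.mul_apply]
    have h8 : ∀ a : Bits (Fin n), K (Function.extend inp (x ∘ e) z) a
        = if x ∘ e = a ∧ ∀ v, v ∉ Set.range inp → z v = 0 then 1 else 0 := by
      intro a
      simp only [K, inj_ket0_apply, extend_eq_extend_iff]
      rfl
    have h9 : z = 0 ↔ z ∘ inp = 0 ∧ ∀ v, v ∉ Set.range inp → z v = 0 := by
      conv_lhs => rw [← extend_self inp z, ← extend_self inp (0 : Bits W)]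
      exact extend_eq_extend_iff _ _ _ _ _
    simp only [h8, inj_inl_ket0_apply, ite_mul, one_mul, zero_mul, ite_and, Finset.sum_ite_eq,
      Finset.mem_univ, if_true, extend_eq_extend_iff, h9, ctrl, Matrix.of_apply, embed_apply]
    split_ifs with e1 e2 e3 <;> first | rfl | rw [e2 c hc]

end InPlace

/-! ### Commands of constant depth -/

section Steps

variable {V : Type} [Fintype V] [DecidableEq V] {d n : ℕ}

theorem exists_eq_phase {R : Type} [Fintype R] [DecidableEq R] {D : Op R} (hd : D.IsDiag)
    (hu : D * Dᴴ = 1) : ∃ θ, D = phase θ := by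
  refine ⟨fun x => (D x x).arg, ?_⟩
  have h1 : D = Matrix.diagonal fun x => D x x := (Matrix.isDiag_iff_diagonal_diag D).1 hd |>.symm
  rw [phase]
  conv_lhs => rw [h1]
  congr 1
  funext x
  have h2 : D x x * star (D x x) = 1 := by
    have h3 := congrFun (congrFun hu x) x
    rw [h1, Matrix.diagonal_conjTranspose, Matrix.diagonal_mul_diagonal,
      Matrix.diagonal_apply_eq, Matrix.one_apply_eq] at h3
    exact h3
  have h4 : ‖D x x‖ = 1 := by
    rw [Complex.star_def, Complex.mul_conj, Complex.normSq_eq_norm_sq] at h2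
    have h5 : ‖D x x‖ ^ 2 = 1 := by exact_mod_cast h2
    exact (pow_eq_one_iff_of_nonneg (norm_nonneg _) two_ne_zero).1 h5
  have h6 := Complex.norm_mul_exp_arg_mul_I (D x x)
  rw [h4, Complex.ofReal_one, one_mul] at h6
  exact h6.symm

/-- A unitary in the class `OQNCf` is diagonalised to a diagonal matrix of phases. -/
theorem exists_diagonalization {M : Op (Fin n)} (hM : M ∈ OQNCf d n) (hu : M * Mᴴ = 1) :
    ∃ U ∈ UQNCf d n, ∃ θ, U * M * Uᴴ = phase θ := by
  obtain ⟨U, hU, hd⟩ := hM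
  refine ⟨U, hU, exists_eq_phase hd ?_⟩
  have h1 := hU.1
  rw [Matrix.mem_unitaryGroup_iff, Matrix.star_eq_conjTranspose] at h1
  have h2 : Uᴴ * U = 1 := mul_eq_one_comm.1 h1
  calc U * M * Uᴴ * (U * M * Uᴴ)ᴴ = U * (M * ((Uᴴ * U) * Mᴴ)) * Uᴴ := by
        simp only [Matrix.conjTranspose_mul, Matrix.conjTranspose_conjTranspose, Matrix.mul_assoc]
    _ = 1 := by rw [h2, Matrix.one_mul, hu, Matrix.mul_one, h1]

theorem inj_inl_unit_apply (φ : Fin 2 → ℂ) (x : Bits V) (t : Bits Unit) (y : Bits V) :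
    inj (Function.Embedding.inl : V ↪ V ⊕ Unit) φ (Sum.elim x t) y
      = if x = y then φ (t ()) else 0 := by
  classical
  rw [inj_apply, Fintype.prod_sum_type]
  refine if_congr Iff.rfl ?_ rfl
  simp

theorem update_elim_unit (x : Bits V) (t : Bits Unit) (c : Fin 2) :
    Function.update (Sum.elim x t) (Sum.inr ()) c = Sum.elim x fun _ => c := by
  funext v
  rcases v with v | v
  · rw [Function.update_of_ne (by simp), Sum.elim_inl, Sum.elim_inl]
  · exact Function.update_self _ _ _

theorem single_mul_inj (A : Matrix (Fin 2) (Fin 2) ℂ) (φ : Fin 2 → ℂ) :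
    single (Sum.inr () : V ⊕ Unit) A * inj (Function.Embedding.inl : V ↪ V ⊕ Unit) φ
      = inj (Function.Embedding.inl : V ↪ V ⊕ Unit) (A *ᵥ φ) := by
  ext w y
  rw [elim_eta w]
  generalize w ∘ Sum.inl = x
  generalize w ∘ Sum.inr = t
  rw [single_mul_apply, inj_inl_unit_apply]
  simp only [update_elim_unit, inj_inl_unit_apply, Sum.elim_inr]
  split_ifs with h
  · rfl
  · simp

theorem conj_single_prepare (A : Matrix (Fin 2) (Fin 2) ℂ) (φ : Fin 2 → ℂ) (ρ : Op V) :
    conj (single (Sum.inr () : V ⊕ Unit) A)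
        (prepare (Function.Embedding.inl : V ↪ V ⊕ Unit) φ ρ)
      = prepare (Function.Embedding.inl : V ↪ V ⊕ Unit) (A *ᵥ φ) ρ := by
  rw [prepare_eq, prepare_eq, ← single_mul_inj, conj, Matrix.conjTranspose_mul]
  simp only [Matrix.mul_assoc]

/-- The control qubit of the additional register `Unit`, in the state `φ`. -/
theorem ctrl_mul_inj_apply (e : Fin n ↪ V) (M : Op (Fin n)) (φ : Fin 2 → ℂ) (x y : Bits V)
    (t : Bits Unit) :
    (ctrl (e.trans Function.Embedding.inl) (Sum.inr ()) M *
      inj (Function.Embedding.inl : V ↪ V ⊕ Unit) φ) (Sum.elim x t) y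
      = φ (t ()) * embed e (M ^ (t () : ℕ)) x y := by
  have h1 : (ctrl (e.trans Function.Embedding.inl) (Sum.inr ()) M *
      inj (Function.Embedding.inl : V ↪ V ⊕ Unit) φ) (Sum.elim x t) y
      = (embed (e.trans (Function.Embedding.inl : V ↪ V ⊕ Unit)) (M ^ (t () : ℕ)) *
        inj (Function.Embedding.inl : V ↪ V ⊕ Unit) φ) (Sum.elim x t) y := by
    rw [Matrix.mul_apply, Matrix.mul_apply]
    rfl
  have h2 : embed e (M ^ (t () : ℕ)) x y = (embed e (M ^ (t () : ℕ)) * 1) x y := by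
    rw [Matrix.mul_one]
  rw [h1, h2, embed_mul_apply, embed_mul_apply, Finset.mul_sum]
  refine Finset.sum_congr rfl fun a _ => ?_
  rw [extend_trans_inl, inj_inl_unit_apply, Matrix.one_apply]
  change (M ^ (t () : ℕ)) (x ∘ e) a * _ = _
  split_ifs <;> ring

theorem resetPlus_unit (ρ : Op (V ⊕ Unit)) :
    resetPlus {Sum.inr ()} ρ = prepare .inl ketPlus (reduce .inl ρ) := by
  rw [← resetPlus_inr]
  congr 1

/-- Measuring the control qubit of a controlled observable in the basis `|±⟩` measures the
observable. -/
theorem reduce_measure_ctrl (e : Fin n ↪ V) (M : Op (Fin n)) (b : Fin 2) (ρ : Op V) :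
    reduce (Function.Embedding.inl : V ↪ V ⊕ Unit) (conj (single (Sum.inr ()) (projAngle 0 b))
      (conj (ctrl (e.trans Function.Embedding.inl) (Sum.inr ()) M)
        (prepare (Function.Embedding.inl : V ↪ V ⊕ Unit) ketPlus ρ)))
      = conj (embed e (outcomeProj M b)) ρ := by
  let J : Matrix (Bits (V ⊕ Unit)) (Bits V) ℂ := inj Function.Embedding.inl ketPlus
  let C : Op (V ⊕ Unit) := ctrl (e.trans Function.Embedding.inl) (Sum.inr ()) M
  let P : Op (V ⊕ Unit) := single (Sum.inr ()) (projAngle 0 b)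
  let N₁ : Matrix (Bits (V ⊕ Unit)) (Bits V) ℂ := C * J
  let N : Matrix (Bits (V ⊕ Unit)) (Bits V) ℂ := P * N₁
  have h1 : conj P (conj C (prepare (Function.Embedding.inl : V ↪ V ⊕ Unit) ketPlus ρ))
      = N * ρ * Nᴴ := by
    simp only [prepare_eq, conj, N, N₁, J, Matrix.conjTranspose_mul, Matrix.mul_assoc]
  change reduce _ (conj P (conj C _)) = _
  rw [h1]
  refine (reduce_of_factor _ N (embed e (outcomeProj M b))
    (fun w => (Real.sqrt 2 : ℂ)⁻¹ * sg b (w (Sum.inr ()))) 1 ?_ ?_ ?_ ρ).trans (one_smul _ _)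
  · intro w y
    rw [elim_eta w]
    generalize w ∘ Sum.inl = x
    generalize w ∘ Sum.inr = t
    have h2 : ∀ t : Bits Unit, N₁ (Sum.elim x t) y
        = (Real.sqrt 2 : ℂ)⁻¹ * embed e (M ^ (t () : ℕ)) x y := fun t => by
      rw [← ketPlus_apply (t ())]; exact ctrl_mul_inj_apply e M ketPlus x y t
    have h3 : N (Sum.elim x t) y = ∑ c : Fin 2, projAngle 0 b (t ()) c *
        ((Real.sqrt 2 : ℂ)⁻¹ * embed e (M ^ (c : ℕ)) x y) := by
      refine (single_mul_apply _ _ N₁ _ _).trans (Finset.sum_congr rfl fun c _ => ?_)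
      rw [update_elim_unit, h2, Sum.elim_inr]
    rw [h3, Fin.sum_univ_two, projAngle_apply, projAngle_apply, outcomeProj, embed_smul, embed_add,
      embed_smul]
    have h4 : ∀ c, ang 0 c = 1 := fun c => by unfold ang; split_ifs <;> simp
    have h5 : sg b 0 = 1 := by simp [sg]
    have h6 : sg b 1 = (-1) ^ (b : ℕ) := by
      fin_cases b <;> simp [sg]
    simp only [neg_zero, h4, h5, h6, Fin.val_zero, Fin.val_one, pow_zero, pow_one,
      Matrix.smul_apply, Matrix.add_apply, smul_eq_mul, Sum.elim_inr]
    change _ = 2⁻¹ * (embed e 1 x y + _ * embed e M x y) * _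
    ring
  · intro y w
    have : Function.extend (Function.Embedding.inl : V ↪ V ⊕ Unit) y w (Sum.inr ())
        = w (Sum.inr ()) := extend_apply_notMem _ _ _ (by simp)
    simp only [this]
  · intro x
    have h7 := sum_fiber_inl (W := Unit) x fun t => ((Real.sqrt 2 : ℂ)⁻¹ * sg b (t ())) *
      star ((Real.sqrt 2 : ℂ)⁻¹ * sg b (t ()))
    refine h7.trans ?_
    have h8 : star ((Real.sqrt 2 : ℂ)⁻¹) = (Real.sqrt 2 : ℂ)⁻¹ := by simp
    have h9 : ∀ t : Bits Unit, ((Real.sqrt 2 : ℂ)⁻¹ * sg b (t ())) *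
      star ((Real.sqrt 2 : ℂ)⁻¹ * sg b (t ())) = 2⁻¹ := fun t => by
      rw [star_mul', h8, star_sg, mul_mul_mul_comm, sqrt_two_inv_mul_self, sg_mul_self, mul_one]
    rw [Finset.sum_congr rfl fun t _ => h9 t]
    simp

/-- The control qubit in a basis state. -/
theorem reduce_ctrl_basis (e : Fin n ↪ V) (M : Op (Fin n)) (b : Fin 2) (ρ : Op V) :
    reduce (Function.Embedding.inl : V ↪ V ⊕ Unit)
      (conj (ctrl (e.trans Function.Embedding.inl) (Sum.inr ()) M)
        (prepare (Function.Embedding.inl : V ↪ V ⊕ Unit) (fun t => if t = b then 1 else 0) ρ))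
      = conj (embed e (M ^ (b : ℕ))) ρ := by
  let J : Matrix (Bits (V ⊕ Unit)) (Bits V) ℂ :=
    inj Function.Embedding.inl fun t => if t = b then 1 else 0
  let C : Op (V ⊕ Unit) := ctrl (e.trans Function.Embedding.inl) (Sum.inr ()) M
  let N : Matrix (Bits (V ⊕ Unit)) (Bits V) ℂ := C * J
  have h1 : conj C (prepare (Function.Embedding.inl : V ↪ V ⊕ Unit)
      (fun t => if t = b then 1 else 0) ρ) = N * ρ * Nᴴ := by
    simp only [prepare_eq, conj, N, J, Matrix.conjTranspose_mul, Matrix.mul_assoc]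
  change reduce _ (conj C _) = _
  rw [h1]
  refine (reduce_of_factor _ N (embed e (M ^ (b : ℕ)))
    (fun w => if w (Sum.inr ()) = b then 1 else 0) 1 ?_ ?_ ?_ ρ).trans (one_smul _ _)
  · intro w y
    rw [elim_eta w]
    generalize w ∘ Sum.inl = x
    generalize w ∘ Sum.inr = t
    refine (ctrl_mul_inj_apply e M _ x y t).trans ?_
    rw [Sum.elim_inr, mul_comm]
    change embed e _ x y * _ = embed e _ x y * _
    split_ifs with h
    · rw [h]
    · rw [mul_zero, mul_zero]
  · intro y w
    have : Function.extend (Function.Embedding.inl : V ↪ V ⊕ Unit) y w (Sum.inr ())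
        = w (Sum.inr ()) := extend_apply_notMem _ _ _ (by simp)
    simp only [this]
  · intro x
    have h7 := sum_fiber_inl (W := Unit) x fun t => (if t () = b then (1 : ℂ) else 0) *
      star (if t () = b then (1 : ℂ) else 0)
    refine h7.trans ?_
    rw [← (Equiv.funUnique Unit (Fin 2)).symm.sum_comp]
    simp [Equiv.funUnique]

theorem conj_embed_reset (e : Fin n ↪ V) (B : Op (Fin n)) (φ : Bits (Fin n) → ℂ) (ρ : Op V) :
    conj (embed e B) (reset e φ ρ) = reset e (B *ᵥ φ) ρ := by
  ext x y
  have h1 : ∀ N : Op V, (N * (embed e B)ᴴ) x y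
      = ∑ a, N x (Function.extend e a y) * star (B (y ∘ e) a) := by
    intro N
    have h2 : (N * (embed e B)ᴴ) x y = star ((embed e B * Nᴴ) y x) := by
      rw [← Matrix.conjTranspose_apply, Matrix.conjTranspose_mul,
        Matrix.conjTranspose_conjTranspose]
    rw [h2, embed_mul_apply, star_sum]
    refine Finset.sum_congr rfl fun a _ => ?_
    rw [star_mul', Matrix.conjTranspose_apply, star_star, mul_comm]
  rw [conj, h1]
  simp only [embed_mul_apply, reset, Matrix.of_apply, extend_comp_self, extend_extend]
  generalize ∑ z : Bits (Fin n), ρ (Function.extend e z x) (Function.extend e z y) = Z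
  simp only [Matrix.mulVec, dotProduct, star_sum, star_mul', Finset.sum_mul, Finset.mul_sum]
  refine Finset.sum_congr rfl fun a _ => Finset.sum_congr rfl fun b _ => ?_
  ring

/-- Exchanging qubits with fresh ones and discarding the latter. -/
theorem reduce_swap_ket0 (e : Fin n ↪ V) (ρ : Op V) :
    reduce (Function.Embedding.inl : V ↪ V ⊕ Fin n)
      (conj (pullOp (swapAnc e (Function.Embedding.refl (Fin n))))
        (prepare (Function.Embedding.inl : V ↪ V ⊕ Fin n) ket0 ρ))
      = reset e (Pi.single 0 1) ρ := by
  classical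
  obtain ⟨J, hJ, h1⟩ := conj_prepare_inl_ket0
    (pullOp (swapAnc e (Function.Embedding.refl (Fin n)))) ρ
  rw [h1]
  have h2 : ∀ (x : Bits V) (z : Bits (Fin n)) (a : Bits V),
      (pullOp (swapAnc e (Function.Embedding.refl (Fin n))) * J) (Sum.elim x z) a
      = if a = Function.extend e z x then (Pi.single 0 1 : Bits (Fin n) → ℂ) (x ∘ e) else 0 := by
    intro x z a
    rw [hJ, swapAnc_mul_inj_apply, inj_ket0_apply, ← ite_and, Pi.single_apply, ← ite_and]
    have e1 : Function.extend (Function.Embedding.refl (Fin n)) (a ∘ e) 0 = a ∘ e :=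
      extend_comp_self (Function.Embedding.refl (Fin n)) _ _
    rw [e1]
    refine if_congr ?_ rfl rfl
    rw [← comp_eq_iff, ← comp_eq_iff]
    have e2 : (∀ v, v ∉ Set.range e → a v = x v) ↔ ∀ v, v ∉ Set.range e → x v = a v :=
      forall₂_congr fun v _ => eq_comm
    rw [e2, eq_comm (a := z)]
    tauto
  ext x y
  have h3 : ∀ u : Bits (V ⊕ Fin n), Function.extend (Function.Embedding.inl : V ↪ V ⊕ Fin n) y u
      = Sum.elim y (u ∘ Sum.inr) := by
    intro u
    conv_lhs => rw [elim_eta u]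
    exact extend_inl_elim _ _ _
  let N : Matrix (Bits (V ⊕ Fin n)) (Bits V) ℂ :=
    pullOp (swapAnc e (Function.Embedding.refl (Fin n))) * J
  have h4 : ∀ z : Bits (Fin n), (N * ρ * Nᴴ) (Sum.elim x z) (Sum.elim y z)
      = (Pi.single 0 1 : Bits (Fin n) → ℂ) (x ∘ e) *
        star ((Pi.single 0 1 : Bits (Fin n) → ℂ) (y ∘ e)) *
        ρ (Function.extend e z x) (Function.extend e z y) := by
    intro z
    have h5 : ∀ a, N (Sum.elim x z) a
      = if a = Function.extend e z x then (Pi.single 0 1 : Bits (Fin n) → ℂ) (x ∘ e) else 0 :=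
      h2 x z
    have h6 : ∀ a, N (Sum.elim y z) a
      = if a = Function.extend e z y then (Pi.single 0 1 : Bits (Fin n) → ℂ) (y ∘ e) else 0 :=
      h2 y z
    simp only [Matrix.mul_apply, Matrix.conjTranspose_apply, h5, h6, ite_mul, zero_mul,
      Finset.sum_ite_eq', Finset.mem_univ, if_true, apply_ite star, star_zero, mul_ite, mul_zero]
    ring
  rw [reduce_apply]
  refine Eq.trans (Finset.sum_congr rfl fun u _ => ?_)
    ((sum_fiber_inl x fun z => (N * ρ * Nᴴ) (Sum.elim x z) (Sum.elim y z)).trans ?_)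
  · refine ite_congr rfl (fun hu => ?_) fun _ => rfl
    rw [h3, ← hu]
    conv_lhs => rw [elim_eta u]
    rfl
  · simp only [h4, ← Finset.mul_sum]
    rfl

/-- Preparing `U |0…0⟩`: the qubits are exchanged with fresh ones, to which `U` is applied. -/
theorem hasImpl_reset (e : Fin n ↪ V) {U : Op (Fin n)} (hU : U ∈ UQNCf d n) :
    HasImpl (Set.range e) ∅ ∅ (31 + 3 * d)
      (fun s ρ κ => κ s (reset e (U *ᵥ Pi.single 0 1) ρ)) := by
  have h1 := (hasProgram_swapAnc e (Function.Embedding.refl (Fin n))).hasImpl_of_ancillas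
    (S' := Set.range e) (f := reset e (Pi.single 0 1)) (by
      rintro v (⟨k, hk⟩ | ⟨k, hk⟩)
      · exact ⟨k, Sum.inl_injective hk⟩
      · cases hk) (reduce_swap_ket0 e)
  have h2 := (h1.comp (hasImpl_unitary e hU) (Set.disjoint_empty _)).congr
    (F' := fun s ρ κ => κ s (reset e (U *ᵥ Pi.single 0 1) ρ)) fun s ρ κ => by
      simp only [conj_embed_reset]
  rw [Set.union_empty] at h2
  exact h2.mono subset_rfl subset_rfl (by omega)

/-- Measurement of an observable that is diagonalised in constant depth: a qubit in the state `|+⟩`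
controls the observable and is then measured in the basis `|±⟩`. -/
theorem hasImpl_measure (e : Fin n ↪ V) {M : Op (Fin n)} (hM : M ∈ OQNCf d n)
    (hu : M * Mᴴ = 1) (k : ℕ) :
    HasImpl (Set.range e) {k} ∅ (31 + 6 * d) (fun s ρ κ =>
      ∑ b : Fin 2, κ (Function.update s k b) (conj (embed e (outcomeProj M b)) ρ)) := by
  obtain ⟨U, hU, θ, hθ⟩ := exists_diagonalization hM hu
  let e' : Fin n ↪ V ⊕ Unit := e.trans Function.Embedding.inl
  let S : Set (V ⊕ Unit) := insert (Sum.inr ()) (Set.range e')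
  have h1 := (hasImpl_instr (Instr.init {(Sum.inr () : V ⊕ Unit)})).mono (S' := S) (rd' := ∅)
    (c' := 1) (by simp [Instr.qubits, S]) subset_rfl le_rfl
  have h2 := hasImpl_ctrl e' (Sum.inr ()) (by rintro ⟨k, hk⟩; cases hk) hU θ hθ
  have h3 := (hasImpl_instr (Instr.meas (Sum.inr () : V ⊕ Unit) k)).mono (S' := S) (rd' := ∅)
    (c' := 1) (by simp [Instr.qubits, S]) subset_rfl le_rfl
  have h4 := (h1.comp (h2.comp h3 (Set.empty_disjoint _)) (Set.empty_disjoint _)).hide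
    (S' := Set.range e) (F' := fun s ρ κ =>
      ∑ b : Fin 2, κ (Function.update s k b) (conj (embed e (outcomeProj M b)) ρ)) ?_ ?_
  · have e1 : (Instr.init {(Sum.inr () : V ⊕ Unit)}).writes ∪
        (∅ ∪ (Instr.meas (Sum.inr () : V ⊕ Unit) k).writes) = {k} := by
      simp [Instr.writes]
    rw [e1] at h4
    exact h4.mono subset_rfl (by simp) (by omega)
  · rintro v (hv | ⟨i, hi⟩)
    · cases hv
    · exact ⟨i, Sum.inl_injective hi⟩
  · intro β _ s ρ κ
    simp only [Instr.runK, resetPlus_unit, reduce_prepare _ ketPlus_norm]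
    refine Finset.sum_congr rfl fun b _ => ?_
    rw [reduce_measure_ctrl]

/-- A correction that is diagonalised in constant depth: a qubit is put in the basis state given by
the outcomes, by a classically controlled `X`, and then controls the correction. -/
theorem hasImpl_correct (e : Fin n ↪ V) {M : Op (Fin n)} (hM : M ∈ OQNCf d n)
    (hu : M * Mᴴ = 1) (σ : Finset ℕ) :
    HasImpl (Set.range e) ∅ σ (31 + 6 * d) (fun s ρ κ =>
      κ s (conj (embed e (M ^ ((∑ k ∈ σ, s k : Fin 2) : ℕ))) ρ)) := by
  obtain ⟨U, hU, θ, hθ⟩ := exists_diagonalization hM hu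
  let e' : Fin n ↪ V ⊕ Unit := e.trans Function.Embedding.inl
  let S : Set (V ⊕ Unit) := insert (Sum.inr ()) (Set.range e')
  have h1 := (hasImpl_instr (Instr.init {(Sum.inr () : V ⊕ Unit)})).mono (S' := S) (rd' := ∅)
    (c' := 1) (by simp [Instr.qubits, S]) subset_rfl le_rfl
  have h2 := (hasImpl_instr (Instr.had (Sum.inr () : V ⊕ Unit))).mono (S' := S) (rd' := ∅)
    (c' := 1) (by simp [Instr.qubits, S]) subset_rfl le_rfl
  have h3 := (hasImpl_instr (Instr.flip (Sum.inr () : V ⊕ Unit) σ)).mono (S' := S) (rd' := σ)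
    (c' := 1) (by simp [Instr.qubits, S]) subset_rfl le_rfl
  have h4 := hasImpl_ctrl e' (Sum.inr ()) (by rintro ⟨k, hk⟩; cases hk) hU θ hθ
  have h5 := (h1.comp (h2.comp (h3.comp h4 (Set.disjoint_empty _)) (Set.empty_disjoint _))
    (Set.empty_disjoint _)).hide
    (S' := Set.range e) (F' := fun s ρ κ =>
      κ s (conj (embed e (M ^ ((∑ k ∈ σ, s k : Fin 2) : ℕ))) ρ)) ?_ ?_
  · have e1 : (Instr.init {(Sum.inr () : V ⊕ Unit)}).writes ∪
        ((Instr.had (Sum.inr () : V ⊕ Unit)).writes ∪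
          ((Instr.flip (Sum.inr () : V ⊕ Unit) σ).writes ∪ ∅)) = ∅ := by
      simp [Instr.writes]
    rw [e1] at h5
    exact h5.mono subset_rfl (by simp) (by omega)
  · rintro v (hv | ⟨i, hi⟩)
    · cases hv
    · exact ⟨i, Sum.inl_injective hi⟩
  · intro β _ s ρ κ
    simp only [Instr.runK, resetPlus_unit, conj_single_prepare]
    have h6 : ∀ b : Fin 2, (gateX ^ (b : ℕ)) *ᵥ (gateH *ᵥ ketPlus)
        = fun t => if t = b then 1 else 0 := by
      intro b
      have hfin : ∀ t b : Fin 2, t + b = 0 ↔ t = b := by decide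
      have h7 : gateH *ᵥ ketPlus = fun t => if t = 0 then 1 else 0 :=
        funext fun t => sum_gateH_mul_ketPlus t
      funext t
      rw [h7]
      simp only [Matrix.mulVec, dotProduct, XorNet.gateX_pow_apply, ite_mul, one_mul, zero_mul,
        Finset.sum_ite_eq', Finset.mem_univ, if_true, hfin]
    rw [h6, reduce_ctrl_basis]

end Steps

/-! ### Patterns of a scheme of constant depth -/

namespace CCCommand

variable {S : Scheme} {V : Type} [Fintype V] [DecidableEq V]

/-- The meaning of one command of a classically controlled pattern. -/
def sem : CCCommand S V → Sem V
  | init e φ _ => fun s ρ κ => κ s (reset e φ ρ)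
  | unitary e U _ => fun s ρ κ => κ s (conj (embed e U) ρ)
  | measure e M _ k => fun s ρ κ =>
      ∑ b : Fin 2, κ (Function.update s k b) (conj (embed e (outcomeProj M b)) ρ)
  | correct e C _ σ => fun s ρ κ =>
      κ s (conj (embed e (C ^ ((∑ k ∈ σ, s k : Fin 2) : ℕ))) ρ)

/-- The meaning of a sequence of commands. -/
def runK {β : Type} [AddCommMonoid β] : List (CCCommand S V) → (ℕ → Fin 2) → Op V →
    ((ℕ → Fin 2) → Op V → β) → β
  | [], s, ρ, κ => κ s ρ
  | p :: A, s, ρ, κ => p.sem s ρ fun s' ρ' => runK A s' ρ' κ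

theorem reduce_run {O : Type} (f : O ↪ V) (P : List (CCCommand S V)) (s : ℕ → Fin 2) (ρ : Op V) :
    reduce f (run P s ρ) = runK P s ρ fun _ ρ' => reduce f ρ' := by
  induction P generalizing s ρ with
  | nil => rfl
  | cons p P ih =>
    cases p with
    | init e φ h => exact ih _ _
    | unitary e U h => exact ih _ _
    | measure e M h k =>
      rw [run, reduce_sum]
      exact Finset.sum_congr rfl fun b _ => ih _ _
    | correct e C h σ => exact ih _ _

/-- Every command of a scheme of constant depth has constant cost. -/
theorem hasImpl {d : ℕ} (hd : ∀ n : ℕ,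
    S.states n ⊆ IQNCf d n ∧ S.unitaries n ⊆ UQNCf d n ∧
    S.measurements n ⊆ OQNCf d n ∧ S.corrections n ⊆ UQNCf d n ∩ OQNCf d n)
    (p : CCCommand S V) : HasImpl p.qubits p.writes p.reads (31 + 6 * d) p.sem := by
  cases p with
  | init e φ h =>
    obtain ⟨U, hU, rfl⟩ := (hd _).1 h
    exact (hasImpl_reset e hU).mono subset_rfl subset_rfl (by omega)
  | unitary e U h => exact (hasImpl_unitary e ((hd _).2.1 h)).mono subset_rfl subset_rfl (by omega)
  | measure e M h k =>
    refine hasImpl_measure e ((hd _).2.2.1 h) ?_ k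
    rw [S.measurements_hermitian _ M h, S.measurements_sq _ M h]
  | correct e C h σ =>
    refine hasImpl_correct e ((hd _).2.2.2 h).2 ?_ σ
    have h1 := S.corrections_unitary _ C h
    rwa [Matrix.mem_unitaryGroup_iff, Matrix.star_eq_conjTranspose] at h1

/-- A sequence of commands is implemented command by command; every command has its own
ancillas. -/
theorem exists_blocks {c : ℕ}
    (h : ∀ p : CCCommand S V, HasImpl p.qubits p.writes p.reads c p.sem)
    (P : List (CCCommand S V)) :
    ∃ (A : Type) (_ : Fintype A) (_ : DecidableEq A)
      (L : List (CCCommand S V × List (Instr (V ⊕ A)))),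
      L.map Prod.fst = P ∧
      (∀ b ∈ L, chainDepth Instr.Dep b.2 ≤ c) ∧
      (∀ b ∈ L, ∀ g ∈ b.2, (∀ v, Sum.inl v ∈ g.qubits → v ∈ b.1.qubits) ∧
        g.reads ⊆ b.1.reads ∧ g.writes ⊆ b.1.writes) ∧
      L.Pairwise (fun b b' => ∀ g ∈ b.2, ∀ g' ∈ b'.2, ∀ a,
        Sum.inr a ∈ g.qubits → Sum.inr a ∉ g'.qubits) ∧
      (∀ m, WF m P → Instr.WF m (L.flatMap Prod.snd)) ∧
      ∀ {β : Type} [AddCommMonoid β] (s : ℕ → Fin 2) (ρ : Op (V ⊕ A))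
        (κ : (ℕ → Fin 2) → Op V → β),
        Instr.runK (L.flatMap Prod.snd) s ρ (fun s' ρ' => κ s' (reduce .inl ρ'))
          = runK P s (reduce .inl ρ) κ := by
  induction P with
  | nil =>
    exact ⟨Empty, inferInstance, inferInstance, [], rfl, by simp, by simp, List.Pairwise.nil,
      fun _ _ => trivial, fun _ _ _ => rfl⟩
  | cons p P ih =>
    obtain ⟨A, _, _, Q, h1, h2, h3, h4, h5, h6⟩ := h p
    obtain ⟨A', _, _, L, i1, i2, i3, i4, i5, i6⟩ := ih
    let j : V ⊕ A ↪ V ⊕ (A ⊕ A') := (Function.Embedding.refl V).sumMap .inl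
    let j' : V ⊕ A' ↪ V ⊕ (A ⊕ A') := (Function.Embedding.refl V).sumMap .inr
    let f : CCCommand S V × List (Instr (V ⊕ A')) → CCCommand S V × List (Instr (V ⊕ (A ⊕ A'))) :=
      fun b => (b.1, b.2.map (Instr.map j'))
    have hf : (L.map f).flatMap Prod.snd = (L.flatMap Prod.snd).map (Instr.map j') := by
      rw [List.flatMap_map, List.map_flatMap]
    refine ⟨A ⊕ A', inferInstance, inferInstance, (p, Q.map (Instr.map j)) :: L.map f,
      ?_, ?_, ?_, ?_, ?_, ?_⟩
    · rw [List.map_cons, List.map_map]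
      exact congrArg (p :: ·) i1
    · intro b hb
      rcases List.mem_cons.1 hb with rfl | hb
      · exact (chainDepth_instr_map _ _).trans h5
      · obtain ⟨b, hb', rfl⟩ := List.mem_map.1 hb
        exact (chainDepth_instr_map _ _).trans (i2 b hb')
    · intro b hb g hg
      rcases List.mem_cons.1 hb with rfl | hb
      · obtain ⟨g, hg', rfl⟩ := List.mem_map.1 hg
        refine ⟨fun v hv => h1 g hg' v (inl_mem_qubits_map _ hv), ?_, ?_⟩
        · rw [Instr.reads_map]; exact h2 g hg'
        · rw [Instr.writes_map]; exact (Instr.writes_subset_names hg').trans h3.le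
      · obtain ⟨b, hb', rfl⟩ := List.mem_map.1 hb
        obtain ⟨g, hg', rfl⟩ := List.mem_map.1 hg
        obtain ⟨k1, k2, k3⟩ := i3 b hb' g hg'
        refine ⟨fun v hv => k1 v (inl_mem_qubits_map _ hv), ?_, ?_⟩
        · rw [Instr.reads_map]; exact k2
        · rw [Instr.writes_map]; exact k3
    · refine List.pairwise_cons.2 ⟨?_, List.pairwise_map.2 (i4.imp ?_)⟩
      · intro b hb g hg g' hg' a ha ha'
        obtain ⟨b, -, rfl⟩ := List.mem_map.1 hb
        obtain ⟨g, -, rfl⟩ := List.mem_map.1 hg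
        obtain ⟨g', -, rfl⟩ := List.mem_map.1 hg'
        rw [Instr.qubits_map] at ha ha'
        obtain ⟨v | x, -, hx⟩ := ha
        · cases hx
        obtain ⟨v | x', -, hx'⟩ := ha'
        · cases hx'
        have := Sum.inr_injective (hx.trans hx'.symm)
        cases this
      · intro b b' hbb g hg g' hg' a ha ha'
        obtain ⟨g, hg1, rfl⟩ := List.mem_map.1 hg
        obtain ⟨g', hg1', rfl⟩ := List.mem_map.1 hg'
        rw [Instr.qubits_map] at ha ha'
        obtain ⟨v | x, hx1, hx⟩ := ha
        · cases hx
        obtain ⟨v | x', hx1', hx'⟩ := ha'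
        · cases hx'
        obtain rfl : x = x' := Sum.inr_injective (Sum.inr_injective (hx.trans hx'.symm))
        exact hbb g hg1 g' hg1' x hx1 hx1'
    · rintro m ⟨k1, k2, k3⟩
      rw [List.flatMap_cons, hf, Instr.wf_append, Instr.names_map, h3]
      exact ⟨(h4 m k2 k1).map _, (i5 _ k3).map _⟩
    · intro β _ s ρ κ
      rw [List.flatMap_cons, hf, Instr.runK_append]
      simp only [j', runK_map_sumMap _ (F := runK P) i6]
      exact runK_map_sumMap _ (F := p.sem) h6 s ρ fun s' ρ' => runK P s' ρ' κ

end CCCommand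

/-- A scheme of constant depth is simulated by measurement patterns with a constant overhead in
depth. -/
theorem exists_pattern (S : Scheme) (hS : S.ConstantDepth) :
    ∃ c : ℕ, ∀ (V I O : Type) [Fintype V] [DecidableEq V] (P : CCPattern S V I O),
      ∃ (W : Type) (_ : Fintype W) (_ : DecidableEq W) (t : MPattern W I O),
        t.channel = P.channel ∧ t.depth ≤ c * P.depth := by
  obtain ⟨d, hd⟩ := hS
  refine ⟨8 * (31 + 6 * d), fun V I O _ _ P => ?_⟩
  classical
  have : Fintype I := Fintype.ofInjective P.inp P.inp.injective
  have : Fintype O := Fintype.ofInjective P.out P.out.injective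
  obtain ⟨A, _, _, L, h1, h2, h3, h4, h5, h6⟩ :=
    CCCommand.exists_blocks (CCCommand.hasImpl hd) P.cmds
  obtain ⟨T⟩ := exists_sim _ (h5 ∅ P.wf)
  let a : V ↪ V ⊕ A := Function.Embedding.inl
  have hout : ∀ (o : O) (α : ℝ), MCommand.M (P.out.trans (a.trans T.loc) o) α ∉ T.cmds :=
    fun o α hm => T.loc_notMem (a (P.out o)) ⟨_, hm, rfl⟩
  refine ⟨T.W, inferInstance, inferInstance,
    ⟨P.inp.trans (a.trans T.start), P.out.trans (a.trans T.loc), T.cmds, T.wf, hout⟩, ?_, ?_⟩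
  · funext ρ
    have h7 : ∀ ρ' : Op T.W, reduce (P.out.trans (a.trans T.loc)) ρ'
        = reduce P.out (reduce a (reduce T.loc ρ')) := fun ρ' => by
      rw [reduce_trans, reduce_trans]
    have h8 := T.sem (fun _ => (reduceHom P.out).comp (reduceHom a))
      (prepare a ketPlus (prepare P.inp ketPlus ρ))
    have h11 := MCommand.runK_of_const T.cmds 0
      (prepare T.start ketPlus (prepare a ketPlus (prepare P.inp ketPlus ρ)))
      (fun _ ρ' => reduce P.out (reduce a (reduce T.loc ρ')))
      (((reduceHom P.out).comp (reduceHom a)).comp (reduceHom T.loc)) fun _ _ _ => rfl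
    have h9 := h6 0 (prepare a ketPlus (prepare P.inp ketPlus ρ)) fun _ ρ' => reduce P.out ρ'
    rw [reduce_prepare _ ketPlus_norm, ← CCCommand.reduce_run] at h9
    -- measurement patterns start in `|+⟩`; the classically controlled pattern cannot tell
    have h10 := P.well_defined (prepare P.inp ketPlus ρ) (prepare P.inp ket0 ρ)
      (by rw [reduce_prepare _ ketPlus_norm, reduce_prepare _ ket0_norm])
    rw [MPattern.channel, CCPattern.channel, ← h10, h7, prepare_trans, prepare_trans]
    exact (h11.symm.trans h8).trans h9
  · have h7 := chainDepth_flatMap_le (dep := CCCommand.Dep) L h2 ?_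
    · rw [h1] at h7
      calc chainDepth MCommand.Dep T.cmds ≤ 8 * chainDepth Instr.Dep (L.flatMap Prod.snd) :=
            T.depth_cmds_le
        _ ≤ 8 * ((31 + 6 * d) * P.depth) := Nat.mul_le_mul_left 8 h7
        _ = 8 * (31 + 6 * d) * P.depth := (mul_assoc _ _ _).symm
    · refine (List.pairwise_iff_forall_sublist.2 ?_ :
        L.Pairwise fun b b' => ∀ p ∈ b.2, ∀ q ∈ b'.2, Instr.Dep p q → CCCommand.Dep b.1 b'.1)
      intro b b' hs g hg g' hg' hdep
      have hb : b ∈ L := hs.subset (by simp)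
      have hb' : b' ∈ L := hs.subset (by simp)
      rcases hdep with ⟨v | x, hx, hx'⟩ | ⟨k, hk, hk'⟩
      · exact Or.inl ⟨v, (h3 b hb g hg).1 v hx, (h3 b' hb' g' hg').1 v hx'⟩
      · exact absurd hx' ((List.pairwise_iff_forall_sublist.1 h4) hs g hg g' hg' x hx)
      · exact Or.inr ⟨k, (h3 b hb g hg).2.2 hk, (h3 b' hb' g' hg').2.1 hk'⟩

/-! ### The ancilla-driven model has constant depth -/

/-- A circuit without ancillas or discarded qubits implements its own operator; its length bounds
its depth. -/
theorem circuitOp_mem_UQNCf {n d : ℕ} (l : List (Gate (Fin n))) (h : l.length ≤ d) :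
    Gate.circuitOp l ∈ UQNCf d n := by
  refine ⟨?_, Fin n, inferInstance, inferInstance,
    ⟨Function.Embedding.refl _, Function.Embedding.refl _, l⟩,
    (chainDepth_le_length l).trans h, fun ρ => ?_⟩
  · rw [Matrix.mem_unitaryGroup_iff, Matrix.star_eq_conjTranspose]
    exact mul_eq_one_comm.1 (Gate.circuitOp_conjTranspose_mul l)
  · rw [Circuit.channel, prepare_refl, reduce_refl, Gate.foldl_conj]

theorem gateH_mul_self : gateH * gateH = 1 := by
  have h := gateH_mul
  rwa [gateH_conjTranspose] at h

theorem gateX_eq : gateX = gateH * (gateZ * gateH) := by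
  have h := sqrt_two_inv_mul_self
  ext a b
  fin_cases a <;> fin_cases b <;>
    simp [gateX, gateZ, gateH, Matrix.mul_apply, Fin.sum_univ_two, h] <;> norm_num

theorem gateRz_pi : gateRz Real.pi = gateZ := by
  simp [gateRz, gateZ, Complex.exp_pi_mul_I]

theorem gateZ_isDiag : gateZ.IsDiag := by
  intro a b hab
  fin_cases a <;> fin_cases b <;> simp_all [gateZ]

theorem isDiag_single {V : Type} [Fintype V] [DecidableEq V] (i : V)
    {A : Matrix (Fin 2) (Fin 2) ℂ} (h : A.IsDiag) : (single i A : Op V).IsDiag := by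
  intro x y hxy
  simp only [single, Matrix.of_apply]
  split_ifs with h1
  · refine h fun h2 => hxy (funext fun v => ?_)
    by_cases hv : v = i
    · rw [hv, h2]
    · exact h1 v hv
  · rfl

/-- `R_z(-α)` followed by `H` maps the basis `|±_α⟩` to the computational basis. -/
theorem isDiag_conj_obsAngle (α : ℝ) :
    (gateH * gateRz (-α) * obsAngle α * (gateH * gateRz (-α))ᴴ).IsDiag := by
  have hc : (starRingEnd ℂ) (Complex.exp (-(α * Complex.I))) = Complex.exp (α * Complex.I) := by
    rw [← Complex.exp_conj]; simp
  have he : Complex.exp (-(α * Complex.I)) * Complex.exp (α * Complex.I) = 1 := by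
    rw [← Complex.exp_add]; simp
  have he' : gateRz (-α) * obsAngle α = gateX * gateRz (-α) := by
    rw [obsAngle_eq]
    ext a b
    fin_cases a <;> fin_cases b <;>
      simp [gateRz, gateX, Matrix.mul_apply, Fin.sum_univ_two, he]
  have hR : gateRz (-α) * (gateRz (-α))ᴴ = 1 := by
    ext a b
    fin_cases a <;> fin_cases b <;>
      simp [gateRz, Matrix.mul_apply, Fin.sum_univ_two, hc, he]
  have h1 : gateH * gateRz (-α) * obsAngle α * (gateH * gateRz (-α))ᴴ = gateZ := by
    calc _ = gateH * (gateRz (-α) * obsAngle α) * ((gateRz (-α))ᴴ * gateHᴴ) := by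
            rw [Matrix.conjTranspose_mul, Matrix.mul_assoc gateH]
      _ = gateH * (gateX * ((gateRz (-α) * (gateRz (-α))ᴴ) * gateHᴴ)) := by
            rw [he']; simp only [Matrix.mul_assoc]
      _ = (gateH * gateH) * (gateZ * (gateH * gateH)) := by
            rw [hR, Matrix.one_mul, gateH_conjTranspose, gateX_eq]
            simp only [Matrix.mul_assoc]
      _ = gateZ := by rw [gateH_mul_self, Matrix.one_mul, Matrix.mul_one]
  rw [h1]
  exact gateZ_isDiag

/-- Depth 3 suffices: it is needed for the correction `X = H Z H`, where `Z = R_z(π)`. Scheme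
ingredients exist for `n ≤ 2` qubits only. -/
theorem ancillaDriven_constantDepth : ancillaDriven.ConstantDepth := by
  have hU1 : single 0 gateH ∈ UQNCf 3 1 := by
    have h := circuitOp_mem_UQNCf (n := 1) (d := 3) [.H 0] (by simp)
    rwa [Gate.circuitOp, Gate.circuitOp, Matrix.one_mul] at h
  refine ⟨3, fun n => ⟨?_, ?_, ?_, ?_⟩⟩
  · rcases n with _ | _ | n
    · rintro φ ⟨⟩
    · rintro φ hφ
      obtain rfl : φ = fun x => ketPlus (x 0) := hφ
      refine ⟨_, hU1, funext fun x => ?_⟩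
      rw [Matrix.mulVec_single_one, ketPlus_apply]
      change _ = single 0 gateH x 0
      rw [single, Matrix.of_apply,
        if_pos fun v hv => absurd (Subsingleton.elim (α := Fin 1) v 0) hv, gateH_apply]
      simp [sg]
    · rintro φ ⟨⟩
  · rcases n with _ | _ | _ | n
    · rintro U ⟨⟩
    · rintro U ⟨⟩
    · intro U hU
      obtain rfl : U = single 0 gateH * single 1 gateH * cz 0 1 := hU
      have h := circuitOp_mem_UQNCf (n := 2) (d := 3) [.CZ 0 1 (by decide), .H 1, .H 0] (by simp)
      simp only [Gate.circuitOp, Matrix.one_mul] at h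
      exact h
    · rintro U ⟨⟩
  · rcases n with _ | _ | n
    · rintro M ⟨⟩
    · rintro M ⟨α, -, rfl⟩
      have h := circuitOp_mem_UQNCf (n := 1) (d := 3) [.Rz 0 (-α), .H 0] (by simp)
      simp only [Gate.circuitOp, Matrix.one_mul, Gate.toOp, single_mul] at h
      refine ⟨_, h, ?_⟩
      rw [single_conjTranspose, single_mul, single_mul]
      exact isDiag_single 0 (isDiag_conj_obsAngle α)
    · rintro M ⟨⟩
  · rcases n with _ | _ | n
    · rintro C ⟨⟩
    · rintro C (rfl | rfl)
      · have h := circuitOp_mem_UQNCf (n := 1) (d := 3) [.Rz 0 Real.pi] (by simp)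
        simp only [Gate.circuitOp, Matrix.one_mul, Gate.toOp, gateRz_pi] at h
        refine ⟨h, 1, circuitOp_mem_UQNCf [] (by simp), ?_⟩
        rw [Matrix.one_mul, Matrix.conjTranspose_one, Matrix.mul_one]
        exact isDiag_single 0 gateZ_isDiag
      · have h := circuitOp_mem_UQNCf (n := 1) (d := 3) [.H 0, .Rz 0 Real.pi, .H 0] (by simp)
        simp only [Gate.circuitOp, Matrix.one_mul, Gate.toOp, gateRz_pi, single_mul,
          Matrix.mul_assoc, ← gateX_eq] at h
        refine ⟨h, _, hU1, ?_⟩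
        rw [single_conjTranspose, single_mul, single_mul, gateH_conjTranspose, gateX_eq,
          ← Matrix.mul_assoc gateH gateH, gateH_mul_self, Matrix.one_mul, Matrix.mul_assoc,
          gateH_mul_self, Matrix.mul_one]
        exact isDiag_single 0 gateZ_isDiag
    · rintro C ⟨⟩

end MBQC

end

theorem mainTheorem4 :
    (∀ S : MBQC.Scheme, S.ConstantDepth →
      ∃ c : ℕ, ∀ (V I O : Type) [Fintype V] [DecidableEq V] (P : MBQC.CCPattern S V I O),
        ∃ (W : Type) (_ : Fintype W) (_ : DecidableEq W) (t : MBQC.MPattern W I O),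
          t.channel = P.channel ∧ t.depth ≤ c * P.depth) ∧
    (∃ c : ℕ, ∀ (V I O : Type) [Fintype V] [DecidableEq V]
        (P : MBQC.CCPattern MBQC.ancillaDriven V I O),
        ∃ (W : Type) (_ : Fintype W) (_ : DecidableEq W) (t : MBQC.MPattern W I O),
          t.channel = P.channel ∧ t.depth ≤ c * P.depth) := by
  exact ⟨fun S hS => MBQC.exists_pattern S hS,
    MBQC.exists_pattern _ MBQC.ancillaDriven_constantDepth⟩
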